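/- Let $G$ be a locally compact (Hausdorff) group with identity $e$ and a fixed left Haar measure $dx$. Let $\omega$ be a weight function on $G$, that is, a continuous function $\omega:G\to[1,\infty)$ with $\omega(e)=1$ and $\omega(xy)\le\omega(x)\omega(y)$ for all $x,y\in G$, and put $\omega^*(x)=\omega(x)\,\omega(x^{-1})$, which is again a weight function. For a weight function $\sigma$ on $G$, let $L^1(G,\sigma)$ be the Banach algebra of (classes of) measurable $f:G\to\mathbb C$ with $\|f\|_\sigma=\int_G|f|\sigma\,dx<\infty$, with the convolution product $(f*g)(x)=\int_G f(y)g(y^{-1}x)\,dy$. A Banach algebra $A$ is called weakly amenable if every continuous linear $\Delta:A\to A^*$ with $\Delta(ab)=\Delta(a)\cdot b+a\cdot \Delta(b)$ for all $a,b\in A$ is of the form $\Delta(a)=z\cdot a-a\cdot z$ for some $z\in A^*$; here $\langle z\cdot a,c\rangle=\langle z,ac\rangle$ and $\langle a\cdot z,c\rangle=\langle z,ca\rangle$. "Almost all" below means locally almost all with respect to Haar measure of $G$, $G^2$ or $G^3$, that is, up to a set whose intersection with every compact set is null (for $\sigma$-compact $G$ this is the usual notion), and functions on $G\times G$ that agree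 almost everywhere are identified. A Borel measurable $p:G\times G\to\mathbb C$ is called quasi-additive if $p(xy,z)=p(x,yz)+p(y,zx)$ for almost all $(x,y,z)$. For a weight function $\sigma$, let $D(G,\sigma)$ be the set of classes of quasi-additive $p$ with $$\sup_{x,y\in G}\frac{|p(x,y)|}{\sigma(x)\sigma(y)}<\infty,$$ and let $I(G,\sigma)$ be the set of classes of quasi-additive $p$ for which there is a Borel function $h:G\to\mathbb C$ with $h/\sigma$ essentially bounded and $p(x,y)=h(xy)-h(yx)$ for almost all $(x,y)$. Then the following statements hold. (i) If $\omega^*$ is bounded, then $L^1(G,\omega)$ is weakly amenable and $D(G,\omega^*)=I(G,\omega^*)$. (ii) If $L^1(G,\omega^*)$ is weakly amenable and $I(G,\omega)=I(G,\omega^*)$, then $L^1(G,\omega)$ is weakly amenable and $D(G,\omega)=D(G,\omega^*)$; if moreover $G$ is Abelian, then $D(G,\omega)=\{0\}$. (iii) If $D(G,\omega^*)=I(G,\omega^*)=I(G,\omega)$, then $D(G,\omega)=I(G,\omega)$. -/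

import Mathlib

namespace Beurling

open MeasureTheory Filter

/-! ## Weak amenability -/

section WeakAmenability

variable {A : Type*} [NormedAddCommGroup A] [NormedSpace ℂ A]

/-- `D : A → A*` is a (continuous) derivation for the product `mul` of the Banach algebra `A`:
`D (a b) = D a · b + a · D b`, where `A*` carries the usual `A`-bimodule structure
`⟨z · a, c⟩ = ⟨z, a c⟩` and `⟨a · z, c⟩ = ⟨z, c a⟩`. -/
def IsDerivation (mul : A → A → A) (D : A →L[ℂ] (A →L[ℂ] ℂ)) : Prop :=
  ∀ a b c : A, D (mul a b) c = D a (mul b c) + D b (mul c a)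

/-- `D` is the inner derivation `a ↦ z · a - a · z` for some `z ∈ A*`. -/
def IsInnerDerivation (mul : A → A → A) (D : A →L[ℂ] (A →L[ℂ] ℂ)) : Prop :=
  ∃ z : A →L[ℂ] ℂ, ∀ a c : A, D a c = z (mul a c) - z (mul c a)

end WeakAmenability

/-- The Banach algebra `A` with product `mul` is weakly amenable: every continuous derivation
from `A` into `A*` is inner. (Conversely, every `z · a - a · z` is a derivation.) -/
def IsWeaklyAmenable (A : Type*) [NormedAddCommGroup A] [NormedSpace ℂ A]
    (mul : A → A → A) : Prop :=
  ∀ D : A →L[ℂ] (A →L[ℂ] ℂ), IsDerivation mul D → IsInnerDerivation mul D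

/-! ## Weights and Beurling algebras -/

section Weights

variable {G : Type*} [Group G]

/-- Weight functions: continuous, submultiplicative, with values in `[1, ∞)`, and `ω e = 1`. -/
structure IsWeight [TopologicalSpace G] (ω : G → ℝ) : Prop where
  continuous : Continuous ω
  one_le : ∀ x, 1 ≤ ω x
  mul_le : ∀ x y, ω (x * y) ≤ ω x * ω y
  map_one : ω 1 = 1

/-- `ω* (x) = ω (x) ω (x⁻¹)`. -/
def star (ω : G → ℝ) (x : G) : ℝ := ω x * ω x⁻¹

variable [MeasurableSpace G]

/-- The measure `ω(x) dx`. -/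
noncomputable def weightedMeasure (μ : Measure G) (ω : G → ℝ) : Measure G :=
  μ.withDensity fun x => ENNReal.ofReal (ω x)

/-- `L¹(G, ω)`: classes of measurable `f` with `∫ |f| ω dμ < ∞`, normed by this integral. -/
abbrev L1 (μ : Measure G) (ω : G → ℝ) : Type _ := Lp ℂ 1 (weightedMeasure μ ω)

open Classical in
/-- The convolution `(f * g)(x) = ∫ f(y) g(y⁻¹ x) dy` on `L¹(G, ω)`. For a weight `ω` and a Haar
measure `μ` this function is again in `L¹(G, ω)`, so that the value `0` is never used. -/
noncomputable def conv (μ : Measure G) (ω : G → ℝ) (f g : L1 μ ω) : L1 μ ω :=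
  if h : MemLp (fun x => ∫ y, f y * g (y⁻¹ * x) ∂μ) 1 (weightedMeasure μ ω) then h.toLp else 0

/-- `L¹(G, ω)` with convolution is weakly amenable. -/
def L1WeaklyAmenable (μ : Measure G) (ω : G → ℝ) : Prop :=
  IsWeaklyAmenable (L1 μ ω) (conv μ ω)

end Weights

/-! ## Quasi-additive functions -/

/-- The filter of locally co-null sets of a locally compact group `H`: a property holds locally
almost everywhere if it holds almost everywhere, for the Haar measure of `H` on its Borel sets, on
each compact set. On a σ-compact group this is the same as almost everywhere. -/
noncomputable def locallyAE (H : Type*) [Group H] [TopologicalSpace H] [IsTopologicalGroup H]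
    [LocallyCompactSpace H] : Filter H :=
  letI : MeasurableSpace H := borel H
  haveI : BorelSpace H := ⟨rfl⟩
  ⨆ (K : Set H) (_ : IsCompact K), ae ((Measure.haar : Measure H).restrict K)

section QuasiAdditive

variable {G : Type*} [Group G] [TopologicalSpace G] [IsTopologicalGroup G] [LocallyCompactSpace G]

/-- `h ∈ L^∞(G, 1/ω)`: `h` is Borel and `h/ω` is essentially bounded. -/
def MemLinf (ω : G → ℝ) (h : G → ℂ) : Prop :=
  Measurable[borel G] h ∧ ∃ C : ℝ, ∀ᶠ x in locallyAE G, ‖h x‖ / ω x ≤ C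

/-- Borel functions `p` on `G × G` with `p(xy, z) = p(x, yz) + p(y, zx)` for almost all
`(x, y, z)`. -/
def IsQuasiAdditive (p : G × G → ℂ) : Prop :=
  Measurable[borel (G × G)] p ∧
    ∀ᶠ t : G × G × G in locallyAE (G × G × G),
      p (t.1 * t.2.1, t.2.2) = p (t.1, t.2.1 * t.2.2) + p (t.2.1, t.2.2 * t.1)

/-- The quasi-additive function `p` is inner: `p(x, y) = h(xy) - h(yx)` for almost all `(x, y)`,
for some `h ∈ L^∞(G, 1/ω)`. -/
def IsInnerQuasiAdditive (ω : G → ℝ) (p : G × G → ℂ) : Prop :=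
  IsQuasiAdditive p ∧ ∃ h : G → ℂ, MemLinf ω h ∧
    ∀ᶠ t : G × G in locallyAE (G × G), p t = h (t.1 * t.2) - h (t.2 * t.1)

/-- Functions on `G × G` modulo equality locally almost everywhere. -/
abbrev FunClass (G : Type*) [Group G] [TopologicalSpace G] [IsTopologicalGroup G]
    [LocallyCompactSpace G] : Type _ := Germ (locallyAE (G × G)) ℂ

/-- The class of a function on `G × G`. -/
noncomputable def toClass (p : G × G → ℂ) : FunClass G := (p : Germ (locallyAE (G × G)) ℂ)

/-- `D(G, ω)`: the quasi-additive functions `p` with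
`sup_{x, y} |p(x, y)| / (ω(x) ω(y)) < ∞`, modulo equality almost everywhere. -/
def D (ω : G → ℝ) : Set (FunClass G) :=
  toClass '' {p | IsQuasiAdditive p ∧ ∃ C : ℝ, ∀ x y : G, ‖p (x, y)‖ / (ω x * ω y) ≤ C}

/-- `I(G, ω)`: the inner quasi-additive functions, modulo equality almost everywhere. -/
def I (ω : G → ℝ) : Set (FunClass G) :=
  toClass '' {p | IsInnerQuasiAdditive ω p}

end QuasiAdditive

end Beurling

open MeasureTheory Filter Topology Set CompactlySupported

set_option linter.unusedSectionVars false

namespace Beurling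

/-! The statement rests on two facts.

First, L¹(G, ω) is weakly amenable exactly when `D ω ⊆ I ω`, while `I ω ⊆ D ω` always holds
(`I_subset_D`). A derivation is a bounded bilinear form on L¹(G, ω), hence a bounded functional on
the weighted L¹ space of G × G, hence integration against some p with |p(x, y)| ≤ C ω(x) ω(y).
Tested on a ⊗ b ⊗ c, the derivation identity is quasi-additivity of p
(`IsProdHaar.integral_quasiAdditive_defect`); the derivation is inner, with z given by h, exactly
when p(x, y) = h(xy) - h(yx) (`IsProdHaar.integral_coboundary_mul`). The two directions are
`L1WeaklyAmenable.D_subset_I` and `l1WeaklyAmenable_of_D_subset_I`.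

Second, bounded quasi-additive functions are inner; this is Johnson's theorem that L¹(G) is weakly
amenable. Put c_x(t) = p(x, x⁻¹t). Quasi-additivity with z = (xy)⁻¹t reads c_{xy}(t) = c_x(t) +
c_y(x⁻¹tx). For real p, taking suprema over y shows that h = sup_y c_y satisfies h(t) = c_x(t) +
h(x⁻¹tx), which says p(x, y) = h(xy) - h(yx). Since p matters only up to locally null sets, the c_x
are replaced by averages against probability densities (`IsProdHaar.exists_primitive`,
`IsProdHaar.exists_coboundary_real`).

The rest is the chain `I ω ⊆ D ω ⊆ D (star ω)`, valid because ω ≤ ω*. If ω* is bounded, the classes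
in `D (star ω)` come from bounded functions and so lie in both `I ω` and `I (star ω)`. In (ii) and
(iii) the hypotheses put `D (star ω)` inside `I ω`, which closes the chain. For Abelian G every
coboundary vanishes.

The group need not be σ-compact or second countable. The Borel sets of G × G may then exceed the
product σ-algebra, so its Haar measure is built as a Riesz measure; identities are tested on
compactly supported continuous functions; and densities of functionals are glued over the cosets of
an open σ-compact subgroup (`exists_density_of_le`). -/

lemma exists_cutoff {X : Type*} [TopologicalSpace X] [T2Space X] [LocallyCompactSpace X] {K : Set X} (hK : IsCompact K) :
    ∃ χ : X → ℝ, Continuous χ ∧ HasCompactSupport χ ∧ (∀ x ∈ K, χ x = 1) ∧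
      ∀ x, 0 ≤ χ x ∧ χ x ≤ 1 := by
  obtain ⟨f, h1, -, h3, h4⟩ := exists_continuous_one_zero_of_isCompact hK isClosed_empty
    (disjoint_empty _)
  exact ⟨f, f.continuous, h3, fun x hx => h1 hx, fun x => h4 x⟩

/-! ### Locally null sets and testing against compactly supported continuous functions -/

section LocallyAE

variable {X : Type*} [TopologicalSpace X] [MeasurableSpace X]

/-- The filter of sets that are locally co-null for the measure `ν`. -/
noncomputable def lae (ν : Measure X) : Filter X :=
  ⨆ (K : Set X) (_ : IsCompact K), ae (ν.restrict K)

lemma eventually_lae {ν : Measure X} {P : X → Prop} :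
    (∀ᶠ x in lae ν, P x) ↔ ∀ K, IsCompact K → ∀ᵐ x ∂ν.restrict K, P x := by
  simp only [lae, eventually_iSup]

/-- Regular Haar measures differ by a scalar, so each is absolutely continuous with respect to the
other. The Haar measure fixed in the definition can therefore be exchanged for any other regular
one, in particular for the Riesz measures built below. -/
lemma locallyAE_eq_lae {H : Type*} [Group H] [TopologicalSpace H] [IsTopologicalGroup H]
    [LocallyCompactSpace H] [mH : MeasurableSpace H] [hH : BorelSpace H] (ν : Measure H)
    [ν.IsHaarMeasure] [ν.Regular] : locallyAE H = lae ν := by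
  obtain rfl : mH = borel H := hH.measurable_eq
  let _ : MeasurableSpace H := borel H
  have e : ν = Measure.haarScalarFactor ν Measure.haar • Measure.haar :=
    Measure.isMulLeftInvariant_eq_smul_of_regular ν Measure.haar
  have e' : (Measure.haar : Measure H)
      = Measure.haarScalarFactor Measure.haar ν • ν :=
    Measure.isMulLeftInvariant_eq_smul_of_regular Measure.haar ν
  have a1 : ν ≪ Measure.haar := by
    conv_lhs => rw [e]
    exact Measure.smul_absolutelyContinuous
  have a2 : (Measure.haar : Measure H) ≪ ν := by
    conv_lhs => rw [e']
    exact Measure.smul_absolutelyContinuous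
  refine iSup_congr fun K => iSup_congr fun _ => le_antisymm ?_ ?_
  · exact (a2.restrict K).ae_le
  · exact (a1.restrict K).ae_le

variable {𝕜 : Type*} [RCLike 𝕜]

/-- Measurable functions that are dominated by a continuous function. -/
structure LocBdd (u : X → 𝕜) : Prop where
  measurable : Measurable u
  bound : ∃ w : X → ℝ, Continuous w ∧ ∀ x, ‖u x‖ ≤ w x

namespace LocBdd

lemma of_bounded {u : X → 𝕜} (h : Measurable u) {C : ℝ} (hC : ∀ x, ‖u x‖ ≤ C) : LocBdd u :=
  ⟨h, fun _ => C, continuous_const, hC⟩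

lemma sub {u v : X → 𝕜} (hu : LocBdd u) (hv : LocBdd v) : LocBdd (fun x => u x - v x) := by
  obtain ⟨w, hw, h⟩ := hu.bound
  obtain ⟨w', hw', h'⟩ := hv.bound
  exact ⟨hu.measurable.sub hv.measurable, fun x => w x + w' x, hw.add hw', fun x =>
    (norm_sub_le _ _).trans (add_le_add (h x) (h' x))⟩

lemma comp {Y : Type*} [TopologicalSpace Y] [MeasurableSpace Y] [BorelSpace X] [BorelSpace Y]
    {u : Y → 𝕜} (hu : LocBdd u) {m : X → Y} (hm : Continuous m) : LocBdd (fun x => u (m x)) := by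
  obtain ⟨w, hw, h⟩ := hu.bound
  exact ⟨hu.measurable.comp hm.measurable, fun x => w (m x), hw.comp hm, fun x => h _⟩

lemma of_continuous [BorelSpace X] {u : X → 𝕜} (hu : Continuous u) : LocBdd u :=
  ⟨hu.measurable, fun x => ‖u x‖, hu.norm, fun _ => le_rfl⟩

lemma integrable [BorelSpace X] {u F : X → 𝕜} (hu : LocBdd u) (hF : Continuous F)
    (hF' : HasCompactSupport F) (ν : Measure X) [IsFiniteMeasureOnCompacts ν] :
    Integrable (fun x => u x * F x) ν := by
  obtain ⟨w, hw, h⟩ := hu.bound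
  have hi : Integrable (fun x => w x * ‖F x‖) ν :=
    (hw.mul hF.norm).integrable_of_hasCompactSupport (hF'.norm.mul_left)
  refine hi.mono' (hu.measurable.mul hF.measurable).aestronglyMeasurable (ae_of_all _ fun x => ?_)
  rw [norm_mul]
  exact mul_le_mul_of_nonneg_right (h x) (norm_nonneg _)

end LocBdd

lemma integral_mul_congr_lae [T2Space X] [BorelSpace X] {ν : Measure X} {u v : X → 𝕜}
    (h : ∀ᶠ x in lae ν, u x = v x) {F : X → 𝕜} (hF : HasCompactSupport F) :
    ∫ x, u x * F x ∂ν = ∫ x, v x * F x ∂ν := by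
  refine integral_congr_ae ?_
  have := (ae_restrict_iff' (hF.isCompact.isClosed.measurableSet)).1 (eventually_lae.1 h _ hF)
  filter_upwards [this] with x hx
  by_cases hxF : x ∈ tsupport F
  · simp only [hx hxF]
  · simp [image_eq_zero_of_notMem_tsupport hxF]

/-- Regularity squeezes a set of finite measure between a compact set inside it and an open
neighbourhood of that compact set; a cutoff between these two approximates the indicator. Only
Urysohn functions for compact sets occur, so neither normality nor σ-compactness is needed. -/
lemma exists_hasCompactSupport_integral_sub_le [T2Space X] [LocallyCompactSpace X] [BorelSpace X]
    {E : Type*} [NormedAddCommGroup E] [NormedSpace ℝ E] {ν : Measure X} [ν.Regular] {f : X → E}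
    (hf : Integrable f ν) {ε : ℝ} (hε : 0 < ε) :
    ∃ g : X → E, HasCompactSupport g ∧ ∫ x, ‖f x - g x‖ ∂ν ≤ ε ∧ Continuous g ∧
      Integrable g ν := by
  have H : ∃ g : X → E, eLpNorm (f - g) 1 ν ≤ ENNReal.ofReal ε ∧
      (Continuous g ∧ HasCompactSupport g ∧ MemLp g 1 ν) := by
    refine (memLp_one_iff_integrable.2 hf).induction_dense ENNReal.one_ne_top
      (fun g => Continuous g ∧ HasCompactSupport g ∧ MemLp g 1 ν) ?_ ?_ ?_ (by simpa using hε)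
    · intro c t ht htν ε hε
      obtain ⟨δ, δpos, hδ⟩ := exists_Lp_half E ν 1 hε
      obtain ⟨η, ηpos, hη⟩ : ∃ η : NNReal, 0 < η ∧ ∀ s : Set X, ν s ≤ η →
          eLpNorm (s.indicator fun _x => c) 1 ν ≤ δ :=
        exists_eLpNorm_indicator_le ENNReal.one_ne_top c δpos.ne'
      have ηpos' : (0 : ENNReal) < η := ENNReal.coe_pos.2 ηpos
      obtain ⟨s, st, s_compact, s_closed, νs⟩ :
          ∃ s, s ⊆ t ∧ IsCompact s ∧ IsClosed s ∧ ν (t \ s) < η :=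
        ht.exists_isCompact_isClosed_sdiff_lt htν.ne ηpos'.ne'
      obtain ⟨V, sV, V_open, -, hV⟩ : ∃ V ⊇ s, IsOpen V ∧ ν V < ⊤ ∧ ν (V \ s) < η :=
        s_closed.measurableSet.exists_isOpen_sdiff_lt s_compact.measure_lt_top.ne ηpos'.ne'
      obtain ⟨g, g1, g0, gs, gb⟩ := exists_continuous_one_zero_of_isCompact s_compact
        V_open.isClosed_compl (disjoint_compl_right_iff_subset.2 sV)
      have gc : Continuous fun x => g x • c := g.continuous.smul continuous_const
      have gcs : HasCompactSupport fun x => g x • c := gs.smul_right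
      have gm : MemLp (fun x => g x • c) 1 ν :=
        memLp_one_iff_integrable.2 (gc.integrable_of_hasCompactSupport gcs)
      refine ⟨fun x => g x • c, ?_, gc, gcs, gm⟩
      have I1 : eLpNorm ((s.indicator fun _y => c) - t.indicator fun _y => c) 1 ν ≤ δ := by
        rw [← eLpNorm_neg, neg_sub, ← indicator_sdiff st]
        exact hη _ νs.le
      have I2 : eLpNorm ((fun x => g x • c) - s.indicator fun _y => c) 1 ν ≤ δ := by
        refine (eLpNorm_mono fun x => ?_).trans (hη _ hV.le)
        by_cases hs : x ∈ s
        · simp [hs, g1 hs]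
        by_cases hv : x ∈ V
        · have : ‖g x • c‖ ≤ ‖c‖ := by
            rw [norm_smul, Real.norm_eq_abs, abs_of_nonneg (gb x).1]
            exact mul_le_of_le_one_left (norm_nonneg _) (gb x).2
          simpa [hs, hv] using this
        · have : g x = 0 := g0 hv
          simp [hs, hv, this]
      have := (hδ _ _ (gm.aestronglyMeasurable.sub
        (aestronglyMeasurable_const.indicator s_closed.measurableSet))
        ((aestronglyMeasurable_const.indicator s_closed.measurableSet).sub
          (aestronglyMeasurable_const.indicator ht)) I2 I1).le
      simpa only [sub_add_sub_cancel] using this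
    · rintro f g ⟨f1, f2, f3⟩ ⟨g1, g2, g3⟩
      exact ⟨f1.add g1, f2.add g2, f3.add g3⟩
    · rintro f ⟨-, -, h⟩
      exact h.aestronglyMeasurable
  obtain ⟨g, hg, gc, gs, gm⟩ := H
  have gi := memLp_one_iff_integrable.1 gm
  refine ⟨g, gs, ?_, gc, gi⟩
  have e : eLpNorm (f - g) 1 ν = ENNReal.ofReal (∫ x, ‖f x - g x‖ ∂ν) := by
    rw [eLpNorm_one_eq_lintegral_enorm, ← ofReal_integral_norm_eq_lintegral_enorm (hf.sub gi)]
    rfl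
  rw [e] at hg
  exact (ENNReal.ofReal_le_ofReal_iff hε.le).1 hg

/-- With c a cutoff equal to 1 on the compact set K, the function uc is bounded and integrable. Its
conjugate v is an L¹ limit of test functions g, and each cg is again a test function, so ∫ |uc|² is
a limit of integrals ∫ u (cg) = 0. -/
lemma lae_eq_zero_of_integral [T2Space X] [LocallyCompactSpace X] [BorelSpace X] {ν : Measure X}
    [ν.Regular] {u : X → 𝕜} (hu : LocBdd u)
    (h : ∀ F : X → 𝕜, Continuous F → HasCompactSupport F → ∫ x, u x * F x ∂ν = 0) :
    ∀ᶠ x in lae ν, u x = 0 := by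
  rw [eventually_lae]
  intro K hK
  obtain ⟨χ, χc, χs, χ1, χb⟩ := exists_cutoff hK
  set c : X → 𝕜 := fun x => (χ x : 𝕜) with hc
  have cc : Continuous c := RCLike.continuous_ofReal.comp χc
  have cs : HasCompactSupport c := χs.comp_left (g := fun r : ℝ => (r : 𝕜)) (by simp)
  have hi := hu.integrable cc cs ν
  set v : X → 𝕜 := fun x => (starRingEnd 𝕜) (u x * c x) with hv
  have hvi : Integrable v ν := by
    refine hi.norm.mono' ?_ (ae_of_all _ fun x => by simp [hv])
    exact (RCLike.continuous_conj.measurable.comp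
      (hu.measurable.mul cc.measurable)).aestronglyMeasurable
  obtain ⟨w, hw, hb⟩ := hu.bound
  obtain ⟨M, hM⟩ : ∃ M : ℝ, ∀ x, ‖u x * c x‖ ≤ M := by
    obtain ⟨M, hM⟩ := (hw.mul χc).bounded_above_of_compact_support (χs.mul_left)
    refine ⟨M, fun x => le_trans ?_ (hM x)⟩
    rw [Pi.mul_apply, norm_mul, norm_mul]
    have e : ‖c x‖ = ‖χ x‖ := by simp [hc]
    rw [e]
    exact mul_le_mul_of_nonneg_right ((hb x).trans (le_abs_self _)) (norm_nonneg _)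
  have hzero : ∫ x, (u x * c x) * v x ∂ν = 0 := by
    rw [← norm_le_zero_iff]
    refine le_of_forall_pos_le_add fun ε hε => ?_
    have hM1 : 0 < |M| + 1 := by positivity
    -- The error is scaled by the sup bound of uc; the extra 1 keeps the denominator positive.
    obtain ⟨g, gs, hg, gc, gi⟩ := exists_hasCompactSupport_integral_sub_le hvi (div_pos hε hM1)
    have e1 : ∫ x, (u x * c x) * g x ∂ν = 0 := by
      simpa only [mul_assoc] using h (fun x => c x * g x) (cc.mul gc) (cs.mul_right)
    have i1 : Integrable (fun x => (u x * c x) * g x) ν := by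
      simpa only [mul_assoc] using
        hu.integrable (F := fun x => c x * g x) (cc.mul gc) (cs.mul_right) ν
    have i2 : Integrable (fun x => (u x * c x) * v x) ν :=
      hvi.bdd_mul (c := M) (hu.measurable.mul cc.measurable).aestronglyMeasurable
        (ae_of_all _ hM)
    have e2 : ∫ x, (u x * c x) * v x ∂ν = ∫ x, (u x * c x) * (v x - g x) ∂ν := by
      simp only [mul_sub]
      rw [integral_sub i2 i1, e1, sub_zero]
    rw [e2, zero_add]
    calc ‖∫ x, (u x * c x) * (v x - g x) ∂ν‖ ≤ ∫ x, ‖(u x * c x) * (v x - g x)‖ ∂ν :=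
          norm_integral_le_integral_norm _
      _ ≤ ∫ x, (|M| + 1) * ‖v x - g x‖ ∂ν := by
          refine integral_mono_of_nonneg (ae_of_all _ fun x => norm_nonneg _)
            ((hvi.sub gi).norm.const_mul _) (ae_of_all _ fun x => ?_)
          simp only [norm_mul (u x * c x)]
          exact mul_le_mul_of_nonneg_right (by linarith [hM x, le_abs_self M]) (norm_nonneg _)
      _ = (|M| + 1) * ∫ x, ‖v x - g x‖ ∂ν := integral_const_mul _ _
      _ ≤ (|M| + 1) * (ε / (|M| + 1)) := by gcongr
      _ = ε := by field_simp
  have e3 : ∀ x, (u x * c x) * v x = ((‖u x * c x‖ ^ 2 : ℝ) : 𝕜) := fun x => by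
    simp only [hv, RCLike.mul_conj, RCLike.ofReal_pow]
  simp only [e3] at hzero
  rw [integral_ofReal, RCLike.ofReal_eq_zero] at hzero
  have hsq : Integrable (fun x => ‖u x * c x‖ ^ 2) ν := by
    refine (hi.norm.const_mul M).mono' ((hu.measurable.mul cc.measurable).norm.pow_const
      2).aestronglyMeasurable (ae_of_all _ fun x => ?_)
    rw [Real.norm_eq_abs, abs_of_nonneg (by positivity), sq]
    exact mul_le_mul_of_nonneg_right (hM x) (norm_nonneg _)
  rw [integral_eq_zero_iff_of_nonneg (fun x => by positivity) hsq] at hzero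
  rw [ae_restrict_iff' hK.isClosed.measurableSet]
  filter_upwards [hzero] with x hx hxK
  have : c x = 1 := by simp [hc, χ1 x hxK]
  simpa [this] using hx

end LocallyAE

/-! ### Compact supports and integrals over sections -/

lemma hasCompactSupport_tensor {X Y : Type*} [TopologicalSpace X] [TopologicalSpace Y]
    [T2Space X] [T2Space Y] {R : Type*} [MulZeroClass R] {f : X → R}
    {g : Y → R} (hf : HasCompactSupport f) (hg : HasCompactSupport g) :
    HasCompactSupport fun v : X × Y => f v.1 * g v.2 := by
  refine HasCompactSupport.intro (hf.isCompact.prod hg.isCompact) fun v hv => ?_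
  by_contra h
  exact hv ⟨subset_tsupport _ (left_ne_zero_of_mul h), subset_tsupport _ (right_ne_zero_of_mul h)⟩

/-- A point where the composite does not vanish is recovered by θ' from a point of the support of F,
so the support lies in a compact image. For each change of variables below only this continuous
recovery map has to be exhibited. -/
lemma hasCompactSupport_comp_of_leftInverse {X Y E : Type*} [TopologicalSpace X] [T2Space X]
    [TopologicalSpace Y] [Zero E] {F : Y → E}
    (hF : HasCompactSupport F) {θ : X → Y} {θ' : Y → X} (hθ' : Continuous θ')
    (h : ∀ x, θ' (θ x) = x) : HasCompactSupport fun x => F (θ x) :=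
  HasCompactSupport.intro (hF.isCompact.image hθ') fun x hx => by
    by_contra hne
    exact hx ⟨θ x, subset_tsupport _ hne, h x⟩

section Sections

variable {X Y E : Type*} [TopologicalSpace X] [TopologicalSpace Y] [NormedAddCommGroup E]

lemma hasCompactSupport_section [T2Space Y] {F : X × Y → E} (hF' : HasCompactSupport F) (x : X) :
    HasCompactSupport fun y => F (x, y) := by
  refine HasCompactSupport.intro (hF'.isCompact.image continuous_snd) fun y hy => ?_
  by_contra h
  exact hy ⟨(x, y), subset_tsupport _ h, rfl⟩

variable [NormedSpace ℝ E] [MeasurableSpace Y] [BorelSpace Y]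

lemma hasCompactSupport_integral_section [T2Space X] {F : X × Y → E} (hF' : HasCompactSupport F)
    (ρ : Measure Y) : HasCompactSupport fun x => ∫ y, F (x, y) ∂ρ := by
  refine HasCompactSupport.intro (hF'.isCompact.image continuous_fst) fun x hx => ?_
  have : ∀ y, F (x, y) = 0 := fun y => by
    by_contra h
    exact hx ⟨(x, y), subset_tsupport _ h, rfl⟩
  simp [this]

lemma continuous_integral_section {F : X × Y → E} (hF : Continuous F)
    (hF' : HasCompactSupport F) (ρ : Measure Y) [IsFiniteMeasureOnCompacts ρ] :
    Continuous fun x => ∫ y, F (x, y) ∂ρ := by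
  rw [← continuousOn_univ]
  refine continuousOn_integral_of_compact_support (f := fun x y => F (x, y))
    (hF'.isCompact.image continuous_snd) hF.continuousOn fun x y _ hy => ?_
  by_contra h
  exact hy ⟨(x, y), subset_tsupport _ h, rfl⟩

end Sections

/-! ### Haar measure on the Borel sets of a product -/

section ProductHaar

variable {G H : Type*} [Group G] [TopologicalSpace G] [IsTopologicalGroup G]
  [LocallyCompactSpace G] [T2Space G] [MeasurableSpace G] [BorelSpace G]
  [Group H] [TopologicalSpace H] [IsTopologicalGroup H]
  [LocallyCompactSpace H] [T2Space H] [MeasurableSpace H] [BorelSpace H]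
  [MeasurableSpace (G × H)] [BorelSpace (G × H)]

/-- The measure `ν` on the Borel sets of `G × H` integrates continuous functions with compact
support like the product of `μ` and `ρ`. -/
structure IsProdHaar (μ : Measure G) (ρ : Measure H) (ν : Measure (G × H)) : Prop where
  haar : ν.IsHaarMeasure
  regular : ν.Regular
  integral_real : ∀ F : G × H → ℝ, Continuous F → HasCompactSupport F →
    ∫ v, F v ∂ν = ∫ x, ∫ y, F (x, y) ∂ρ ∂μ

variable (μ : Measure G) [μ.IsHaarMeasure] (ρ : Measure H) [ρ.IsHaarMeasure]

/-- The iterated integral as a positive functional. -/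
noncomputable def iteratedIntegral : C_c(G × H, ℝ) →ₚ[ℝ] ℝ :=
  PositiveLinearMap.mk₀
    { toFun := fun F => ∫ x, ∫ y, F (x, y) ∂ρ ∂μ
      map_add' := fun F F' => by
        rw [← integral_add]
        · refine integral_congr_ae (ae_of_all _ fun x => ?_)
          exact integral_add
            ((F.continuous.comp (Continuous.prodMk_right x)).integrable_of_hasCompactSupport
              (hasCompactSupport_section F.hasCompactSupport x))
            ((F'.continuous.comp (Continuous.prodMk_right x)).integrable_of_hasCompactSupport
              (hasCompactSupport_section F'.hasCompactSupport x))
        · exact (continuous_integral_section F.continuous F.hasCompactSupport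
            ρ).integrable_of_hasCompactSupport
            (hasCompactSupport_integral_section F.hasCompactSupport ρ)
        · exact (continuous_integral_section F'.continuous F'.hasCompactSupport
            ρ).integrable_of_hasCompactSupport
            (hasCompactSupport_integral_section F'.hasCompactSupport ρ)
      map_smul' := fun r F => by
        simp only [CompactlySupportedContinuousMap.coe_smul, Pi.smul_apply, smul_eq_mul,
          integral_const_mul, RingHom.id_apply] }
    fun F hF => integral_nonneg fun x => integral_nonneg fun y => hF (x, y)

/-- The Riesz measure of the iterated integral is regular on all Borel sets of the product, which
the product measure need not see. Left invariance is checked on test functions, one coordinate at a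
time; a product of two bump functions shows that the measure is not zero. -/
lemma exists_isProdHaar : ∃ ν : Measure (G × H), IsProdHaar μ ρ ν := by
  let Λ := iteratedIntegral μ ρ
  let ν := RealRMK.rieszMeasure Λ
  have hν : ∀ F : G × H → ℝ, Continuous F → HasCompactSupport F →
      ∫ v, F v ∂ν = ∫ x, ∫ y, F (x, y) ∂ρ ∂μ := fun F hF hF' =>
    RealRMK.integral_rieszMeasure Λ (⟨⟨F, hF⟩, hF'⟩ : C_c(G × H, ℝ))
  have hreg : ν.Regular := RealRMK.regular_rieszMeasure Λ
  have hinv : ν.IsMulLeftInvariant := by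
    refine ⟨fun g => ?_⟩
    have : (ν.map (g * ·)).Regular := Measure.Regular.map (Homeomorph.mulLeft g)
    refine Measure.ext_of_integral_eq_on_compactlySupported fun F => ?_
    rw [integral_map (f := fun v => F v) (continuous_const_mul g).aemeasurable
      F.continuous.aestronglyMeasurable, hν F F.continuous F.hasCompactSupport,
      hν (fun v => F (g * v)) (F.continuous.comp (continuous_const_mul g))
        (F.hasCompactSupport.comp_homeomorph (Homeomorph.mulLeft g))]
    have e1 : ∀ x, ∫ y, F (g * (x, y)) ∂ρ = ∫ y, F (g.1 * x, y) ∂ρ := fun x =>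
      integral_mul_left_eq_self (fun y => F (g.1 * x, y)) g.2
    simp only [e1]
    exact integral_mul_left_eq_self (fun x => ∫ y, F (x, y) ∂ρ) g.1
  have hne : ν ≠ 0 := by
    intro h0
    obtain ⟨f, fs, f0, fx⟩ := exists_continuous_nonneg_pos (1 : G)
    obtain ⟨f', fs', f0', fx'⟩ := exists_continuous_nonneg_pos (1 : H)
    have h1 := f.continuous.integral_pos_of_hasCompactSupport_nonneg_nonzero (μ := μ) fs f0 fx
    have h2 := f'.continuous.integral_pos_of_hasCompactSupport_nonneg_nonzero (μ := ρ) fs' f0' fx'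
    have h3 := hν (fun v => f v.1 * f' v.2) (by fun_prop) (hasCompactSupport_tensor fs fs')
    simp only [h0, integral_zero_measure, integral_const_mul, integral_mul_const] at h3
    exact (mul_pos h1 h2).ne h3
  have : NeZero ν := ⟨hne⟩
  have hop : ν.IsOpenPosMeasure := inferInstance
  exact ⟨ν, { }, hreg, hν⟩

variable {μ ρ} in
lemma IsProdHaar.integral {ν : Measure (G × H)} (hν : IsProdHaar μ ρ ν) {𝕜 : Type*} [RCLike 𝕜]
    {F : G × H → 𝕜} (hF : Continuous F) (hF' : HasCompactSupport F) :
    ∫ v, F v ∂ν = ∫ x, ∫ y, F (x, y) ∂ρ ∂μ := by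
  have := hν.haar
  have rc : Continuous fun v => RCLike.re (F v) := RCLike.continuous_re.comp hF
  have ic : Continuous fun v => RCLike.im (F v) := RCLike.continuous_im.comp hF
  have rs : HasCompactSupport fun v => RCLike.re (F v) := hF'.comp_left (map_zero _)
  have ims : HasCompactSupport fun v => RCLike.im (F v) := hF'.comp_left (map_zero _)
  have e : ∀ x, ∫ y, F (x, y) ∂ρ = ((∫ y, RCLike.re (F (x, y)) ∂ρ : ℝ) : 𝕜)
      + ((∫ y, RCLike.im (F (x, y)) ∂ρ : ℝ) : 𝕜) * RCLike.I := fun x =>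
    (integral_re_add_im ((hF.comp (Continuous.prodMk_right x)).integrable_of_hasCompactSupport
      (hasCompactSupport_section hF' x))).symm
  rw [← integral_re_add_im (hF.integrable_of_hasCompactSupport hF'), hν.integral_real _ rc rs,
    hν.integral_real _ ic ims]
  simp only [e]
  rw [integral_add, integral_mul_const, integral_ofReal, integral_ofReal]
  · exact ((continuous_integral_section rc rs ρ).integrable_of_hasCompactSupport
      (hasCompactSupport_integral_section rs ρ)).ofReal
  · exact ((continuous_integral_section ic ims ρ).integrable_of_hasCompactSupport
      (hasCompactSupport_integral_section ims ρ)).ofReal.mul_const _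

end ProductHaar

/-! ### From test functions to Borel functions -/

section Transfer

variable {X Y : Type*} [TopologicalSpace X] [T2Space X] [LocallyCompactSpace X]
  [MeasurableSpace X] [BorelSpace X] [TopologicalSpace Y] [T2Space Y] [LocallyCompactSpace Y]
  [MeasurableSpace Y] [BorelSpace Y] {𝕜 : Type*} [RCLike 𝕜]

lemma integral_norm_mul_le {ν : Measure X} {f : X → 𝕜} {M : ℝ}
    (hM : ∀ x, ‖f x‖ ≤ M) {v : X → 𝕜} (hv : IntegrableOn v (tsupport f) ν) :
    ‖∫ x, v x * f x ∂ν‖ ≤ M * ∫ x in tsupport f, ‖v x‖ ∂ν := by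
  rw [← setIntegral_eq_integral_of_forall_compl_eq_zero (s := tsupport f) (fun x hx => by
    rw [image_eq_zero_of_notMem_tsupport hx, mul_zero]), ← integral_const_mul]
  refine (norm_integral_le_integral_norm _).trans (integral_mono_of_nonneg
    (ae_of_all _ fun x => norm_nonneg _) (hv.norm.const_mul _) (ae_of_all _ fun x => ?_))
  simp only [norm_mul]
  rw [mul_comm]
  exact mul_le_mul_of_nonneg_right (hM x) (norm_nonneg _)

/-- An identity of integrals that holds for test functions extends to Borel functions. -/
lemma integral_comp_mul_eq {νX : Measure X} {νY : Measure Y} [νX.Regular] [νY.Regular]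
    {m : X → Y} (hm : Continuous m) {f : X → 𝕜} (fc : Continuous f) (fs : HasCompactSupport f)
    {g : Y → 𝕜} (gc : Continuous g) (gs : HasCompactSupport g)
    (h : ∀ φ : Y → 𝕜, Continuous φ → HasCompactSupport φ →
      ∫ x, φ (m x) * f x ∂νX = ∫ y, φ y * g y ∂νY)
    {u : Y → 𝕜} (hu : LocBdd u) : ∫ x, u (m x) * f x ∂νX = ∫ y, u y * g y ∂νY := by
  obtain ⟨M, hM⟩ := fc.bounded_above_of_compact_support fs
  obtain ⟨M', hM'⟩ := gc.bounded_above_of_compact_support gs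
  have hX : νX (tsupport f) ≠ ⊤ := fs.isCompact.measure_lt_top.ne
  have hY : νY (tsupport g) ≠ ⊤ := gs.isCompact.measure_lt_top.ne
  have : Fact (νX (tsupport f) < ⊤) := ⟨hX.lt_top⟩
  have : Fact (νY (tsupport g) < ⊤) := ⟨hY.lt_top⟩
  -- Both sides see u only through two finite measures on Y: the image of νX on the support of f,
  -- and νY on the support of g. One test function approximates u in L¹ of their sum, and so
  -- controls both sides at once.
  set ρ₁ := (νX.restrict (tsupport f)).map m with hρ₁
  set ρ₂ := νY.restrict (tsupport g) with hρ₂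
  have r1 : (νX.restrict (tsupport f)).Regular := Measure.Regular.restrict_of_measure_ne_top hX
  have r2 : ρ₂.Regular := Measure.Regular.restrict_of_measure_ne_top hY
  have r3 : ρ₁.InnerRegular := Measure.InnerRegular.map_of_continuous hm
  have r4 : IsFiniteMeasure ρ₁ := Measure.isFiniteMeasure_map _ m
  have r5 : (ρ₁ + ρ₂).Regular := inferInstance
  obtain ⟨w, wc, hw⟩ := hu.bound
  have locint : ∀ {ρ : Measure Y} [IsFiniteMeasure ρ] {K : Set Y}, IsCompact K → ρ Kᶜ = 0 →
      Integrable u ρ := by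
    intro ρ _ K hK hρ
    obtain ⟨B, hB⟩ := hK.exists_bound_of_continuousOn wc.continuousOn
    refine Integrable.of_bound hu.measurable.aestronglyMeasurable B ?_
    have : ∀ᵐ y ∂ρ, y ∈ K := hρ
    filter_upwards [this] with y hy
    exact (hw y).trans ((le_abs_self _).trans (hB y hy))
  have i1 : Integrable u ρ₁ := by
    refine locint (fs.isCompact.image hm) ?_
    rw [hρ₁, Measure.map_apply hm.measurable
      (fs.isCompact.image hm).isClosed.measurableSet.compl, Measure.restrict_apply
      ((fs.isCompact.image hm).isClosed.measurableSet.compl.preimage hm.measurable)]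
    convert measure_empty (μ := νX)
    ext x
    simp only [mem_inter_iff, mem_preimage, mem_compl_iff, mem_image, not_exists, not_and,
      mem_empty_iff_false, iff_false]
    exact fun h1 h2 => h1 x h2 rfl
  have i2 : Integrable u ρ₂ := by
    refine locint gs.isCompact ?_
    rw [hρ₂, Measure.restrict_apply gs.isCompact.isClosed.measurableSet.compl]
    simp
  rw [← sub_eq_zero, ← norm_le_zero_iff]
  refine le_of_forall_pos_le_add fun ε hε => ?_
  have hB : 0 < |M| + |M'| + 1 := by positivity
  obtain ⟨φ, φs, hφ, φc, φi⟩ :=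
    exists_hasCompactSupport_integral_sub_le (i1.add_measure i2) (div_pos hε hB)
  have j1 : Integrable (fun y => u y - φ y) ρ₁ :=
    i1.sub (φc.integrable_of_hasCompactSupport φs)
  have j2 : Integrable (fun y => u y - φ y) ρ₂ :=
    i2.sub (φc.integrable_of_hasCompactSupport φs)
  rw [integral_add_measure j1.norm j2.norm] at hφ
  have e1 : ∫ x, u (m x) * f x ∂νX - ∫ x, φ (m x) * f x ∂νX
      = ∫ x, (u (m x) - φ (m x)) * f x ∂νX := by
    rw [← integral_sub ((hu.comp hm).integrable fc fs νX)
      (((LocBdd.of_continuous φc).comp hm).integrable fc fs νX)]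
    simp only [sub_mul]
  have e2 : ∫ y, u y * g y ∂νY - ∫ y, φ y * g y ∂νY = ∫ y, (u y - φ y) * g y ∂νY := by
    rw [← integral_sub (hu.integrable gc gs νY) ((LocBdd.of_continuous φc).integrable gc gs νY)]
    simp only [sub_mul]
  have k1 : ‖∫ x, (u (m x) - φ (m x)) * f x ∂νX‖ ≤ |M| * ∫ y, ‖u y - φ y‖ ∂ρ₁ := by
    have h1 : ∫ y, ‖u y - φ y‖ ∂ρ₁ = ∫ x in tsupport f, ‖u (m x) - φ (m x)‖ ∂νX :=
      integral_map (f := fun y => ‖u y - φ y‖) hm.aemeasurable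
        (hu.measurable.sub φc.measurable).norm.aestronglyMeasurable
    rw [h1]
    refine integral_norm_mul_le (v := fun x => u (m x) - φ (m x))
      (fun x => (hM x).trans (le_abs_self _)) ?_
    exact j1.comp_measurable hm.measurable
  have k2 : ‖∫ y, (u y - φ y) * g y ∂νY‖ ≤ |M'| * ∫ y, ‖u y - φ y‖ ∂ρ₂ :=
    integral_norm_mul_le (fun x => (hM' x).trans (le_abs_self _)) j2
  have e : ∫ x, u (m x) * f x ∂νX - ∫ y, u y * g y ∂νY
      = ∫ x, (u (m x) - φ (m x)) * f x ∂νX - ∫ y, (u y - φ y) * g y ∂νY := by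
    rw [← e1, ← e2, h φ φc φs]
    ring
  rw [e, zero_add]
  have n1 : 0 ≤ ∫ y, ‖u y - φ y‖ ∂ρ₁ := integral_nonneg fun y => norm_nonneg _
  have n2 : 0 ≤ ∫ y, ‖u y - φ y‖ ∂ρ₂ := integral_nonneg fun y => norm_nonneg _
  calc _ ≤ |M| * ∫ y, ‖u y - φ y‖ ∂ρ₁ + |M'| * ∫ y, ‖u y - φ y‖ ∂ρ₂ :=
        (norm_sub_le _ _).trans (add_le_add k1 k2)
    _ ≤ (|M| + |M'| + 1) * (∫ y, ‖u y - φ y‖ ∂ρ₁ + ∫ y, ‖u y - φ y‖ ∂ρ₂) := by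
        nlinarith [abs_nonneg M, abs_nonneg M', mul_nonneg (abs_nonneg M) n2,
          mul_nonneg (abs_nonneg M') n1]
    _ ≤ (|M| + |M'| + 1) * (ε / (|M| + |M'| + 1)) := by gcongr
    _ = ε := by field_simp

/-- The extended identity is applied to the indicator of a Borel null set N containing the part of
the exceptional set that meets the image of K. The integral over Y vanishes, so the preimage of N is
null wherever the cutoff equals 1. -/
lemma tendsto_lae_of_integral {νX : Measure X} {νY : Measure Y} [νX.Regular] [νY.Regular]
    {m : X → Y} (hm : Continuous m)
    (h : ∀ f : X → ℝ, Continuous f → HasCompactSupport f → ∃ g : Y → ℝ, Continuous g ∧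
      HasCompactSupport g ∧ ∀ φ : Y → ℝ, Continuous φ → HasCompactSupport φ →
        ∫ x, φ (m x) * f x ∂νX = ∫ y, φ y * g y ∂νY) :
    Tendsto m (lae νX) (lae νY) := by
  intro s hs
  change ∀ᶠ x in lae νX, m x ∈ s
  rw [eventually_lae]
  intro K hK
  obtain ⟨χ, χc, χs, χ1, χb⟩ := exists_cutoff hK
  obtain ⟨g, gc, gs, hg⟩ := h χ χc χs
  set L := m '' K ∪ tsupport g with hLdef
  have hL : IsCompact L := (hK.image hm).union gs.isCompact
  have hsL : νY (sᶜ ∩ L) = 0 := by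
    have := eventually_lae.1 (show ∀ᶠ y in lae νY, y ∈ s from hs) _ hL
    rw [ae_restrict_iff' hL.isClosed.measurableSet, ae_iff] at this
    convert this using 2
    ext y
    simp [and_comm]
  obtain ⟨N, hN, hNm, hN0⟩ := exists_measurable_superset_of_null hsL
  have hu : LocBdd (N.indicator (1 : Y → ℝ)) :=
    LocBdd.of_bounded (measurable_one.indicator hNm) (C := 1) fun x => by
      by_cases hx : x ∈ N <;> simp [hx]
  have e := integral_comp_mul_eq hm χc χs gc gs hg hu
  have e0 : ∫ y, N.indicator (1 : Y → ℝ) y * g y ∂νY = 0 := by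
    refine integral_eq_zero_of_ae ?_
    filter_upwards [compl_mem_ae_iff.2 hN0] with y hy
    simp [indicator_of_notMem hy]
  rw [e0, integral_eq_zero_iff_of_nonneg (fun x => mul_nonneg (indicator_nonneg (by simp) _)
    (χb x).1) ((hu.comp hm).integrable χc χs νX)] at e
  rw [ae_restrict_iff' hK.isClosed.measurableSet]
  filter_upwards [e] with x hx hxK
  by_contra hxs
  have : m x ∈ N := hN ⟨hxs, Or.inl ⟨x, hxK, rfl⟩⟩
  simp [this, χ1 x hxK] at hx

/-- Fubini without σ-finiteness: both integrals live on the compact projections of the support of Φ,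
where the measures are finite. A compactly supported continuous function is strongly measurable for
the product σ-algebra, and p depends on one variable only. -/
lemma integral_integral_mul_swap {νX : Measure X} {νY : Measure Y}
    [IsFiniteMeasureOnCompacts νX] [IsFiniteMeasureOnCompacts νY] {p : Y → 𝕜} (hp : LocBdd p)
    {Φ : X × Y → 𝕜} (hΦ : Continuous Φ) (hΦ' : HasCompactSupport Φ) :
    ∫ x, ∫ y, p y * Φ (x, y) ∂νY ∂νX = ∫ y, p y * ∫ x, Φ (x, y) ∂νX ∂νY := by
  set K := Prod.fst '' tsupport Φ
  set L := Prod.snd '' tsupport Φ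
  have hK : IsCompact K := hΦ'.isCompact.image continuous_fst
  have hL : IsCompact L := hΦ'.isCompact.image continuous_snd
  have zK : ∀ x y, x ∉ K → Φ (x, y) = 0 := fun x y hx => by
    by_contra h
    exact hx ⟨(x, y), subset_tsupport _ h, rfl⟩
  have zL : ∀ x y, y ∉ L → Φ (x, y) = 0 := fun x y hx => by
    by_contra h
    exact hx ⟨(x, y), subset_tsupport _ h, rfl⟩
  have e1 : ∫ x, ∫ y, p y * Φ (x, y) ∂νY ∂νX = ∫ x in K, ∫ y in L, p y * Φ (x, y) ∂νY ∂νX := by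
    rw [setIntegral_eq_integral_of_forall_compl_eq_zero]
    · congr 1
      ext x
      rw [setIntegral_eq_integral_of_forall_compl_eq_zero fun y hy => by rw [zL x y hy, mul_zero]]
    · intro x hx
      simp [zK x _ hx]
  have e2 : ∫ y, p y * ∫ x, Φ (x, y) ∂νX ∂νY = ∫ y in L, ∫ x in K, p y * Φ (x, y) ∂νX ∂νY := by
    rw [setIntegral_eq_integral_of_forall_compl_eq_zero]
    · congr 1
      ext y
      rw [← integral_const_mul, setIntegral_eq_integral_of_forall_compl_eq_zero fun x hx => by
        rw [zK x y hx, mul_zero]]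
    · intro y hy
      simp [zL _ y hy]
  rw [e1, e2]
  have : Fact (νX K < ⊤) := ⟨hK.measure_lt_top⟩
  have : Fact (νY L < ⊤) := ⟨hL.measure_lt_top⟩
  refine integral_integral_swap ?_
  obtain ⟨w, wc, hw⟩ := hp.bound
  obtain ⟨B, hB⟩ := ((wc.comp continuous_snd).mul hΦ.norm).bounded_above_of_compact_support
    (hΦ'.norm.mul_left)
  refine Integrable.of_bound (C := B) ?_ (ae_of_all _ fun v => ?_)
  · exact ((hp.measurable.comp measurable_snd).stronglyMeasurable.mul
      (hΦ'.stronglyMeasurable_of_prod hΦ)).aestronglyMeasurable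
  · refine le_trans ?_ (hB v)
    simp only [Function.uncurry_def, norm_mul, Pi.mul_apply, Function.comp, norm_norm]
    exact mul_le_mul_of_nonneg_right ((hw _).trans (le_abs_self _)) (norm_nonneg _)

end Transfer

lemma integral_section_swap {X Y E : Type*} [TopologicalSpace X] [TopologicalSpace Y]
    [MeasurableSpace X] [BorelSpace X] [MeasurableSpace Y] [BorelSpace Y] [NormedAddCommGroup E]
    [NormedSpace ℝ E] {F : X × Y → E} (hF : Continuous F) (hF' : HasCompactSupport F)
    {νX : Measure X} {νY : Measure Y} [IsFiniteMeasureOnCompacts νX]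
    [IsFiniteMeasureOnCompacts νY] :
    ∫ x, ∫ y, F (x, y) ∂νY ∂νX = ∫ y, ∫ x, F (x, y) ∂νX ∂νY :=
  integral_integral_swap_of_hasCompactSupport (f := fun x y => F (x, y)) hF hF'

/-! ### Integration on the group and along the fibres of multiplication -/

section Group

variable {G : Type*} [Group G] [TopologicalSpace G] [IsTopologicalGroup G]
  [LocallyCompactSpace G] [T2Space G] [MeasurableSpace G] [BorelSpace G]
  (μ : Measure G) [μ.IsHaarMeasure] [μ.Regular] {𝕜 : Type*} [RCLike 𝕜]

/-- The factor by which the left Haar measure `μ` is scaled by the right translation by `s`. -/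
noncomputable def rightScale (s : G) : ℝ :=
  Measure.haarScalarFactor (μ.map (· * s)) μ

lemma integral_mul_right_eq_rightScale (s : G) (u : G → 𝕜) :
    ∫ t, u (t * s) ∂μ = rightScale μ s * ∫ t, u t ∂μ := by
  have : (μ.map (· * s)).Regular := Measure.Regular.map (Homeomorph.mulRight s)
  have h := Measure.isMulLeftInvariant_eq_smul_of_regular (μ.map (· * s)) μ
  have e : ∫ t, u t ∂(μ.map (· * s)) = ∫ t, u (t * s) ∂μ :=
    (Homeomorph.mulRight s).measurableEmbedding.integral_map u
  rw [← e, h, integral_smul_nnreal_measure, rightScale]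
  simp only [NNReal.smul_def, RCLike.real_smul_eq_coe_mul]

-- For a fixed bump function f the factor is the quotient of ∫ f(ts) dt by ∫ f, and for s in a
-- compact neighbourhood the integrands share a compact support.
@[fun_prop]
lemma continuous_rightScale : Continuous (rightScale μ) := by
  obtain ⟨f, fs, f0, fx⟩ := exists_continuous_nonneg_pos (1 : G)
  have hf := f.continuous.integral_pos_of_hasCompactSupport_nonneg_nonzero (μ := μ) fs f0 fx
  have e : rightScale μ = fun s => (∫ t, f (t * s) ∂μ) / ∫ t, f t ∂μ := by
    ext s
    rw [integral_mul_right_eq_rightScale μ s f]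
    simp only [RCLike.ofReal_real_eq_id, id]
    field_simp
  rw [e]
  refine Continuous.div_const ?_ _
  refine continuous_iff_continuousAt.2 fun s₀ => ?_
  obtain ⟨k, hk, hks⟩ := exists_compact_mem_nhds s₀
  refine ContinuousOn.continuousAt (s := k) ?_ hks
  refine continuousOn_integral_of_compact_support (f := fun s t => f (t * s))
    (fs.isCompact.mul hk.inv) (by fun_prop) fun s t hs ht => ?_
  by_contra h
  exact ht ⟨t * s, subset_tsupport _ h, s⁻¹, by simpa using hs, by simp⟩

/-- The inverse of a left Haar measure is right invariant, and comparing the two gives a continuous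
density. Its only use is that inversion preserves locally null sets. -/
lemma exists_integral_inv_eq : ∃ D : G → ℝ, Continuous D ∧
    ∀ F : G → ℝ, Continuous F → HasCompactSupport F →
      ∫ y, F y⁻¹ ∂μ = ∫ y, F y * D y ∂μ := by
  obtain ⟨g, gs, g0, gx⟩ := exists_continuous_nonneg_pos (1 : G)
  have hg := g.continuous.integral_pos_of_hasCompactSupport_nonneg_nonzero (μ := μ) gs g0 gx
  set D₀ : G → ℝ := fun y => ∫ z, g (z⁻¹ * y) ∂μ.inv with hD₀
  have Dc : Continuous D₀ := continuous_integral_apply_inv_mul g.continuous gs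
  have Dpos : ∀ y, 0 < D₀ y := fun y => by
    have : Continuous fun z => g (z⁻¹ * y) := by fun_prop
    refine this.integral_pos_of_hasCompactSupport_nonneg_nonzero (x := y)
      (hasCompactSupport_comp_of_leftInverse gs (θ := fun z => z⁻¹ * y)
        (θ' := fun w => y * w⁻¹) (by fun_prop) fun z => by group) (fun z => g0 (z⁻¹ * y)) (by simpa using gx)
  refine ⟨fun y => D₀ y / ∫ t, g t ∂μ, Dc.div_const _, fun F hF hF' => ?_⟩
  -- The comparison formula divides its test function by D₀, so it is applied to F D₀.
  have h := Measure.integral_isMulLeftInvariant_isMulRightInvariant_combo (μ := μ) (ν := μ.inv)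
    (f := fun y => F y * D₀ y) (hF.mul Dc) hF'.mul_right g.continuous gs g0 gx
  have e : ∫ y, F y ∂μ.inv = ∫ y, F y⁻¹ ∂μ :=
    (Homeomorph.inv G).measurableEmbedding.integral_map F
  have e2 : ∀ y, F y * D₀ y * (∫ z, g (z⁻¹ * y) ∂μ.inv)⁻¹ = F y := fun y =>
    mul_inv_cancel_right₀ (Dpos y).ne' _
  simp only [e2] at h
  rw [← e]
  simp only [← mul_div_assoc]
  rw [integral_div, h]
  field_simp

lemma tendsto_inv_lae : Tendsto (fun x : G => x⁻¹) (lae μ) (lae μ) := by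
  obtain ⟨D, Dc, hD⟩ := exists_integral_inv_eq μ
  refine tendsto_lae_of_integral continuous_inv fun f fc fs => ?_
  have fs' : HasCompactSupport fun y => f y⁻¹ :=
    hasCompactSupport_comp_of_leftInverse fs (θ' := fun y => y⁻¹) continuous_inv inv_inv
  refine ⟨fun y => f y⁻¹ * D y, (fc.comp continuous_inv).mul Dc, fs'.mul_right,
    fun φ φc φs => ?_⟩
  have := hD (fun y => φ y * f y⁻¹) (φc.mul (fc.comp continuous_inv)) fs'.mul_left
  simpa only [inv_inv, mul_assoc] using this

variable [MeasurableSpace (G × G)] [BorelSpace (G × G)] {ν : Measure (G × G)}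

variable {μ} in
/-- Integration along the fibres of `(x, y) ↦ x y`. -/
lemma IsProdHaar.integral_comp_mul (hν : IsProdHaar μ μ ν) {F : G × G → 𝕜}
    (hF : Continuous F) (hF' : HasCompactSupport F) {u : G → 𝕜} (hu : LocBdd u) :
    ∫ v, u (v.1 * v.2) * F v ∂ν = ∫ t, u t * ∫ x, F (x, x⁻¹ * t) ∂μ ∂μ := by
  have := hν.haar
  have := hν.regular
  have c1 : Continuous fun w : G × G => F (w.2, w.2⁻¹ * w.1) := by fun_prop
  have s1 : HasCompactSupport fun w : G × G => F (w.2, w.2⁻¹ * w.1) :=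
    hasCompactSupport_comp_of_leftInverse hF' (θ := fun w : G × G => (w.2, w.2⁻¹ * w.1))
      (θ' := fun w => (w.1 * w.2, w.1)) (by fun_prop) fun w => by simp
  refine integral_comp_mul_eq (m := fun v : G × G => v.1 * v.2) (by fun_prop) hF hF'
    (continuous_integral_section c1 s1 μ) (hasCompactSupport_integral_section s1 μ)
    (fun φ φc φs => ?_) hu
  rw [hν.integral (F := fun v : G × G => φ (v.1 * v.2) * F v) (by fun_prop) hF'.mul_left]
  simp only
  have e : ∀ x, ∫ y, φ (x * y) * F (x, y) ∂μ = ∫ y, φ y * F (x, x⁻¹ * y) ∂μ := fun x => by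
    rw [← integral_mul_left_eq_self (fun y => φ y * F (x, x⁻¹ * y)) x]
    simp
  simp only [e]
  refine integral_integral_mul_swap (LocBdd.of_continuous φc)
    (Φ := fun v : G × G => F (v.1, v.1⁻¹ * v.2)) (by fun_prop) ?_
  exact hasCompactSupport_comp_of_leftInverse hF' (θ := fun w : G × G => (w.1, w.1⁻¹ * w.2))
      (θ' := fun w => (w.1, w.1 * w.2)) (by fun_prop) fun w => by simp

variable {μ} in
/-- Integration along the fibres of `(x, y) ↦ y x`. -/
lemma IsProdHaar.integral_comp_mul_swap (hν : IsProdHaar μ μ ν) {F : G × G → 𝕜}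
    (hF : Continuous F) (hF' : HasCompactSupport F) {u : G → 𝕜} (hu : LocBdd u) :
    ∫ v, u (v.2 * v.1) * F v ∂ν = ∫ t, u t * ∫ y, F (y⁻¹ * t, y) ∂μ ∂μ := by
  have := hν.haar
  have := hν.regular
  have c1 : Continuous fun w : G × G => F (w.2⁻¹ * w.1, w.2) := by fun_prop
  have s1 : HasCompactSupport fun w : G × G => F (w.2⁻¹ * w.1, w.2) :=
    hasCompactSupport_comp_of_leftInverse hF' (θ := fun w : G × G => (w.2⁻¹ * w.1, w.2))
      (θ' := fun w => (w.2 * w.1, w.2)) (by fun_prop) fun w => by simp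
  refine integral_comp_mul_eq (m := fun v : G × G => v.2 * v.1) (by fun_prop) hF hF'
    (continuous_integral_section c1 s1 μ) (hasCompactSupport_integral_section s1 μ)
    (fun φ φc φs => ?_) hu
  rw [hν.integral (F := fun v : G × G => φ (v.2 * v.1) * F v) (by fun_prop) hF'.mul_left]
  have cF : Continuous fun v : G × G => φ (v.2 * v.1) * F v := by fun_prop
  have sF : HasCompactSupport fun v : G × G => φ (v.2 * v.1) * F v := hF'.mul_left
  have sw : ∫ x, ∫ y, φ (y * x) * F (x, y) ∂μ ∂μ = ∫ y, ∫ x, φ (y * x) * F (x, y) ∂μ ∂μ :=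
    integral_section_swap cF sF
  refine sw.trans ?_
  have e : ∀ y, ∫ x, φ (y * x) * F (x, y) ∂μ = ∫ x, φ x * F (y⁻¹ * x, y) ∂μ := fun y => by
    rw [← integral_mul_left_eq_self (fun x => φ x * F (y⁻¹ * x, y)) y]
    simp
  simp only [e]
  refine integral_integral_mul_swap (LocBdd.of_continuous φc)
    (Φ := fun v : G × G => F (v.1⁻¹ * v.2, v.1)) (by fun_prop) ?_
  exact hasCompactSupport_comp_of_leftInverse hF' (θ := fun w : G × G => (w.1⁻¹ * w.2, w.1))
      (θ' := fun w => (w.2, w.2 * w.1)) (by fun_prop) fun w => by simp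

lemma continuous_rightScale_ofReal : Continuous fun s => (rightScale μ s : 𝕜) :=
  RCLike.continuous_ofReal.comp (continuous_rightScale μ)

variable {μ} in
/-- Integration along the fibres of `(x, y) ↦ y x`, in the other coordinates. -/
lemma IsProdHaar.integral_comp_mul_swap' (hν : IsProdHaar μ μ ν) {F : G × G → 𝕜}
    (hF : Continuous F) (hF' : HasCompactSupport F) {u : G → 𝕜} (hu : LocBdd u) :
    ∫ v, u (v.2 * v.1) * F v ∂ν =
      ∫ t, u t * ∫ x, rightScale μ x * F (x, t * x⁻¹) ∂μ ∂μ := by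
  have := hν.haar
  have := hν.regular
  have κc := continuous_rightScale_ofReal μ (𝕜 := 𝕜)
  have c1 : Continuous fun w : G × G => (rightScale μ w.2 : 𝕜) * F (w.2, w.1 * w.2⁻¹) := by
    fun_prop
  have s1 : HasCompactSupport fun w : G × G => (rightScale μ w.2 : 𝕜) * F (w.2, w.1 * w.2⁻¹) :=
    (hasCompactSupport_comp_of_leftInverse hF' (θ := fun w : G × G => (w.2, w.1 * w.2⁻¹))
      (θ' := fun w => (w.2 * w.1, w.1)) (by fun_prop) fun w => by simp).mul_left
  refine integral_comp_mul_eq (m := fun v : G × G => v.2 * v.1) (by fun_prop) hF hF'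
    (continuous_integral_section c1 s1 μ) (hasCompactSupport_integral_section s1 μ)
    (fun φ φc φs => ?_) hu
  rw [hν.integral (F := fun v : G × G => φ (v.2 * v.1) * F v) (by fun_prop) hF'.mul_left]
  simp only
  have e : ∀ x, ∫ y, φ (y * x) * F (x, y) ∂μ
      = ∫ y, φ y * (rightScale μ x * F (x, y * x⁻¹)) ∂μ := fun x => by
    have := integral_mul_right_eq_rightScale μ x (fun y => φ y * F (x, y * x⁻¹))
    simp only [mul_inv_cancel_right] at this
    rw [this, ← integral_const_mul]
    congr 1
    ext y
    ring
  simp only [e]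
  refine integral_integral_mul_swap (LocBdd.of_continuous φc)
    (Φ := fun v : G × G => (rightScale μ v.1 : 𝕜) * F (v.1, v.2 * v.1⁻¹)) (by fun_prop) ?_
  exact (hasCompactSupport_comp_of_leftInverse hF' (θ := fun w : G × G => (w.1, w.2 * w.1⁻¹))
      (θ' := fun w => (w.1, w.2 * w.1)) (by fun_prop) fun w => by simp).mul_left

-- This and its companion for yx allow h to be changed on a locally null set without changing the
-- class of h(xy) - h(yx).
variable {μ} in
lemma IsProdHaar.tendsto_mul (hν : IsProdHaar μ μ ν) :
    Tendsto (fun v : G × G => v.1 * v.2) (lae ν) (lae μ) := by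
  have := hν.haar
  have := hν.regular
  refine tendsto_lae_of_integral (by fun_prop) fun f fc fs => ?_
  have c1 : Continuous fun w : G × G => f (w.2, w.2⁻¹ * w.1) := by fun_prop
  have s1 : HasCompactSupport fun w : G × G => f (w.2, w.2⁻¹ * w.1) :=
    hasCompactSupport_comp_of_leftInverse fs (θ := fun w : G × G => (w.2, w.2⁻¹ * w.1))
      (θ' := fun w => (w.1 * w.2, w.1)) (by fun_prop) fun w => by simp
  exact ⟨_, continuous_integral_section c1 s1 μ, hasCompactSupport_integral_section s1 μ,
    fun φ φc φs => hν.integral_comp_mul fc fs (LocBdd.of_continuous φc)⟩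

variable {μ} in
lemma IsProdHaar.tendsto_mul_swap (hν : IsProdHaar μ μ ν) :
    Tendsto (fun v : G × G => v.2 * v.1) (lae ν) (lae μ) := by
  have := hν.haar
  have := hν.regular
  refine tendsto_lae_of_integral (by fun_prop) fun f fc fs => ?_
  have c1 : Continuous fun w : G × G => f (w.2⁻¹ * w.1, w.2) := by fun_prop
  have s1 : HasCompactSupport fun w : G × G => f (w.2⁻¹ * w.1, w.2) :=
    hasCompactSupport_comp_of_leftInverse fs (θ := fun w : G × G => (w.2⁻¹ * w.1, w.2))
      (θ' := fun w => (w.2 * w.1, w.2)) (by fun_prop) fun w => by simp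
  exact ⟨_, continuous_integral_section c1 s1 μ, hasCompactSupport_integral_section s1 μ,
    fun φ φc φs => hν.integral_comp_mul_swap fc fs (LocBdd.of_continuous φc)⟩

end Group

/-! ### The three multiplication maps from G × G × G to G × G -/

section Triple

variable {G : Type*} [Group G] [TopologicalSpace G] [IsTopologicalGroup G]
  [LocallyCompactSpace G] [T2Space G] [MeasurableSpace G] [BorelSpace G]
  {μ : Measure G} [μ.IsHaarMeasure] [μ.Regular] {𝕜 : Type*} [RCLike 𝕜]
  [MeasurableSpace (G × G)] [BorelSpace (G × G)] {ν : Measure (G × G)}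
  [MeasurableSpace (G × G × G)] [BorelSpace (G × G × G)] {ν₃ : Measure (G × G × G)}

/-- Integration along the fibres of `(x, y, z) ↦ (x y, z)`. -/
lemma IsProdHaar.integral_comp_mul_left (hν : IsProdHaar μ μ ν) (hν₃ : IsProdHaar μ ν ν₃)
    {F : G × G × G → 𝕜} (hF : Continuous F) (hF' : HasCompactSupport F) {u : G × G → 𝕜}
    (hu : LocBdd u) :
    ∫ v, u (v.1 * v.2.1, v.2.2) * F v ∂ν₃ = ∫ w, u w * ∫ x, F (x, x⁻¹ * w.1, w.2) ∂μ ∂ν := by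
  have := hν.haar
  have := hν.regular
  have := hν₃.haar
  have := hν₃.regular
  have c1 : Continuous fun w : (G × G) × G => F (w.2, w.2⁻¹ * w.1.1, w.1.2) := by fun_prop
  have s1 : HasCompactSupport fun w : (G × G) × G => F (w.2, w.2⁻¹ * w.1.1, w.1.2) :=
    hasCompactSupport_comp_of_leftInverse hF'
      (θ := fun w : (G × G) × G => (w.2, w.2⁻¹ * w.1.1, w.1.2))
      (θ' := fun w => ((w.1 * w.2.1, w.2.2), w.1)) (by fun_prop) fun w => by simp
  refine integral_comp_mul_eq (m := fun v : G × G × G => (v.1 * v.2.1, v.2.2)) (by fun_prop)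
    hF hF' (continuous_integral_section c1 s1 μ) (hasCompactSupport_integral_section s1 μ)
    (fun φ φc φs => ?_) hu
  rw [hν₃.integral (F := fun v : G × G × G => φ (v.1 * v.2.1, v.2.2) * F v) (by fun_prop)
    hF'.mul_left]
  simp only
  have c2 : Continuous fun w : G × G × G => F (w.1, w.1⁻¹ * w.2.1, w.2.2) := by fun_prop
  have s2 : HasCompactSupport fun w : G × G × G => F (w.1, w.1⁻¹ * w.2.1, w.2.2) :=
    hasCompactSupport_comp_of_leftInverse hF'
      (θ := fun w : G × G × G => (w.1, w.1⁻¹ * w.2.1, w.2.2))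
      (θ' := fun w => (w.1, w.1 * w.2.1, w.2.2)) (by fun_prop) fun w => by simp
  have e : ∀ x, ∫ w, φ (x * w.1, w.2) * F (x, w) ∂ν
      = ∫ w, φ w * F (x, x⁻¹ * w.1, w.2) ∂ν := fun x => by
    rw [← integral_mul_left_eq_self (fun w : G × G => φ w * F (x, x⁻¹ * w.1, w.2)) (x, 1)]
    simp [Prod.mul_def]
  simp only [e]
  exact integral_integral_mul_swap (LocBdd.of_continuous φc)
    (Φ := fun w : G × G × G => F (w.1, w.1⁻¹ * w.2.1, w.2.2)) c2 s2

/-- Integration along the fibres of `(x, y, z) ↦ (x, y z)`. -/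
lemma IsProdHaar.integral_comp_mul_right (hν : IsProdHaar μ μ ν) (hν₃ : IsProdHaar μ ν ν₃)
    {F : G × G × G → 𝕜} (hF : Continuous F) (hF' : HasCompactSupport F) {u : G × G → 𝕜}
    (hu : LocBdd u) :
    ∫ v, u (v.1, v.2.1 * v.2.2) * F v ∂ν₃ = ∫ w, u w * ∫ y, F (w.1, y, y⁻¹ * w.2) ∂μ ∂ν := by
  have := hν.haar
  have := hν.regular
  have := hν₃.haar
  have := hν₃.regular
  have c1 : Continuous fun w : (G × G) × G => F (w.1.1, w.2, w.2⁻¹ * w.1.2) := by fun_prop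
  have s1 : HasCompactSupport fun w : (G × G) × G => F (w.1.1, w.2, w.2⁻¹ * w.1.2) :=
    hasCompactSupport_comp_of_leftInverse hF'
      (θ := fun w : (G × G) × G => (w.1.1, w.2, w.2⁻¹ * w.1.2))
      (θ' := fun w => ((w.1, w.2.1 * w.2.2), w.2.1)) (by fun_prop) fun w => by simp
  refine integral_comp_mul_eq (m := fun v : G × G × G => (v.1, v.2.1 * v.2.2)) (by fun_prop)
    hF hF' (continuous_integral_section c1 s1 μ) (hasCompactSupport_integral_section s1 μ)
    (fun φ φc φs => ?_) hu
  rw [hν₃.integral (F := fun v : G × G × G => φ (v.1, v.2.1 * v.2.2) * F v) (by fun_prop)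
    hF'.mul_left, hν.integral (F := fun w => φ w * ∫ y, F (w.1, y, y⁻¹ * w.2) ∂μ)
    (φc.mul (continuous_integral_section c1 s1 μ)) φs.mul_right]
  simp only
  congr 1
  ext x
  exact hν.integral_comp_mul (F := fun w => F (x, w)) (by fun_prop)
    (hasCompactSupport_section hF' x) (LocBdd.of_continuous (u := fun t => φ (x, t)) (by fun_prop))

lemma hasCompactSupport_rotate {F : G × G × G → 𝕜} (hF' : HasCompactSupport F) :
    HasCompactSupport fun w : G × G × G => F (w.2.2, w.1, w.2.1) :=
  hasCompactSupport_comp_of_leftInverse hF' (θ := fun w : G × G × G => (w.2.2, w.1, w.2.1))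
    (θ' := fun w => (w.2.1, w.2.2, w.1)) (by fun_prop) fun w => by simp

/-- `∫ F (x, y, z)` can be computed with `x` innermost. -/
lemma IsProdHaar.integral_rotate (hν : IsProdHaar μ μ ν) (hν₃ : IsProdHaar μ ν ν₃)
    {F : G × G × G → 𝕜} (hF : Continuous F) (hF' : HasCompactSupport F) :
    ∫ v, F v ∂ν₃ = ∫ y, ∫ w, F (w.2, y, w.1) ∂ν ∂μ := by
  have := hν.haar
  have cr : Continuous fun w : (G × G) × G => F (w.2, w.1) := by fun_prop
  have sr : HasCompactSupport fun w : (G × G) × G => F (w.2, w.1) :=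
    hasCompactSupport_comp_of_leftInverse hF' (θ := fun w : (G × G) × G => (w.2, w.1))
    (θ' := fun w => (w.2, w.1)) (by fun_prop) fun w => by simp
  rw [hν₃.integral hF hF', integral_section_swap hF hF',
    hν.integral (F := fun w => ∫ x, F (x, w) ∂μ) (continuous_integral_section cr sr μ)
      (hasCompactSupport_integral_section sr μ)]
  congr 1
  ext y
  exact (hν.integral (F := fun w => F (w.2, y, w.1)) (by fun_prop)
    (hasCompactSupport_section (F := fun w : G × G × G => F (w.2.2, w.1, w.2.1))
      (hasCompactSupport_rotate hF') y)).symm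

/-- Integration along the fibres of `(x, y, z) ↦ (y, z x)`. -/
lemma IsProdHaar.integral_comp_mul_rotate (hν : IsProdHaar μ μ ν) (hν₃ : IsProdHaar μ ν ν₃)
    {F : G × G × G → 𝕜} (hF : Continuous F) (hF' : HasCompactSupport F) {u : G × G → 𝕜}
    (hu : LocBdd u) :
    ∫ v, u (v.2.1, v.2.2 * v.1) * F v ∂ν₃ = ∫ w, u w * ∫ z, F (z⁻¹ * w.2, w.1, z) ∂μ ∂ν := by
  have := hν.haar
  have := hν.regular
  have := hν₃.haar
  have := hν₃.regular
  have c1 : Continuous fun w : (G × G) × G => F (w.2⁻¹ * w.1.2, w.1.1, w.2) := by fun_prop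
  have s1 : HasCompactSupport fun w : (G × G) × G => F (w.2⁻¹ * w.1.2, w.1.1, w.2) :=
    hasCompactSupport_comp_of_leftInverse hF'
      (θ := fun w : (G × G) × G => (w.2⁻¹ * w.1.2, w.1.1, w.2))
      (θ' := fun w => ((w.2.1, w.2.2 * w.1), w.2.2)) (by fun_prop) fun w => by simp
  refine integral_comp_mul_eq (m := fun v : G × G × G => (v.2.1, v.2.2 * v.1)) (by fun_prop)
    hF hF' (continuous_integral_section c1 s1 μ) (hasCompactSupport_integral_section s1 μ)
    (fun φ φc φs => ?_) hu
  rw [hν.integral_rotate hν₃ (F := fun v : G × G × G => φ (v.2.1, v.2.2 * v.1) * F v)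
    (by fun_prop) hF'.mul_left, hν.integral (F := fun w => φ w * ∫ z, F (z⁻¹ * w.2, w.1, z) ∂μ)
    (φc.mul (continuous_integral_section c1 s1 μ)) φs.mul_right]
  simp only
  congr 1
  ext y
  exact hν.integral_comp_mul (F := fun w => F (w.2, y, w.1)) (by fun_prop)
    (hasCompactSupport_section (F := fun w : G × G × G => F (w.2.2, w.1, w.2.1))
      (hasCompactSupport_rotate hF') y)
    (LocBdd.of_continuous (u := fun t => φ (y, t)) (by fun_prop))

/-- Integration along the fibres of `(x, y, z) ↦ (y, z x)`, in the other coordinates. -/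
lemma IsProdHaar.integral_comp_mul_rotate' (hν : IsProdHaar μ μ ν) (hν₃ : IsProdHaar μ ν ν₃)
    {F : G × G × G → 𝕜} (hF : Continuous F) (hF' : HasCompactSupport F) {u : G × G → 𝕜}
    (hu : LocBdd u) :
    ∫ v, u (v.2.1, v.2.2 * v.1) * F v ∂ν₃ =
      ∫ w, u w * ∫ x, rightScale μ x * F (x, w.1, w.2 * x⁻¹) ∂μ ∂ν := by
  have := hν.haar
  have := hν.regular
  have := hν₃.haar
  have := hν₃.regular
  have κc := continuous_rightScale_ofReal μ (𝕜 := 𝕜)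
  have c1 : Continuous fun w : (G × G) × G =>
      (rightScale μ w.2 : 𝕜) * F (w.2, w.1.1, w.1.2 * w.2⁻¹) := by fun_prop
  have s1 : HasCompactSupport fun w : (G × G) × G =>
      (rightScale μ w.2 : 𝕜) * F (w.2, w.1.1, w.1.2 * w.2⁻¹) :=
    (hasCompactSupport_comp_of_leftInverse hF'
      (θ := fun w : (G × G) × G => (w.2, w.1.1, w.1.2 * w.2⁻¹))
      (θ' := fun w => ((w.2.1, w.2.2 * w.1), w.1)) (by fun_prop) fun w => by simp).mul_left
  refine integral_comp_mul_eq (m := fun v : G × G × G => (v.2.1, v.2.2 * v.1)) (by fun_prop)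
    hF hF' (continuous_integral_section c1 s1 μ) (hasCompactSupport_integral_section s1 μ)
    (fun φ φc φs => ?_) hu
  rw [hν.integral_rotate hν₃ (F := fun v : G × G × G => φ (v.2.1, v.2.2 * v.1) * F v)
    (by fun_prop) hF'.mul_left, hν.integral
    (F := fun w => φ w * ∫ x, (rightScale μ x : 𝕜) * F (x, w.1, w.2 * x⁻¹) ∂μ)
    (φc.mul (continuous_integral_section c1 s1 μ)) φs.mul_right]
  simp only
  congr 1
  ext y
  have cF : Continuous fun w : G × G => φ (y, w.1 * w.2) * F (w.2, y, w.1) := by fun_prop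
  have sF : HasCompactSupport fun w : G × G => φ (y, w.1 * w.2) * F (w.2, y, w.1) :=
    (hasCompactSupport_section (F := fun w : G × G × G => F (w.2.2, w.1, w.2.1))
      (hasCompactSupport_rotate hF') y).mul_left
  have sF' : HasCompactSupport fun w : G × G => F (w.1, y, w.2) :=
    hasCompactSupport_comp_of_leftInverse (hasCompactSupport_section
      (F := fun w : G × G × G => F (w.2.2, w.1, w.2.1)) (hasCompactSupport_rotate hF') y) (θ := fun w : G × G => (w.2, w.1))
      (θ' := fun w => (w.2, w.1)) (by fun_prop) fun w => by simp
  rw [← hν.integral_comp_mul_swap' (F := fun w => F (w.1, y, w.2)) (by fun_prop) sF'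
    (LocBdd.of_continuous (u := fun t => φ (y, t)) (by fun_prop)), hν.integral cF sF,
    hν.integral (F := fun w => φ (y, w.2 * w.1) * F (w.1, y, w.2)) (by fun_prop) sF'.mul_left,
    integral_section_swap cF sF]

end Triple

/-! ### Reduction of test functions to tensors -/

/-- Uniform approximation of test functions on a product by sums of products. -/
lemma exists_sum_tensor_approx {X Y 𝕜 : Type*} [TopologicalSpace X] [T2Space X]
    [TopologicalSpace Y] [T2Space Y] [LocallyCompactSpace Y] [RCLike 𝕜]
    {F : X × Y → 𝕜} (hF : Continuous F) (hF' : HasCompactSupport F) :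
    ∃ K : Set (X × Y), IsCompact K ∧ (∀ v ∉ K, F v = 0) ∧ ∀ ε > 0, ∃ (n : ℕ) (a : Fin n → X → 𝕜)
      (b : Fin n → Y → 𝕜), (∀ i, Continuous (a i) ∧ HasCompactSupport (a i)) ∧
      (∀ i, Continuous (b i) ∧ HasCompactSupport (b i)) ∧
      (∀ v ∉ K, ∀ i, a i v.1 * b i v.2 = 0) ∧ ∀ v, ‖F v - ∑ i, a i v.1 * b i v.2‖ ≤ ε := by
  set K₁ := Prod.fst '' tsupport F
  set K₂ := Prod.snd '' tsupport F
  have hK₁ : IsCompact K₁ := hF'.isCompact.image continuous_fst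
  have hK₂ : IsCompact K₂ := hF'.isCompact.image continuous_snd
  have z₁ : ∀ x y, x ∉ K₁ → F (x, y) = 0 := fun x y hx => by
    by_contra h
    exact hx ⟨(x, y), subset_tsupport _ h, rfl⟩
  have z₂ : ∀ x y, y ∉ K₂ → F (x, y) = 0 := fun x y hx => by
    by_contra h
    exact hx ⟨(x, y), subset_tsupport _ h, rfl⟩
  obtain ⟨L, hL, hKL⟩ := exists_compact_superset hK₂
  refine ⟨K₁ ×ˢ L, hK₁.prod hL, fun v hv => ?_, fun ε hε => ?_⟩
  · by_contra h
    exact hv ⟨⟨v, subset_tsupport _ h, rfl⟩,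
      interior_subset (hKL ⟨v, subset_tsupport _ h, rfl⟩)⟩
  -- Compactness of the first projection makes the neighbourhood of y₀ independent of x.
  have hV : ∀ y₀, ∃ V, IsOpen V ∧ y₀ ∈ V ∧ ∀ y ∈ V, ∀ x, ‖F (x, y) - F (x, y₀)‖ ≤ ε := by
    intro y₀
    have : ∀ᶠ y in 𝓝 y₀, ∀ x ∈ K₁, ‖F (x, y) - F (x, y₀)‖ < ε := by
      refine hK₁.eventually_forall_of_forall_eventually fun x _ => ?_
      have hc : Continuous fun z : Y × X => ‖F (z.2, z.1) - F (z.2, y₀)‖ := by fun_prop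
      exact (hc.tendsto' (y₀, x) 0 (by simp)).eventually_lt_const hε
    obtain ⟨V, hV, hVo, hVy⟩ := eventually_nhds_iff.1 this
    refine ⟨V, hVo, hVy, fun y hy x => ?_⟩
    by_cases hx : x ∈ K₁
    · exact (hV y hy x hx).le
    · simp [z₁ x _ hx, hε.le]
  choose V hVo hVy hVε using hV
  obtain ⟨t, -, ht⟩ := hK₂.elim_nhds_subcover V fun y _ => (hVo y).mem_nhds (hVy y)
  set e := t.equivFin
  set s : Fin t.card → Set Y := fun i => V (e.symm i) ∩ interior L with hs
  obtain ⟨f, f1, f2, f3, f4⟩ := exists_continuous_sum_one_of_isOpen_isCompact (s := s)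
    (fun i => (hVo _).inter isOpen_interior) hK₂ (fun y hy => by
      obtain ⟨y₀, hy₀, hyV⟩ := mem_iUnion₂.1 (ht hy)
      exact mem_iUnion.2 ⟨e ⟨y₀, hy₀⟩, by simpa using hyV, hKL hy⟩)
  have fz : ∀ i y, y ∉ s i → f i y = 0 := fun i y hy => by
    by_contra h
    exact hy (f1 i (subset_tsupport _ h))
  -- The bump functions add up to 1 only on K₂. Dividing by the maximum of 1 and their sum keeps
  -- that value there and makes the sum at most 1 everywhere.
  set S : Y → ℝ := fun y => max 1 (∑ i, f i y) with hS
  have hSc : Continuous S := continuous_const.max (continuous_finsetSum _ fun i _ =>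
    (f i).continuous)
  have hS0 : ∀ y, 0 < S y := fun y => lt_of_lt_of_le one_pos (le_max_left _ _)
  set b : Fin t.card → Y → ℝ := fun i y => f i y / S y with hb
  have b0 : ∀ i y, 0 ≤ b i y := fun i y => div_nonneg (f3 i y).1 (hS0 y).le
  have bsum : ∀ y, ∑ i, b i y ≤ 1 := fun y => by
    rw [← Finset.sum_div, div_le_one (hS0 y)]
    exact le_max_right _ _
  have bone : ∀ y ∈ K₂, ∑ i, b i y = 1 := fun y hy => by
    have h1 : ∑ i, f i y = 1 := by simpa using f2 hy
    rw [← Finset.sum_div, hS]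
    simp [h1]
  have bc : ∀ i, Continuous (b i) := fun i => (f i).continuous.div hSc fun y => (hS0 y).ne'
  have bs : ∀ i, HasCompactSupport (b i) := fun i => by
    exact HasCompactSupport.intro (f4 i).isCompact fun y hy => by
      simp [hb, image_eq_zero_of_notMem_tsupport hy]
  have bz : ∀ i y, y ∉ s i → b i y = 0 := fun i y hy => by simp [hb, fz i y hy]
  refine ⟨t.card, fun i x => F (x, e.symm i), fun i y => (b i y : 𝕜), fun i => ⟨by fun_prop, ?_⟩,
    fun i => ⟨RCLike.continuous_ofReal.comp (bc i),
      (bs i).comp_left (g := fun r : ℝ => (r : 𝕜)) (by simp)⟩, fun v hv i => ?_, fun v => ?_⟩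
  · exact HasCompactSupport.intro hK₁ fun x hx => z₁ x _ hx
  · by_cases h1 : v.1 ∈ K₁
    · have : v.2 ∉ s i := fun h => hv ⟨h1, interior_subset h.2⟩
      simp [bz i _ this]
    · simp [z₁ _ _ h1]
  · have e : F v - ∑ i, F (v.1, e.symm i) * (b i v.2 : 𝕜)
        = ∑ i, (F (v.1, v.2) - F (v.1, e.symm i)) * (b i v.2 : 𝕜) := by
      simp only [sub_mul, Finset.sum_sub_distrib, ← Finset.mul_sum, ← RCLike.ofReal_sum]
      congr 1
      by_cases h2 : v.2 ∈ K₂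
      · simp [bone _ h2]
      · rw [show F v = 0 from z₂ v.1 v.2 h2, zero_mul]
    rw [e]
    calc _ ≤ ∑ i, ε * b i v.2 := by
          refine norm_sum_le_of_le _ fun i _ => ?_
          rw [norm_mul, RCLike.norm_ofReal, abs_of_nonneg (b0 i _)]
          by_cases h2 : v.2 ∈ s i
          · exact mul_le_mul_of_nonneg_right (hVε _ _ h2.1 _) (b0 i _)
          · simp [bz i _ h2]
      _ = ε * ∑ i, b i v.2 := (Finset.mul_sum _ _ _).symm
      _ ≤ ε * 1 := mul_le_mul_of_nonneg_left (bsum _) hε.le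
      _ = ε := mul_one _

section Tensor

variable {X Y Z : Type*} [TopologicalSpace X] [T2Space X] [TopologicalSpace Y] [T2Space Y]
  [LocallyCompactSpace Y] [TopologicalSpace Z] [MeasurableSpace Z] [BorelSpace Z]
  {𝕜 : Type*} [RCLike 𝕜]

/-- The approximating tensor sums vanish off one compact set K that does not depend on ε, so uniform
closeness and integrability of w over θ⁻¹(K) suffice. The map θ need not be proper, which permits a
projection. -/
lemma integral_eq_zero_of_tensor {νZ : Measure Z} {w : Z → 𝕜} {θ : Z → X × Y}
    (hθ : Continuous θ) (hw : ∀ K, IsCompact K → IntegrableOn w (θ ⁻¹' K) νZ)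
    (h : ∀ (a : X → 𝕜) (b : Y → 𝕜), Continuous a → HasCompactSupport a → Continuous b →
      HasCompactSupport b → ∫ z, w z * (a (θ z).1 * b (θ z).2) ∂νZ = 0)
    {F : X × Y → 𝕜} (hF : Continuous F) (hF' : HasCompactSupport F) :
    ∫ z, w z * F (θ z) ∂νZ = 0 := by
  obtain ⟨K, hK, hFK, happ⟩ := exists_sum_tensor_approx hF hF'
  have hwi := hw K hK
  have hint : ∀ f : X × Y → 𝕜, Continuous f → (∀ v ∉ K, f v = 0) →
      Integrable (fun z => w z * f (θ z)) νZ := by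
    intro f hf hfK
    have hfs : HasCompactSupport f := HasCompactSupport.intro hK hfK
    obtain ⟨M, hM⟩ := hf.bounded_above_of_compact_support hfs
    have h1 : IntegrableOn (fun z => w z * f (θ z)) (θ ⁻¹' K) νZ :=
      hwi.mul_bdd (c := M) (hf.comp hθ).aestronglyMeasurable (ae_of_all _ fun z => hM _)
    rwa [integrableOn_iff_integrable_of_support_subset] at h1
    intro z hz
    by_contra hzK
    exact hz (by simp [hfK _ hzK])
  set B := ∫ z in θ ⁻¹' K, ‖w z‖ ∂νZ
  have hB : 0 ≤ B := integral_nonneg fun z => norm_nonneg _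
  rw [← norm_le_zero_iff]
  refine le_of_forall_pos_le_add fun ε hε => ?_
  obtain ⟨n, a, b, ha, hb, hab, happ⟩ := happ (ε / (B + 1)) (by positivity)
  have e0 : ∫ z, w z * ∑ i, a i (θ z).1 * b i (θ z).2 ∂νZ = 0 := by
    simp only [Finset.mul_sum]
    rw [integral_finsetSum]
    · exact Finset.sum_eq_zero fun i _ => h _ _ (ha i).1 (ha i).2 (hb i).1 (hb i).2
    · exact fun i _ => hint (fun v => a i v.1 * b i v.2)
        (((ha i).1.comp continuous_fst).mul ((hb i).1.comp continuous_snd)) (fun v hv => hab v hv i)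
  have hsc : Continuous fun v : X × Y => ∑ i, a i v.1 * b i v.2 :=
    continuous_finsetSum _ fun i _ =>
      ((ha i).1.comp continuous_fst).mul ((hb i).1.comp continuous_snd)
  have hs0 : ∀ v ∉ K, ∑ i, a i v.1 * b i v.2 = 0 := fun v hv =>
    Finset.sum_eq_zero fun i _ => hab v hv i
  have e1 : ∫ z, w z * F (θ z) ∂νZ
      = ∫ z in θ ⁻¹' K, w z * (F (θ z) - ∑ i, a i (θ z).1 * b i (θ z).2) ∂νZ := by
    rw [setIntegral_eq_integral_of_forall_compl_eq_zero (fun z hz => by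
      rw [hFK _ hz, hs0 _ hz, sub_zero, mul_zero])]
    simp only [mul_sub]
    rw [integral_sub (hint F hF hFK) (hint _ hsc hs0), e0, sub_zero]
  rw [e1, zero_add]
  calc _ ≤ ∫ z in θ ⁻¹' K, ‖w z‖ * (ε / (B + 1)) ∂νZ := by
        refine (norm_integral_le_integral_norm _).trans (integral_mono_of_nonneg
          (ae_of_all _ fun z => norm_nonneg _) (hwi.norm.mul_const _) (ae_of_all _ fun z => ?_))
        simp only [norm_mul]
        exact mul_le_mul_of_nonneg_left (happ _) (norm_nonneg _)
    _ = B * (ε / (B + 1)) := integral_mul_const _ _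
    _ ≤ ε := by
        rw [mul_div_assoc', div_le_iff₀ (by positivity)]
        nlinarith

variable [T2Space Z] [LocallyCompactSpace Z] {νZ : Measure Z} [νZ.Regular]

/-- The homeomorphism θ leaves room for sheared tensors such as a(x) b(xy) as test functions. -/
lemma lae_eq_zero_of_tensor {u : Z → 𝕜} (hu : LocBdd u) (θ : Z ≃ₜ X × Y)
    (h : ∀ (a : X → 𝕜) (b : Y → 𝕜), Continuous a → HasCompactSupport a → Continuous b →
      HasCompactSupport b → ∫ z, u z * (a (θ z).1 * b (θ z).2) ∂νZ = 0) :
    ∀ᶠ z in lae νZ, u z = 0 := by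
  obtain ⟨w, wc, hw⟩ := hu.bound
  refine lae_eq_zero_of_integral hu fun F hF hF' => ?_
  have := integral_eq_zero_of_tensor (νZ := νZ) θ.continuous (w := u) (fun K hK => ?_) h
    (F := fun v => F (θ.symm v)) (hF.comp θ.symm.continuous)
    (hF'.comp_homeomorph θ.symm)
  · simpa using this
  · have hK' : IsCompact (θ ⁻¹' K) := θ.isClosedEmbedding.isCompact_preimage hK
    obtain ⟨B, hB⟩ := hK'.exists_bound_of_continuousOn wc.continuousOn
    refine Measure.integrableOn_of_bounded (M := B) hK'.measure_lt_top.ne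
      hu.measurable.aestronglyMeasurable ?_
    filter_upwards [ae_restrict_mem hK'.isClosed.measurableSet] with z hz
    exact (hw z).trans ((le_abs_self _).trans (hB z hz))

end Tensor

section TripleTensor

variable {G : Type*} [TopologicalSpace G] [LocallyCompactSpace G] [T2Space G]
  {𝕜 : Type*} [RCLike 𝕜]
  [MeasurableSpace (G × G × G)] [BorelSpace (G × G × G)] {ν₃ : Measure (G × G × G)}
  [ν₃.Regular]

/-- The reduction is used twice: for the splitting of G × G × G, then for the last two coordinates
with u(v) a(v₁) as weight, where the support of a makes up for the projection not being proper. -/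
lemma lae_eq_zero_of_tensor_triple {u : G × G × G → 𝕜} (hu : LocBdd u)
    (h : ∀ a b c : G → 𝕜, Continuous a → HasCompactSupport a → Continuous b →
      HasCompactSupport b → Continuous c → HasCompactSupport c →
      ∫ v, u v * (a v.1 * (b v.2.1 * c v.2.2)) ∂ν₃ = 0) :
    ∀ᶠ v in lae ν₃, u v = 0 := by
  refine lae_eq_zero_of_tensor hu (Homeomorph.refl _) fun a F ac as Fc Fs => ?_
  have := integral_eq_zero_of_tensor (νZ := ν₃) (θ := Prod.snd) (F := F)
    (w := fun v => u v * a v.1) continuous_snd (fun K hK => ?_) (fun b c bc bs cc cs => ?_) Fc Fs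
  · simpa only [mul_assoc, Homeomorph.refl_apply, id] using this
  · obtain ⟨χ, χc, χs, χ1, χb⟩ := exists_cutoff hK
    have hc : Continuous fun v : G × G × G => a v.1 * (χ v.2 : 𝕜) :=
      (ac.comp continuous_fst).mul (RCLike.continuous_ofReal.comp (χc.comp continuous_snd))
    have hs : HasCompactSupport fun v : G × G × G => a v.1 * (χ v.2 : 𝕜) :=
      hasCompactSupport_tensor (f := a) (g := fun y : G × G => (χ y : 𝕜)) as
        (χs.comp_left (g := fun r : ℝ => (r : 𝕜)) (by simp))
    refine (hu.integrable hc hs ν₃).integrableOn.congr_fun (fun v hv => ?_)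
      (hK.isClosed.preimage continuous_snd).measurableSet
    simp [χ1 v.2 hv]
  · simpa only [mul_assoc] using h a b c ac as bc bs cc cs

end TripleTensor

/-! ### Borel densities of dominated functionals on a locally compact group -/

-- The subgroup generated by a compact symmetric neighbourhood of 1 is the union of the powers of
-- that neighbourhood. Its cosets are clopen and σ-compact, hence pieces on which the Radon-Nikodym
-- theorem applies.
open scoped Pointwise in
lemma exists_isOpen_sigmaCompact_subgroup (H : Type*) [Group H] [TopologicalSpace H]
    [IsTopologicalGroup H] [LocallyCompactSpace H] :
    ∃ S : Subgroup H, IsOpen (S : Set H) ∧ ∃ K : ℕ → Set H, (∀ n, IsCompact (K n)) ∧ Monotone K ∧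
      ⋃ n, K n = S := by
  obtain ⟨V, hV, hV1⟩ := exists_compact_mem_nhds (1 : H)
  set W := V ∪ V⁻¹
  have hW : IsCompact W := hV.union hV.inv
  have hWi : W⁻¹ = W := by simp [W, union_comm]
  have hWn : ∀ n : ℕ, IsCompact (W ^ n) := fun n => by
    induction n with
    | zero => simp
    | succ n ih => rw [pow_succ]; exact ih.mul hW
  let S : Subgroup H :=
    { carrier := ⋃ n : ℕ, W ^ n
      mul_mem' := fun {a b} ha hb => by
        obtain ⟨n, hn⟩ := mem_iUnion.1 ha
        obtain ⟨k, hk⟩ := mem_iUnion.1 hb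
        exact mem_iUnion.2 ⟨n + k, by rw [pow_add]; exact mul_mem_mul hn hk⟩
      one_mem' := mem_iUnion.2 ⟨0, by simp⟩
      inv_mem' := fun {a} ha => by
        obtain ⟨n, hn⟩ := mem_iUnion.1 ha
        refine mem_iUnion.2 ⟨n, ?_⟩
        rw [← hWi, inv_pow]
        exact inv_mem_inv.2 hn }
  refine ⟨S, S.isOpen_of_mem_nhds (g := 1) (mem_of_superset hV1 fun x hx => mem_iUnion.2
    ⟨1, by rw [pow_one]; exact Or.inl hx⟩), fun n => accumulate (fun n : ℕ => W ^ n) n,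
    isCompact_accumulate hWn, monotone_accumulate, iUnion_accumulate⟩

section Density

variable {X : Type*} [TopologicalSpace X] [T2Space X] [LocallyCompactSpace X] [MeasurableSpace X]
  [BorelSpace X] {ν : Measure X} [ν.Regular]

lemma sigmaFinite_restrict {ρ : Measure X} [IsFiniteMeasureOnCompacts ρ] {U : Set X}
    {K : ℕ → Set X} (hK : ∀ n, IsCompact (K n)) (hKU : ⋃ n, K n = U) :
    SigmaFinite (ρ.restrict U) := by
  have hU : MeasurableSet U := hKU ▸ MeasurableSet.iUnion fun n => (hK n).isClosed.measurableSet
  refine ⟨⟨⟨fun n => K n ∪ Uᶜ, fun _ => trivial, fun n => ?_, ?_⟩⟩⟩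
  · refine (measure_union_le _ _).trans_lt ?_
    rw [Measure.restrict_apply hU.compl, compl_inter_self, measure_empty, add_zero]
    exact (Measure.restrict_apply_le _ _).trans_lt (hK n).measure_lt_top
  · rw [← iUnion_union, hKU, union_compl_self]

/-- The Riesz measure of a positive functional dominated by `∫ · dν` is dominated by `ν`. -/
lemma rieszMeasure_restrict_le {Λ : C_c(X, ℝ) →ₚ[ℝ] ℝ}
    (hΛ : ∀ f : C_c(X, ℝ), 0 ≤ f → Λ f ≤ ∫ x, f x ∂ν) {U : Set X} {K : ℕ → Set X}
    (hK : ∀ n, IsCompact (K n)) (hKU : ⋃ n, K n = U) (hU : IsClosed U) :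
    (RealRMK.rieszMeasure Λ).restrict U ≤ ν.restrict U := by
  set m := RealRMK.rieszMeasure Λ
  have hm : m.Regular := RealRMK.regular_rieszMeasure Λ
  have hcomp : ∀ L, IsCompact L → m L ≤ ν L := by
    intro L hL
    refine ENNReal.le_of_forall_pos_le_add fun ε hε hν => ?_
    obtain ⟨V, hLV, hV, hVν⟩ := L.exists_isOpen_le_add ν (ε := ε) (by simpa using hε.ne')
    obtain ⟨f, f1, f0, fs, fb⟩ := exists_continuous_one_zero_of_isCompact hL hV.isClosed_compl
      (disjoint_compl_right_iff_subset.2 hLV)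
    let F : C_c(X, ℝ) := ⟨f, fs⟩
    have hVfin : ν V ≠ ⊤ := ne_top_of_le_ne_top (by finiteness) hVν
    calc m L ≤ ENNReal.ofReal (Λ F) :=
          RealRMK.rieszMeasure_le_of_eq_one Λ (f := F) (fun x => (fb x).1) hL fun x hx => f1 hx
      _ ≤ ENNReal.ofReal (∫ x, f x ∂ν) := ENNReal.ofReal_le_ofReal (hΛ F fun x => (fb x).1)
      _ ≤ ENNReal.ofReal (∫ x, V.indicator 1 x ∂ν) := by
          refine ENNReal.ofReal_le_ofReal (integral_mono_of_nonneg
            (ae_of_all _ fun x => (fb x).1) ?_ (ae_of_all _ fun x => ?_))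
          · exact (integrable_indicator_iff hV.measurableSet).2 (integrableOn_const hVfin)
          · by_cases hx : x ∈ V
            · simpa [hx] using (fb x).2
            · have : f x = 0 := f0 hx
              simp [hx, this]
      _ = ν V := by
          rw [integral_indicator_one hV.measurableSet, measureReal_def,
            ENNReal.ofReal_toReal hVfin]
      _ ≤ ν L + ε := hVν
  have := sigmaFinite_restrict (ρ := m) hK hKU
  refine Measure.le_iff.2 fun A hA => ?_
  -- Inner regularity on all measurable sets comes from σ-finiteness of the restriction to U; it
  -- reduces the comparison to compact sets.
  rw [hA.measure_eq_iSup_isCompact]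
  refine iSup₂_le fun L hLA => iSup_le fun hL => ?_
  rw [Measure.restrict_apply hL.isClosed.measurableSet]
  refine (hcomp _ (hL.inter_right hU)).trans ?_
  rw [← Measure.restrict_apply hL.isClosed.measurableSet]
  exact measure_mono hLA

/-- A bounded function is, on a σ-compact set, almost everywhere a limit of continuous functions. -/
lemma exists_continuous_tendsto_ae {U : Set X} {K : ℕ → Set X} (hK : ∀ n, IsCompact (K n))
    (hKm : Monotone K) (hKU : ⋃ n, K n = U) {d : X → ℝ} (hd : Measurable d)
    (hd1 : ∀ x, ‖d x‖ ≤ 1) :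
    ∃ g : ℕ → X → ℝ, (∀ n, Continuous (g n)) ∧
      ∀ᵐ x ∂ν.restrict U, Tendsto (fun n => g n x) atTop (𝓝 (d x)) := by
  have hi : ∀ n, Integrable ((K n).indicator d) ν := fun n =>
    (integrable_indicator_iff (hK n).isClosed.measurableSet).2
      (Measure.integrableOn_of_bounded (M := 1) (hK n).measure_lt_top.ne hd.aestronglyMeasurable
        (ae_of_all _ hd1))
  have hg : ∀ n : ℕ, ∃ g : X → ℝ, Continuous g ∧ ∫⁻ x, ‖(K n).indicator d x - g x‖ₑ ∂ν
      ≤ ENNReal.ofReal ((1 / 2) ^ n) := fun n => by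
    obtain ⟨g, -, h1, h2, h3⟩ :=
      exists_hasCompactSupport_integral_sub_le (hi n) (ε := (1 / 2) ^ n) (by positivity)
    refine ⟨g, h2, ?_⟩
    have := ofReal_integral_norm_eq_lintegral_enorm ((hi n).sub h3)
    simp only [Pi.sub_apply] at this
    rw [← this]
    exact ENNReal.ofReal_le_ofReal h1
  choose g gc hg using hg
  refine ⟨g, gc, ?_⟩
  have hmeas : ∀ n, Measurable fun x => ‖(K n).indicator d x - g n x‖ₑ := fun n =>
    ((hd.indicator (hK n).isClosed.measurableSet).sub (gc n).measurable).enorm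
  -- The L¹ errors are summable, so the series of pointwise errors is finite almost everywhere and
  -- its terms tend to 0.
  have hsum : ∫⁻ x, ∑' n, ‖(K n).indicator d x - g n x‖ₑ ∂ν ≠ ⊤ := by
    rw [lintegral_tsum fun n => (hmeas n).aemeasurable]
    refine ne_top_of_le_ne_top ?_ (ENNReal.tsum_le_tsum hg)
    rw [← ENNReal.ofReal_tsum_of_nonneg (fun n => by positivity)
      (summable_geometric_of_lt_one (by norm_num) (by norm_num))]
    exact ENNReal.ofReal_ne_top
  have hU : MeasurableSet U := hKU ▸ MeasurableSet.iUnion fun n => (hK n).isClosed.measurableSet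
  rw [ae_restrict_iff' hU]
  filter_upwards [ae_lt_top (Measurable.tsum hmeas) hsum] with x hx hxU
  have h0 := ENNReal.tendsto_atTop_zero_of_tsum_ne_top hx.ne
  rw [tendsto_zero_iff_enorm_tendsto_zero.symm] at h0
  obtain ⟨N, hN⟩ := mem_iUnion.1 (hKU.symm ▸ hxU)
  have h1 : Tendsto (fun n => (K n).indicator d x - ((K n).indicator d x - g n x)) atTop
      (𝓝 (d x - 0)) := by
    refine Tendsto.sub (tendsto_const_nhds.congr' ?_) h0
    filter_upwards [eventually_ge_atTop N] with n hn
    rw [indicator_of_mem (hKm hn hN)]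
  simpa using h1

/-- On the σ-compact set U the measure of Λ is dominated by ν, and d is its Radon-Nikodym
derivative. The continuous functions converging to d are recorded because, unlike d itself, they can
be glued over uncountably many cosets. -/
lemma exists_density_on {Λ : C_c(X, ℝ) →ₚ[ℝ] ℝ}
    (hΛ : ∀ f : C_c(X, ℝ), 0 ≤ f → Λ f ≤ ∫ x, f x ∂ν) {U : Set X} {K : ℕ → Set X}
    (hK : ∀ n, IsCompact (K n)) (hKm : Monotone K) (hKU : ⋃ n, K n = U) (hU : IsClosed U) :
    ∃ (d : X → ℝ) (g : ℕ → X → ℝ), (∀ n, Continuous (g n)) ∧ (∀ x, 0 ≤ d x ∧ d x ≤ 1) ∧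
      (∀ᵐ x ∂ν.restrict U, Tendsto (fun n => g n x) atTop (𝓝 (d x))) ∧
      ∀ f : C_c(X, ℝ), (∀ x ∉ U, f x = 0) → Λ f = ∫ x in U, d x * f x ∂ν := by
  set m := RealRMK.rieszMeasure Λ
  have hm : m.Regular := RealRMK.regular_rieszMeasure Λ
  have hle : m.restrict U ≤ ν.restrict U := rieszMeasure_restrict_le hΛ hK hKU hU
  have := sigmaFinite_restrict (ρ := m) hK hKU
  have := sigmaFinite_restrict (ρ := ν) hK hKU
  set r := (m.restrict U).rnDeriv (ν.restrict U)
  have hr : r ≤ᵐ[ν.restrict U] 1 := Measure.rnDeriv_le_one_of_le hle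
  -- The bound r ≤ 1 holds only almost everywhere; the truncation makes it hold at every point.
  set d : X → ℝ := fun x => min (r x).toReal 1 with hd
  have dm : Measurable d := (Measure.measurable_rnDeriv _ _).ennreal_toReal.min measurable_const
  have d01 : ∀ x, 0 ≤ d x ∧ d x ≤ 1 := fun x =>
    ⟨le_min ENNReal.toReal_nonneg zero_le_one, min_le_right _ _⟩
  obtain ⟨g, gc, hg⟩ := exists_continuous_tendsto_ae (ν := ν) hK hKm hKU dm fun x => by
    rw [Real.norm_eq_abs, abs_of_nonneg (d01 x).1]
    exact (d01 x).2
  refine ⟨d, g, gc, d01, hg, fun f hf => ?_⟩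
  have e1 : Λ f = ∫ x in U, f x ∂m := by
    rw [setIntegral_eq_integral_of_forall_compl_eq_zero hf]
    exact (RealRMK.integral_rieszMeasure Λ f).symm
  rw [e1, ← integral_rnDeriv_smul (Measure.absolutelyContinuous_of_le hle)]
  refine integral_congr_ae ?_
  filter_upwards [hr] with x hx
  have : (r x).toReal ≤ 1 := ENNReal.toReal_le_of_le_ofReal zero_le_one (by simpa using hx)
  simp [hd, r, this]

end Density

section GroupDensity

variable {H : Type*} [Group H] [TopologicalSpace H] [IsTopologicalGroup H]
  [LocallyCompactSpace H] [T2Space H] [MeasurableSpace H] [BorelSpace H]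
  {ν : Measure H} [ν.Regular]

/-- There may be uncountably many cosets, so Borel densities chosen on each need not form a Borel
function. The approximating continuous functions do glue to continuous functions, since cosets are
open, and the limsup of a sequence of these is Borel. A test function meets only finitely many
cosets, so the integral formula is a finite sum. -/
lemma exists_density_of_le {Λ : C_c(H, ℝ) →ₚ[ℝ] ℝ}
    (hΛ : ∀ f : C_c(H, ℝ), 0 ≤ f → Λ f ≤ ∫ x, f x ∂ν) :
    ∃ h : H → ℝ, Measurable h ∧ (∀ x, 0 ≤ h x ∧ h x ≤ 1) ∧
      ∀ f : C_c(H, ℝ), Λ f = ∫ x, h x * f x ∂ν := by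
  obtain ⟨S, hS, K, hK, hKm, hKS⟩ := exists_isOpen_sigmaCompact_subgroup H
  have hdisc : DiscreteTopology (H ⧸ S) := QuotientGroup.discreteTopology hS
  let π : H → H ⧸ S := QuotientGroup.mk
  have πc : Continuous π := QuotientGroup.continuous_mk
  have hUc : ∀ q, IsClopen (π ⁻¹' {q}) := fun q => (isClopen_discrete _).preimage πc
  have hUK : ∀ q : H ⧸ S, ⋃ n, (fun x => q.out * x) '' K n = π ⁻¹' {q} := fun q => by
    rw [← image_iUnion, hKS]
    ext x
    simp only [mem_image, SetLike.mem_coe, mem_preimage, mem_singleton_iff, π]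
    constructor
    · rintro ⟨y, hy, rfl⟩
      rw [QuotientGroup.mk_mul_of_mem _ hy, QuotientGroup.out_eq']
    · rintro rfl
      exact ⟨(QuotientGroup.mk x : H ⧸ S).out⁻¹ * x,
        QuotientGroup.eq.1 (QuotientGroup.out_eq' _), by simp⟩
  choose d g gc d01 hg hd using fun q : H ⧸ S => exists_density_on (ν := ν) hΛ
    (fun n => (hK n).image (continuous_const_mul q.out))
    (fun a b hab => image_mono (hKm hab)) (hUK q) (hUc q).isClosed
  set γ : ℕ → H → ℝ := fun n x => g (π x) n x
  have γc : ∀ n, Continuous (γ n) := fun n => continuous_iff_continuousAt.2 fun x => by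
    refine (gc (π x) n).continuousAt.congr ?_
    filter_upwards [(hUc (π x)).isOpen.mem_nhds rfl] with y hy
    have : π y = π x := hy
    simp only [γ, this]
  -- The clamping matters only where the sequence fails to converge to the density.
  set h : H → ℝ := fun x => max 0 (min (limsup (fun n => γ n x) atTop) 1)
  have hm : Measurable h := measurable_const.max
    ((Measurable.limsup fun n => (γc n).measurable).min measurable_const)
  have h01 : ∀ x, 0 ≤ h x ∧ h x ≤ 1 := fun x =>
    ⟨le_max_left _ _, max_le zero_le_one (min_le_right _ _)⟩
  have hhd : ∀ q, ∀ᵐ x ∂ν.restrict (π ⁻¹' {q}), h x = d q x := fun q => by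
    filter_upwards [hg q, ae_restrict_mem (hUc q).isOpen.measurableSet] with x hx hxq
    have hxq : π x = q := hxq
    have : limsup (fun n => γ n x) atTop = d q x := by
      simp only [γ, hxq]
      exact hx.limsup_eq
    simp only [h, this]
    rw [min_eq_left (d01 q x).2, max_eq_right (d01 q x).1]
  refine ⟨h, hm, h01, fun f => ?_⟩
  have hfin : (π '' tsupport f).Finite := (f.hasCompactSupport.isCompact.image πc).finite_of_discrete
  set T := hfin.toFinset
  let fq : H ⧸ S → C_c(H, ℝ) := fun q =>
    ⟨⟨(π ⁻¹' {q}).indicator f, f.continuous.indicator fun x hx => by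
      rw [(hUc q).frontier_eq] at hx
      exact hx.elim⟩, f.hasCompactSupport.mono' fun x hx => by
        refine subset_tsupport _ fun h0 => hx ?_
        change (π ⁻¹' {q}).indicator f x = 0
        by_cases hxq : x ∈ π ⁻¹' {q} <;> simp [hxq, h0]⟩
  have hfq : ∀ q x, fq q x = (π ⁻¹' {q}).indicator f x := fun q x => rfl
  have hsum : f = ∑ q ∈ T, fq q := by
    ext x
    rw [CompactlySupportedContinuousMap.sum_apply]
    simp only [hfq]
    by_cases hx : π x ∈ T
    · rw [Finset.sum_eq_single_of_mem _ hx fun q _ hq =>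
        indicator_of_notMem (fun h => hq (by simpa using h.symm)) _]
      simp
    · have : f x = 0 := by
        by_contra h0
        exact hx (hfin.mem_toFinset.2 ⟨x, subset_tsupport _ h0, rfl⟩)
      rw [this]
      refine (Finset.sum_eq_zero fun q _ => ?_).symm
      by_cases hxq : x ∈ π ⁻¹' {q} <;> simp [hxq, this]
  have hq : ∀ q, Λ (fq q) = ∫ x, h x * fq q x ∂ν := fun q => by
    rw [hd q (fq q) (fun x hx => indicator_of_notMem hx _),
      ← setIntegral_eq_integral_of_forall_compl_eq_zero (s := π ⁻¹' {q})
        (f := fun x => h x * fq q x) (fun x hx => by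
        rw [hfq, indicator_of_notMem hx, mul_zero])]
    refine integral_congr_ae ?_
    filter_upwards [hhd q] with x hx
    rw [hx]
  have hb : LocBdd h := LocBdd.of_bounded hm (C := 1) fun x => by
    rw [Real.norm_eq_abs, abs_of_nonneg (h01 x).1]
    exact (h01 x).2
  conv_lhs => rw [hsum]
  rw [map_sum]
  simp only [hq]
  rw [← integral_finsetSum (f := fun q x => h x * fq q x) _ fun q _ =>
    hb.integrable (fq q).continuous (fq q).hasCompactSupport ν]
  congr 1
  ext x
  rw [← Finset.mul_sum]
  congr 1
  conv_rhs => rw [hsum]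
  rw [CompactlySupportedContinuousMap.sum_apply]

end GroupDensity

/-! ### Bounded functionals on weighted L¹ spaces -/

section Functionals

variable {𝕜 : Type*} [RCLike 𝕜] {H : Type*} [TopologicalSpace H] [MeasurableSpace H]

/-- `ℓ` is a linear functional on `C_c(H)`, bounded for the norm `∫ |f| w dν`. -/
structure IsBddFunctional (ν : Measure H) (w : H → ℝ) (C : ℝ) (ℓ : (H → 𝕜) → 𝕜) : Prop where
  add : ∀ f g, Continuous f → HasCompactSupport f → Continuous g → HasCompactSupport g →
    ℓ (fun x => f x + g x) = ℓ f + ℓ g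
  smul : ∀ (c : 𝕜) f, Continuous f → HasCompactSupport f → ℓ (fun x => c * f x) = c * ℓ f
  bound : ∀ f, Continuous f → HasCompactSupport f → ‖ℓ f‖ ≤ C * ∫ x, ‖f x‖ * w x ∂ν

end Functionals

section Representation

variable {H : Type*} [Group H] [TopologicalSpace H] [IsTopologicalGroup H]
  [LocallyCompactSpace H] [T2Space H] [MeasurableSpace H] [BorelSpace H]
  {ν : Measure H} [ν.Regular]

/-- On nonnegative f the functional ℓ + (C + 1)∫ lies between 0 and 2(C + 1)∫, so after scaling it
is positive, dominated by ∫, and has a density h in [0, 1]. Undoing the scaling gives the density (C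
+ 1)(2h - 1). The extra 1 avoids division by zero when C = 0. -/
lemma IsBddFunctional.exists_density_real {ℓ : (H → ℝ) → ℝ} {C : ℝ} (hC : 0 ≤ C)
    (hℓ : IsBddFunctional ν (fun _ => 1) C ℓ) :
    ∃ h : H → ℝ, Measurable h ∧ (∀ x, ‖h x‖ ≤ C + 1) ∧
      ∀ f, Continuous f → HasCompactSupport f → ℓ f = ∫ x, h x * f x ∂ν := by
  have hB : 0 < C + 1 := by linarith
  have hi : ∀ f : C_c(H, ℝ), Integrable f ν := fun f =>
    f.continuous.integrable_of_hasCompactSupport f.hasCompactSupport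
  have hb : ∀ f : C_c(H, ℝ), 0 ≤ f → |ℓ f| ≤ C * ∫ x, f x ∂ν := fun f hf => by
    refine (hℓ.bound f f.continuous f.hasCompactSupport).trans_eq ?_
    congr 2
    ext x
    rw [mul_one, Real.norm_eq_abs, abs_of_nonneg (hf x)]
  have hI : ∀ f : C_c(H, ℝ), 0 ≤ f → 0 ≤ ∫ x, f x ∂ν := fun f hf =>
    integral_nonneg fun x => hf x
  let Λ₀ : C_c(H, ℝ) →ₗ[ℝ] ℝ :=
    { toFun := fun f => (2 * (C + 1))⁻¹ * (ℓ f + (C + 1) * ∫ x, f x ∂ν)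
      map_add' := fun f g => by
        have h1 : ℓ (f + g : C_c(H, ℝ)) = ℓ f + ℓ g :=
          hℓ.add f g f.continuous f.hasCompactSupport g.continuous g.hasCompactSupport
        have h2 : ∫ x, (f + g : C_c(H, ℝ)) x ∂ν = ∫ x, f x ∂ν + ∫ x, g x ∂ν :=
          integral_add (hi f) (hi g)
        rw [h1, h2]
        ring
      map_smul' := fun c f => by
        have h1 : ℓ (c • f : C_c(H, ℝ)) = c * ℓ f :=
          hℓ.smul c f f.continuous f.hasCompactSupport
        have h2 : ∫ x, (c • f : C_c(H, ℝ)) x ∂ν = c * ∫ x, f x ∂ν := integral_const_mul c f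
        rw [h1, h2, RingHom.id_apply, smul_eq_mul]
        ring }
  have hΛ₀ : ∀ f, Λ₀ f = (2 * (C + 1))⁻¹ * (ℓ f + (C + 1) * ∫ x, f x ∂ν) := fun _ => rfl
  let Λ : C_c(H, ℝ) →ₚ[ℝ] ℝ := PositiveLinearMap.mk₀ Λ₀ fun f hf => by
    rw [hΛ₀]
    have := (abs_le.1 (hb f hf)).1
    have := hI f hf
    exact mul_nonneg (by positivity) (by linarith)
  obtain ⟨h, hm, h01, hh⟩ := exists_density_of_le (ν := ν) (Λ := Λ) fun f hf => by
    change Λ₀ f ≤ _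
    rw [hΛ₀, inv_mul_le_iff₀ (by positivity)]
    have := (abs_le.1 (hb f hf)).2
    have := hI f hf
    linarith
  refine ⟨fun x => (C + 1) * (2 * h x - 1), by fun_prop, fun x => ?_, fun f hf hf' => ?_⟩
  · rw [norm_mul, Real.norm_eq_abs, abs_of_pos hB]
    refine mul_le_of_le_one_right hB.le ?_
    rw [Real.norm_eq_abs, abs_le]
    constructor <;> linarith [(h01 x).1, (h01 x).2]
  · have e : (2 * (C + 1))⁻¹ * (ℓ f + (C + 1) * ∫ x, f x ∂ν) = ∫ x, h x * f x ∂ν := hh ⟨⟨f, hf⟩, hf'⟩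
    have hb : LocBdd h := LocBdd.of_bounded hm (C := 1) fun x => by
      rw [Real.norm_eq_abs, abs_of_nonneg (h01 x).1]
      exact (h01 x).2
    have e2 : ∫ x, (C + 1) * (2 * h x - 1) * f x ∂ν
        = 2 * (C + 1) * ∫ x, h x * f x ∂ν - (C + 1) * ∫ x, f x ∂ν := by
      rw [← integral_const_mul, ← integral_const_mul, ← integral_sub
        ((hb.integrable hf hf' ν).const_mul _)
        ((hf.integrable_of_hasCompactSupport hf').const_mul _)]
      congr 1
      ext x
      ring
    rw [e2, ← e, mul_inv_cancel_left₀ (by positivity)]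
    ring

/-- The real and imaginary parts of ℓ on real test functions have real densities; complex linearity
does the rest. -/
lemma IsBddFunctional.exists_density_complex {ℓ : (H → ℂ) → ℂ} {C : ℝ} (hC : 0 ≤ C)
    (hℓ : IsBddFunctional ν (fun _ => 1) C ℓ) :
    ∃ h : H → ℂ, Measurable h ∧ (∀ x, ‖h x‖ ≤ 2 * (C + 1)) ∧
      ∀ f, Continuous f → HasCompactSupport f → ℓ f = ∫ x, h x * f x ∂ν := by
  have cs : ∀ {f : H → ℝ}, HasCompactSupport f → HasCompactSupport fun x => (f x : ℂ) :=
    fun hf => hf.comp_left (g := ((↑) : ℝ → ℂ)) Complex.ofReal_zero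
  have key : ∀ P : ℂ →L[ℝ] ℝ, (∀ z, |P z| ≤ ‖z‖) →
      IsBddFunctional ν (fun _ => 1) C fun f : H → ℝ => P (ℓ fun x => (f x : ℂ)) := fun P hP =>
    { add := fun f g hf hf' hg hg' => by
        rw [← map_add, ← hℓ.add _ _ (by fun_prop) (cs hf') (by fun_prop) (cs hg')]
        simp
      smul := fun c f hf hf' => by
        have := hℓ.smul c (fun x => (f x : ℂ)) (by fun_prop) (cs hf')
        simp only [Complex.ofReal_mul]
        rw [this, ← Complex.real_smul, map_smul, smul_eq_mul]
      bound := fun f hf hf' => by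
        refine (hP _).trans ((hℓ.bound _ (by fun_prop) (cs hf')).trans_eq ?_)
        simp }
  obtain ⟨h₁, m₁, b₁, e₁⟩ := (key Complex.reCLM Complex.abs_re_le_norm).exists_density_real hC
  obtain ⟨h₂, m₂, b₂, e₂⟩ := (key Complex.imCLM Complex.abs_im_le_norm).exists_density_real hC
  have hm : Measurable fun x => (h₁ x : ℂ) + h₂ x * Complex.I := by fun_prop
  have hbd : ∀ x, ‖(h₁ x : ℂ) + h₂ x * Complex.I‖ ≤ 2 * (C + 1) := fun x => by
    refine (norm_add_le _ _).trans ?_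
    rw [norm_mul, Complex.norm_I, mul_one, Complex.norm_real, Complex.norm_real]
    linarith [b₁ x, b₂ x]
  have L₁ : LocBdd h₁ := .of_bounded m₁ b₁
  have L₂ : LocBdd h₂ := .of_bounded m₂ b₂
  have L : LocBdd fun x => (h₁ x : ℂ) + h₂ x * Complex.I := .of_bounded hm hbd
  refine ⟨_, hm, hbd, fun f hf hf' => ?_⟩
  have real : ∀ f : H → ℝ, Continuous f → HasCompactSupport f →
      ℓ (fun x => (f x : ℂ)) = ∫ x, ((h₁ x : ℂ) + h₂ x * Complex.I) * f x ∂ν := fun f hf hf' => by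
    have i₁ : Integrable (fun x => ((h₁ x * f x : ℝ) : ℂ)) ν := (L₁.integrable hf hf' ν).ofReal (𝕜 := ℂ)
    have i₂ : Integrable (fun x => ((h₂ x * f x : ℝ) : ℂ) * Complex.I) ν := ((L₂.integrable hf hf' ν).ofReal (𝕜 := ℂ)).mul_const Complex.I
    have : ∀ x, ((h₁ x : ℂ) + h₂ x * Complex.I) * f x
        = ((h₁ x * f x : ℝ) : ℂ) + ((h₂ x * f x : ℝ) : ℂ) * Complex.I := fun x => by
      push_cast
      ring
    simp only [this]
    rw [integral_add i₁ i₂, integral_mul_const]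
    rw [integral_complex_ofReal, integral_complex_ofReal, ← e₁ f hf hf', ← e₂ f hf hf']
    exact (Complex.re_add_im _).symm
  have cre : HasCompactSupport fun x => (f x).re := hf'.comp_left (g := Complex.re) rfl
  have cim : HasCompactSupport fun x => (f x).im := hf'.comp_left (g := Complex.im) rfl
  have f1 := real (fun x => (f x).re) (by fun_prop) cre
  have f2 := real (fun x => (f x).im) (by fun_prop) cim
  have ci : HasCompactSupport fun x => Complex.I * ((f x).im : ℂ) := (cs cim).mul_left
  have e := hℓ.add (fun x => ((f x).re : ℂ)) (fun x => Complex.I * ((f x).im : ℂ)) (by fun_prop)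
    (cs cre) (by fun_prop) ci
  have e' := hℓ.smul Complex.I (fun x => ((f x).im : ℂ)) (by fun_prop) (cs cim)
  have hff : f = fun x => ((f x).re : ℂ) + Complex.I * ((f x).im : ℂ) := by
    ext x
    rw [mul_comm, Complex.re_add_im]
  rw [hff, e, e', f1, f2, ← integral_const_mul, ← integral_add
    (L.integrable (by fun_prop) (cs cre) ν)
    ((L.integrable (by fun_prop) (cs cim) ν).const_mul _)]
  congr 1
  ext x
  ring

/-- A bounded functional on a weighted `L¹` space is given by a weighted bounded density. -/
lemma IsBddFunctional.exists_density {ℓ : (H → ℂ) → ℂ} {C : ℝ} {w : H → ℝ} (hw : Continuous w)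
    (hw1 : ∀ x, 1 ≤ w x) (hℓ : IsBddFunctional ν w C ℓ) :
    ∃ h : H → ℂ, Measurable h ∧ (∃ C', ∀ x, ‖h x‖ ≤ C' * w x) ∧
      ∀ f, Continuous f → HasCompactSupport f → ℓ f = ∫ x, h x * f x ∂ν := by
  have hw0 : ∀ x, (w x : ℂ) ≠ 0 := fun x => by
    have := hw1 x
    exact_mod_cast (by linarith : w x ≠ 0)
  have hwp : ∀ x, 0 < w x := fun x => by linarith [hw1 x]
  have hwi : Continuous fun x => ((w x : ℂ))⁻¹ := (by fun_prop : Continuous fun x => (w x : ℂ)).inv₀ hw0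
  have cs : ∀ {f : H → ℂ}, HasCompactSupport f → HasCompactSupport fun x => (w x : ℂ)⁻¹ * f x :=
    fun hf => hf.mul_left
  -- Division by w turns the weighted norm into the unweighted one; the density found is multiplied
  -- by w again.
  have key : IsBddFunctional ν (fun _ => 1) |C| fun f : H → ℂ => ℓ fun x => (w x : ℂ)⁻¹ * f x :=
    { add := fun f g hf hf' hg hg' => by
        rw [← hℓ.add _ _ (by fun_prop) (cs hf') (by fun_prop) (cs hg')]
        simp only [mul_add]
      smul := fun c f hf hf' => by
        rw [← hℓ.smul c _ (by fun_prop) (cs hf')]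
        congr 1
        ext x
        ring
      bound := fun f hf hf' => by
        refine (hℓ.bound _ (by fun_prop) (cs hf')).trans ?_
        have : ∀ x, ‖(w x : ℂ)⁻¹ * f x‖ * w x = ‖f x‖ * 1 := fun x => by
          rw [norm_mul, norm_inv, Complex.norm_real, Real.norm_eq_abs, abs_of_pos (hwp x)]
          field_simp [(hwp x).ne']
        simp only [this]
        exact mul_le_mul_of_nonneg_right (le_abs_self C)
          (integral_nonneg fun x => by positivity) }
  obtain ⟨h, hm, hb, e⟩ := key.exists_density_complex (abs_nonneg C)
  refine ⟨fun x => h x * w x, hm.mul (by fun_prop), ⟨2 * (|C| + 1), fun x => ?_⟩, fun f hf hf' => ?_⟩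
  · rw [norm_mul, Complex.norm_real, Real.norm_eq_abs, abs_of_pos (hwp x)]
    exact mul_le_mul_of_nonneg_right (hb x) (hwp x).le
  · have := e (fun x => (w x : ℂ) * f x) (by fun_prop) hf'.mul_left
    simp only [inv_mul_cancel_left₀ (hw0 _)] at this
    rw [this]
    simp only [mul_assoc]

end Representation

/-! ### The Beurling space and its compactly supported continuous functions -/

lemma IsWeight.pos {G : Type*} [Group G] [TopologicalSpace G] {ω : G → ℝ} (hω : IsWeight ω)
    (x : G) : 0 < ω x := zero_lt_one.trans_le (hω.one_le x)

section BeurlingSpace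

variable {G : Type*} [Group G] [TopologicalSpace G] [IsTopologicalGroup G]
  [LocallyCompactSpace G] [T2Space G] [MeasurableSpace G] [BorelSpace G]
  {μ : Measure G} [μ.IsHaarMeasure] [μ.Regular] {ω : G → ℝ}

variable (μ ω) in
open Classical in
/-- The class of `f` in `L¹(G, ω)`, or `0` if there is none. -/
noncomputable def toL1 (f : G → ℂ) : L1 μ ω :=
  if h : MemLp f 1 (weightedMeasure μ ω) then h.toLp else 0

lemma conv_eq_toL1 (f g : L1 μ ω) :
    conv μ ω f g = toL1 μ ω fun x => ∫ y, f y * g (y⁻¹ * x) ∂μ := rfl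

lemma ae_weightedMeasure_iff (hω : IsWeight ω) {P : G → Prop} :
    (∀ᵐ x ∂weightedMeasure μ ω, P x) ↔ ∀ᵐ x ∂μ, P x := by
  have := hω.continuous
  rw [weightedMeasure, ae_withDensity_iff (by fun_prop)]
  simp [hω.pos]

lemma isLocallyFiniteMeasure_weightedMeasure (hω : IsWeight ω) :
    IsLocallyFiniteMeasure (weightedMeasure μ ω) :=
  IsLocallyFiniteMeasure.withDensity_ofReal hω.continuous

lemma integral_weightedMeasure {E : Type*} [NormedAddCommGroup E] [NormedSpace ℝ E]
    (hω : IsWeight ω) (f : G → E) :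
    ∫ x, f x ∂weightedMeasure μ ω = ∫ x, ω x • f x ∂μ := by
  have := hω.continuous
  rw [weightedMeasure, integral_withDensity_eq_integral_toReal_smul (by fun_prop) (by simp)]
  simp [ENNReal.toReal_ofReal (hω.pos _).le]

lemma integrable_weightedMeasure_iff (hω : IsWeight ω) (f : G → ℂ) :
    Integrable f (weightedMeasure μ ω) ↔ Integrable (fun x => ω x • f x) μ := by
  have := hω.continuous
  rw [weightedMeasure, integrable_withDensity_iff_integrable_smul' (by fun_prop) (by simp)]
  simp [ENNReal.toReal_ofReal (hω.pos _).le]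

lemma coeFn_toL1 (hω : IsWeight ω) {f : G → ℂ} (hf : Integrable f (weightedMeasure μ ω)) :
    ∀ᵐ x ∂μ, toL1 μ ω f x = f x := by
  rw [← ae_weightedMeasure_iff hω, toL1, dif_pos (memLp_one_iff_integrable.2 hf)]
  exact MemLp.coeFn_toLp _

lemma norm_L1_eq (hω : IsWeight ω) (f : L1 μ ω) : ‖f‖ = ∫ x, ω x * ‖f x‖ ∂μ := by
  rw [L1.norm_eq_integral_norm, integral_weightedMeasure hω]
  simp only [smul_eq_mul]

lemma norm_toL1 (hω : IsWeight ω) {f : G → ℂ} (hf : Integrable f (weightedMeasure μ ω)) :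
    ‖toL1 μ ω f‖ = ∫ x, ω x * ‖f x‖ ∂μ := by
  rw [norm_L1_eq hω]
  refine integral_congr_ae ?_
  filter_upwards [coeFn_toL1 hω hf] with x hx
  rw [hx]

lemma toL1_eq_toLp {f : G → ℂ} (hf : Integrable f (weightedMeasure μ ω)) :
    toL1 μ ω f = (memLp_one_iff_integrable.2 hf).toLp f := by
  rw [toL1, dif_pos (memLp_one_iff_integrable.2 hf)]

lemma toL1_add {f g : G → ℂ} (hf : Integrable f (weightedMeasure μ ω))
    (hg : Integrable g (weightedMeasure μ ω)) :
    toL1 μ ω (fun x => f x + g x) = toL1 μ ω f + toL1 μ ω g := by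
  rw [toL1_eq_toLp hf, toL1_eq_toLp hg, toL1_eq_toLp (f := fun x => f x + g x) (hf.add hg)]
  rfl

lemma toL1_const_mul (c : ℂ) {f : G → ℂ} (hf : Integrable f (weightedMeasure μ ω)) :
    toL1 μ ω (fun x => c * f x) = c • toL1 μ ω f := by
  rw [toL1_eq_toLp hf, toL1_eq_toLp (f := fun x => c * f x) (hf.const_mul c)]
  rfl

lemma toL1_sub {f g : G → ℂ} (hf : Integrable f (weightedMeasure μ ω))
    (hg : Integrable g (weightedMeasure μ ω)) :
    toL1 μ ω (fun x => f x - g x) = toL1 μ ω f - toL1 μ ω g := by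
  rw [toL1_eq_toLp hf, toL1_eq_toLp hg, toL1_eq_toLp (f := fun x => f x - g x) (hf.sub hg)]
  rfl

lemma toL1_eq_of_ae (hω : IsWeight ω) {f : G → ℂ} {F : L1 μ ω} (h : ∀ᵐ x ∂μ, f x = F x) :
    toL1 μ ω f = F := by
  have h' : f =ᵐ[weightedMeasure μ ω] F := (ae_weightedMeasure_iff hω).2 h
  have hm : MemLp f 1 (weightedMeasure μ ω) := (memLp_congr_ae h').2 (Lp.memLp F)
  rw [toL1, dif_pos hm]
  exact Lp.ext (hm.coeFn_toLp.trans h')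

lemma integrable_weightedMeasure_of_hasCompactSupport (hω : IsWeight ω) {E : Type*}
    [NormedAddCommGroup E] {f : G → E} (hf : Continuous f)
    (hf' : HasCompactSupport f) : Integrable f (weightedMeasure μ ω) := by
  have := isLocallyFiniteMeasure_weightedMeasure (μ := μ) hω
  exact hf.integrable_of_hasCompactSupport hf'

variable (μ) in
/-- The map of `C_c(G)` into `L¹(G, ω)`. -/
noncomputable def ccToL1 (hω : IsWeight ω) : C_c(G, ℂ) →ₗ[ℂ] L1 μ ω where
  toFun f := toL1 μ ω f
  map_add' f g :=
    toL1_add (integrable_weightedMeasure_of_hasCompactSupport hω f.continuous f.hasCompactSupport)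
      (integrable_weightedMeasure_of_hasCompactSupport hω g.continuous g.hasCompactSupport)
  map_smul' c f := toL1_const_mul c
    (integrable_weightedMeasure_of_hasCompactSupport hω f.continuous f.hasCompactSupport)

lemma ccToL1_apply (hω : IsWeight ω) (f : C_c(G, ℂ)) : ccToL1 μ hω f = toL1 μ ω f := rfl

lemma norm_ccToL1 (hω : IsWeight ω) (f : C_c(G, ℂ)) :
    ‖ccToL1 μ hω f‖ = ∫ x, ω x * ‖f x‖ ∂μ :=
  norm_toL1 hω
    (integrable_weightedMeasure_of_hasCompactSupport hω f.continuous f.hasCompactSupport)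

lemma coeFn_ccToL1 (hω : IsWeight ω) (f : C_c(G, ℂ)) : ∀ᵐ x ∂μ, ccToL1 μ hω f x = f x :=
  coeFn_toL1 hω
    (integrable_weightedMeasure_of_hasCompactSupport hω f.continuous f.hasCompactSupport)

/-- A test function that approximates ωf in L¹(μ) becomes, divided by the continuous function ω, an
approximation of f in L¹(G, ω). -/
lemma denseRange_ccToL1 (hω : IsWeight ω) : DenseRange (ccToL1 μ hω) := by
  refine Metric.denseRange_iff.2 fun f ε hε => ?_
  have hf : Integrable f (weightedMeasure μ ω) := L1.integrable_coeFn f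
  have hu := (integrable_weightedMeasure_iff hω _).1 hf
  obtain ⟨g, hg', hgε, hg, hgi⟩ := exists_hasCompactSupport_integral_sub_le hu (half_pos hε)
  have hω0 : ∀ x, (ω x : ℂ) ≠ 0 := fun x => by exact_mod_cast (hω.pos x).ne'
  have hωc := hω.continuous
  let φ : C_c(G, ℂ) := ⟨⟨fun x => (ω x : ℂ)⁻¹ * g x,
    ((by fun_prop : Continuous fun x => (ω x : ℂ)).inv₀ hω0).mul hg⟩, hg'.mul_left⟩
  refine ⟨φ, ?_⟩
  rw [dist_eq_norm, norm_L1_eq hω]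
  refine lt_of_le_of_lt (le_of_eq ?_) (hgε.trans_lt (half_lt_self hε))
  refine integral_congr_ae ?_
  filter_upwards [coeFn_ccToL1 hω φ, (ae_weightedMeasure_iff hω).1 (Lp.coeFn_sub f (ccToL1 μ hω φ))]
    with x hx hx'
  rw [hx', Pi.sub_apply, hx]
  change ω x * ‖f x - (ω x : ℂ)⁻¹ * g x‖ = ‖ω x • f x - g x‖
  rw [← abs_of_pos (hω.pos x), ← Real.norm_eq_abs, ← norm_smul, Real.norm_eq_abs,
    abs_of_pos (hω.pos x), smul_sub, Complex.real_smul, Complex.real_smul,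
    mul_inv_cancel_left₀ (hω0 x)]

variable (μ) in
/-- Convolution of compactly supported functions. -/
noncomputable def ccConv (f g : C_c(G, ℂ)) : C_c(G, ℂ) :=
  have c : Continuous fun w : G × G => f w.2 * g (w.2⁻¹ * w.1) := by fun_prop
  have s : HasCompactSupport fun w : G × G => f w.2 * g (w.2⁻¹ * w.1) :=
    hasCompactSupport_comp_of_leftInverse
      (hasCompactSupport_tensor f.hasCompactSupport g.hasCompactSupport)
      (θ := fun w : G × G => (w.2, w.2⁻¹ * w.1)) (θ' := fun v => (v.1 * v.2, v.1))
      (by fun_prop) fun w => by simp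
  ⟨⟨fun x => ∫ y, f y * g (y⁻¹ * x) ∂μ, continuous_integral_section c s μ⟩,
    hasCompactSupport_integral_section s μ⟩

lemma ccConv_apply (f g : C_c(G, ℂ)) (x : G) : ccConv μ f g x = ∫ y, f y * g (y⁻¹ * x) ∂μ := rfl

end BeurlingSpace

/-! ### Extension by density and absolutely convergent series -/

section Extension

variable {V E F : Type*} [AddCommGroup V] [Module ℂ V] [NormedAddCommGroup E] [NormedSpace ℂ E]
  [NormedAddCommGroup F] [NormedSpace ℂ F]

lemma exists_bilinear_extension [CompleteSpace F] {e : V →ₗ[ℂ] E} (he : DenseRange e)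
    (b : V →ₗ[ℂ] V →ₗ[ℂ] F) {C : ℝ} (hC : 0 ≤ C) (hb : ∀ v w, ‖b v w‖ ≤ C * ‖e v‖ * ‖e w‖) :
    ∃ B : E →L[ℂ] E →L[ℂ] F, ∀ v w, B (e v) (e w) = b v w := by
  let L : V → E →L[ℂ] F := fun v => (b v).extendOfNorm e
  have hL : ∀ v w, L v (e w) = b v w := fun v w =>
    LinearMap.extendOfNorm_eq he ⟨_, hb v⟩ w
  have hext : ∀ S T : E →L[ℂ] F, (∀ w, S (e w) = T (e w)) → S = T := fun S T h =>
    ContinuousLinearMap.coeFn_injective (he.equalizer S.continuous T.continuous (funext h))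
  let L' : V →ₗ[ℂ] E →L[ℂ] F :=
    { toFun := L
      map_add' := fun v v' => hext _ _ fun w => by simp [hL]
      map_smul' := fun c v => hext _ _ fun w => by simp [hL] }
  have hL' : ∀ v, ‖L' v‖ ≤ C * ‖e v‖ := fun v =>
    ContinuousLinearMap.opNorm_le_bound _ (by positivity) fun x =>
      LinearMap.norm_extendOfNorm_apply_le he _ (hb v) x
  refine ⟨L'.extendOfNorm e, fun v w => ?_⟩
  rw [LinearMap.extendOfNorm_eq he ⟨C, hL'⟩]
  exact hL v w

/-- Successive differences of approximations with error 2⁻ⁿ telescope. Series are preferred to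
sequences because absolute convergence in L¹ gives pointwise convergence almost everywhere. -/
lemma exists_hasSum_of_denseRange {e : V →ₗ[ℂ] E} (he : DenseRange e) (x : E) :
    ∃ v : ℕ → V, Summable (fun n => ‖e (v n)‖) ∧ HasSum (fun n => e (v n)) x := by
  have hg : Summable fun n : ℕ => 2 * (1 / 2 : ℝ) ^ n :=
    (summable_geometric_of_lt_one (by norm_num) (by norm_num)).mul_left 2
  choose w hw using fun n : ℕ =>
    Metric.denseRange_iff.1 he x ((1 / 2 : ℝ) ^ n) (by positivity)
  let v : ℕ → V := fun n => Nat.rec (w 0) (fun n _ => w (n + 1) - w n) n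
  have hv : ∀ n, ∑ i ∈ Finset.range (n + 1), e (v i) = e (w n) := fun n => by
    induction n with
    | zero => simp [v]
    | succ n ih => rw [Finset.sum_range_succ, ih, ← map_add]; simp [v]
  have hs : Summable fun n => ‖e (v n)‖ := by
    refine (summable_nat_add_iff (f := fun n => ‖e (v n)‖) 1).1 ?_
    refine Summable.of_nonneg_of_le (fun n => norm_nonneg (e (v (n + 1)))) (fun n => ?_) hg
    have h1 := hw n
    have h2 : dist x (e (w (n + 1))) < (1 / 2) ^ n :=
      (hw (n + 1)).trans_le (pow_le_pow_of_le_one (by norm_num) (by norm_num) n.le_succ)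
    change ‖e (w (n + 1) - w n)‖ ≤ _
    rw [map_sub, ← dist_eq_norm]
    linarith [dist_triangle_left (e (w (n + 1))) (e (w n)) x]
  have ht : Tendsto (fun n => ∑ i ∈ Finset.range n, e (v i)) atTop (𝓝 x) := by
    refine (tendsto_add_atTop_iff_nat (f := fun n => ∑ i ∈ Finset.range n, e (v i)) 1).1 ?_
    simp only [hv]
    refine tendsto_iff_dist_tendsto_zero.2 (squeeze_zero (fun _ => dist_nonneg)
      (fun n => (dist_comm _ _).trans_le (hw n).le) ?_)
    exact tendsto_pow_atTop_nhds_zero_of_lt_one (by norm_num) (by norm_num)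
  exact ⟨v, hs, (hasSum_iff_tendsto_nat_of_summable_norm hs).2 ht⟩

lemma hasSum_bilinear (B : E →L[ℂ] E →L[ℂ] F) [CompleteSpace F] {u v : ℕ → E} {x y : E}
    (hu : Summable fun n => ‖u n‖) (hv : Summable fun n => ‖v n‖) (hx : HasSum u x)
    (hy : HasSum v y) : (Summable fun n : ℕ × ℕ => ‖B (u n.1) (v n.2)‖) ∧
      HasSum (fun n : ℕ × ℕ => B (u n.1) (v n.2)) (B x y) := by
  have hs : Summable fun n : ℕ × ℕ => ‖B (u n.1) (v n.2)‖ := by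
    refine Summable.of_nonneg_of_le (fun _ => norm_nonneg _)
      (fun n => (B.le_opNorm₂ (u n.1) (v n.2)).trans_eq (mul_assoc _ _ _)) ?_
    exact (hu.mul_of_nonneg hv (fun _ => norm_nonneg _) fun _ => norm_nonneg _).mul_left _
  refine ⟨hs, ?_⟩
  have h := hs.of_norm.hasSum
  have h1 := h.prod_fiberwise fun n => (B (u n)).hasSum hy
  have h2 : HasSum (fun n => B (u n) y) (B x y) := (B.flip y).hasSum hx
  rwa [h1.unique h2] at h

end Extension

/-! ### Convolution as a continuous bilinear map -/

section Convolution

variable {G : Type*} [Group G] [TopologicalSpace G] [IsTopologicalGroup G]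
  [LocallyCompactSpace G] [T2Space G] [MeasurableSpace G] [BorelSpace G]
  {μ : Measure G} [μ.IsHaarMeasure] [μ.Regular] {ω : G → ℝ}

/-- After Fubini and the translation x ↦ yx, submultiplicativity ω(yx) ≤ ω(y) ω(x) splits the double
integral. -/
lemma integral_integral_norm_conv_le (hω : IsWeight ω) (f g : C_c(G, ℂ)) :
    ∫ x, ω x * ∫ y, ‖f y‖ * ‖g (y⁻¹ * x)‖ ∂μ ∂μ ≤ ‖ccToL1 μ hω f‖ * ‖ccToL1 μ hω g‖ := by
  have hωc := hω.continuous
  have cH : Continuous fun w : G × G => ω w.1 * (‖f w.2‖ * ‖g (w.2⁻¹ * w.1)‖) := by fun_prop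
  have sH : HasCompactSupport fun w : G × G => ω w.1 * (‖f w.2‖ * ‖g (w.2⁻¹ * w.1)‖) :=
    (hasCompactSupport_comp_of_leftInverse
      (hasCompactSupport_tensor f.hasCompactSupport.norm g.hasCompactSupport.norm)
      (θ := fun w : G × G => (w.2, w.2⁻¹ * w.1)) (θ' := fun v => (v.1 * v.2, v.1))
      (by fun_prop) fun w => by simp).mul_left
  have cg : Continuous fun x => ω x * ‖g x‖ := by fun_prop
  have sg : HasCompactSupport fun x => ω x * ‖g x‖ := g.hasCompactSupport.norm.mul_left
  have cf : Continuous fun x => ω x * ‖f x‖ := by fun_prop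
  have sf : HasCompactSupport fun x => ω x * ‖f x‖ := f.hasCompactSupport.norm.mul_left
  have sw := integral_section_swap cH sH (νX := μ) (νY := μ)
  simp only [integral_const_mul] at sw
  rw [sw, norm_ccToL1 hω, norm_ccToL1 hω, ← integral_mul_const]
  refine integral_mono_of_nonneg (ae_of_all _ fun y => integral_nonneg fun x => ?_)
    ((cf.integrable_of_hasCompactSupport sf).mul_const _) (ae_of_all _ fun y => ?_)
  · have := hω.pos x
    positivity
  · simp only
    rw [← integral_mul_left_eq_self (fun x => ω x * (‖f y‖ * ‖g (y⁻¹ * x)‖)) y,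
      ← integral_const_mul]
    refine integral_mono_of_nonneg (ae_of_all _ fun x => ?_)
      ((cg.integrable_of_hasCompactSupport sg).const_mul _) (ae_of_all _ fun x => ?_)
    · have := hω.pos (y * x)
      simp only [Pi.zero_apply]
      positivity
    · simp only [inv_mul_cancel_left]
      calc ω (y * x) * (‖f y‖ * ‖g x‖) ≤ (ω y * ω x) * (‖f y‖ * ‖g x‖) := by
            gcongr
            exact hω.mul_le y x
        _ = _ := by ring

lemma norm_ccToL1_ccConv_le (hω : IsWeight ω) (f g : C_c(G, ℂ)) :
    ‖ccToL1 μ hω (ccConv μ f g)‖ ≤ ‖ccToL1 μ hω f‖ * ‖ccToL1 μ hω g‖ := by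
  refine le_trans ?_ (integral_integral_norm_conv_le hω f g)
  have hωc := hω.continuous
  have cH : Continuous fun w : G × G => ‖f w.2‖ * ‖g (w.2⁻¹ * w.1)‖ := by fun_prop
  have sH : HasCompactSupport fun w : G × G => ‖f w.2‖ * ‖g (w.2⁻¹ * w.1)‖ :=
    hasCompactSupport_comp_of_leftInverse
      (hasCompactSupport_tensor f.hasCompactSupport.norm g.hasCompactSupport.norm)
      (θ := fun w : G × G => (w.2, w.2⁻¹ * w.1)) (θ' := fun v => (v.1 * v.2, v.1))
      (by fun_prop) fun w => by simp
  have c1 := continuous_integral_section cH sH μ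
  have s1 := hasCompactSupport_integral_section sH μ
  rw [norm_ccToL1 hω]
  refine integral_mono_of_nonneg (ae_of_all _ fun x => ?_)
    ((hωc.mul c1).integrable_of_hasCompactSupport s1.mul_left) (ae_of_all _ fun x => ?_)
  · have := hω.pos x
    simp only [Pi.zero_apply]
    positivity
  · refine mul_le_mul_of_nonneg_left ?_ (hω.pos x).le
    rw [ccConv_apply]
    refine (norm_integral_le_integral_norm _).trans_eq ?_
    simp only [norm_mul]

variable (μ) in
/-- Convolution as a bilinear map from `C_c(G)` to `L¹(G, ω)`. -/
noncomputable def ccConvL1 (hω : IsWeight ω) : C_c(G, ℂ) →ₗ[ℂ] C_c(G, ℂ) →ₗ[ℂ] L1 μ ω :=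
  have hi : ∀ (f g : C_c(G, ℂ)) (x : G), Integrable (fun y => f y * g (y⁻¹ * x)) μ :=
    fun f g x => (by fun_prop : Continuous fun y => f y * g (y⁻¹ * x)).integrable_of_hasCompactSupport
      f.hasCompactSupport.mul_right
  LinearMap.mk₂ ℂ (fun f g => ccToL1 μ hω (ccConv μ f g))
    (fun f f' g => by
      rw [← map_add]
      congr 1
      ext x
      rw [CompactlySupportedContinuousMap.add_apply, ccConv_apply, ccConv_apply, ccConv_apply,
        ← integral_add (hi f g x) (hi f' g x)]
      simp only [CompactlySupportedContinuousMap.add_apply, add_mul])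
    (fun c f g => by
      rw [← map_smul]
      congr 1
      ext x
      rw [CompactlySupportedContinuousMap.smul_apply, ccConv_apply, ccConv_apply, ← integral_smul]
      simp only [CompactlySupportedContinuousMap.smul_apply, smul_mul_assoc])
    (fun f g g' => by
      rw [← map_add]
      congr 1
      ext x
      rw [CompactlySupportedContinuousMap.add_apply, ccConv_apply, ccConv_apply, ccConv_apply,
        ← integral_add (hi f g x) (hi f g' x)]
      simp only [CompactlySupportedContinuousMap.add_apply, mul_add])
    (fun c f g => by
      rw [← map_smul]
      congr 1
      ext x
      rw [CompactlySupportedContinuousMap.smul_apply, ccConv_apply, ccConv_apply, ← integral_smul]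
      simp only [CompactlySupportedContinuousMap.smul_apply, mul_smul_comm])

lemma ae_hasSum_of_hasSum_ccToL1 (hω : IsWeight ω) {ι : Type*} [Countable ι] {u : ι → C_c(G, ℂ)}
    {f : L1 μ ω} (hu : Summable fun n => ‖ccToL1 μ hω (u n)‖)
    (hf : HasSum (fun n => ccToL1 μ hω (u n)) f) : ∀ᵐ x ∂μ, HasSum (fun n => u n x) (f x) := by
  have h := Lp.hasSum_coeFn_tsum (f := fun n => ccToL1 μ hω (u n))
    (tsum_enorm_ne_top_iff_summable_norm.2 hu)
  rw [hf.tsum_eq] at h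
  filter_upwards [(ae_weightedMeasure_iff hω).1 h, ae_all_iff.2 fun n => coeFn_ccToL1 hω (u n)]
    with x hx hx'
  simpa only [hx'] using hx

/-- The modulus of a compactly supported function. -/
noncomputable def ccAbs (f : C_c(G, ℂ)) : C_c(G, ℂ) :=
  ⟨⟨fun x => (‖f x‖ : ℂ), by fun_prop⟩,
    f.hasCompactSupport.norm.comp_left (g := ((↑) : ℝ → ℂ)) Complex.ofReal_zero⟩

lemma norm_ccToL1_ccAbs (hω : IsWeight ω) (f : C_c(G, ℂ)) :
    ‖ccToL1 μ hω (ccAbs f)‖ = ‖ccToL1 μ hω f‖ := by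
  rw [norm_ccToL1, norm_ccToL1]
  congr 1
  ext x
  change ω x * ‖(‖f x‖ : ℂ)‖ = _
  simp

/-- Inversion is only known to preserve locally null sets, which is why y is confined to a compact
set. -/
lemma ae_comp_inv_mul {P : G → Prop} (hP : ∀ᵐ x ∂μ, P x) {K : Set G} (hK : IsCompact K) (x : G) :
    ∀ᵐ y ∂μ, y ∈ K → P (y⁻¹ * x) := by
  have h1 : ∀ᶠ z in lae μ, P z⁻¹ :=
    (tendsto_inv_lae μ).eventually (eventually_lae.2 fun K _ => ae_restrict_of_ae hP)
  have hK' : IsCompact ((fun y => x⁻¹ * y) '' K) := hK.image (by fun_prop)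
  have h2 := (ae_restrict_iff' hK'.isClosed.measurableSet).1 (eventually_lae.1 h1 _ hK')
  filter_upwards [(measurePreserving_mul_left μ x⁻¹).quasiMeasurePreserving.ae h2] with y hy hyK
  simpa using hy ⟨y, hyK, rfl⟩

/-- The convolution of `L¹(G, ω)` is the continuous extension of the convolution of `C_c(G)`. -/
lemma exists_conv_eq (hω : IsWeight ω) : ∃ B : L1 μ ω →L[ℂ] L1 μ ω →L[ℂ] L1 μ ω,
    (∀ f g, conv μ ω f g = B f g) ∧
    ∀ f g, B (ccToL1 μ hω f) (ccToL1 μ hω g) = ccToL1 μ hω (ccConv μ f g) := by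
  obtain ⟨B, hB⟩ := exists_bilinear_extension (denseRange_ccToL1 hω) (ccConvL1 μ hω) zero_le_one
    fun f g => by
      rw [one_mul]
      exact norm_ccToL1_ccConv_le hω f g
  replace hB : ∀ f g, B (ccToL1 μ hω f) (ccToL1 μ hω g) = ccToL1 μ hω (ccConv μ f g) := hB
  refine ⟨B, fun f g => ?_, hB⟩
  -- Joint measurability of f(y) g(y⁻¹x) is avoided: f and g are expanded into absolutely convergent
  -- series of test functions, and the convolution is computed term by term.
  obtain ⟨u, us, uf⟩ := exists_hasSum_of_denseRange (denseRange_ccToL1 hω) f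
  obtain ⟨v, vs, vg⟩ := exists_hasSum_of_denseRange (denseRange_ccToL1 hω) g
  have hu := ae_hasSum_of_hasSum_ccToL1 hω us uf
  have hv := ae_hasSum_of_hasSum_ccToL1 hω vs vg
  obtain ⟨s1, s2⟩ := hasSum_bilinear B us vs uf vg
  simp only [hB] at s1 s2
  have huv := ae_hasSum_of_hasSum_ccToL1 hω (u := fun n : ℕ × ℕ => ccConv μ (u n.1) (v n.2)) s1 s2
  have habs : Summable fun n : ℕ × ℕ => ‖ccToL1 μ hω (ccConv μ (ccAbs (u n.1)) (ccAbs (v n.2)))‖ := by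
    have h := us.mul_of_nonneg vs (fun _ => norm_nonneg _) fun _ => norm_nonneg _
    refine Summable.of_nonneg_of_le (fun _ => norm_nonneg _) (fun n => ?_) h
    rw [← norm_ccToL1_ccAbs hω (u n.1), ← norm_ccToL1_ccAbs hω (v n.2)]
    exact norm_ccToL1_ccConv_le hω _ _
  have habs' := ae_hasSum_of_hasSum_ccToL1 hω
    (u := fun n : ℕ × ℕ => ccConv μ (ccAbs (u n.1)) (ccAbs (v n.2))) habs habs.of_norm.hasSum
  have hprod : ∀ x, ∀ᵐ y ∂μ, HasSum (fun n : ℕ × ℕ => u n.1 y * v n.2 (y⁻¹ * x))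
      (f y * g (y⁻¹ * x)) := fun x => by
    filter_upwards [hu, ae_all_iff.2 fun n : ℕ => ae_comp_inv_mul hv (u n).hasCompactSupport x]
      with y hy hy'
    -- The series for g is known to converge at y⁻¹x only when y lies in one of the countably many
    -- supports. Off all of them every term vanishes, and so does f(y).
    by_cases h : ∃ n, y ∈ tsupport (u n)
    · obtain ⟨n, hn⟩ := h
      have h1 := hy' n hn
      exact HasSum.mul (f := fun n => u n y) (g := fun n => v n (y⁻¹ * x)) hy h1
        (summable_mul_of_summable_norm (f := fun n => u n y) (g := fun n => v n (y⁻¹ * x))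
          hy.summable.norm h1.summable.norm)
    · have h0 : ∀ n, u n y = 0 := fun n => image_eq_zero_of_notMem_tsupport fun hn => h ⟨n, hn⟩
      simp only [h0] at hy ⊢
      rw [hy.unique hasSum_zero]
      simp
  rw [conv_eq_toL1]
  refine toL1_eq_of_ae hω ?_
  filter_upwards [huv, habs'] with x hx hx'
  have hi : ∀ n : ℕ × ℕ, Integrable (fun y => u n.1 y * v n.2 (y⁻¹ * x)) μ := fun n =>
    (by fun_prop : Continuous fun y => u n.1 y * v n.2 (y⁻¹ * x)).integrable_of_hasCompactSupport
      (u n.1).hasCompactSupport.mul_right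
  -- The integrals of the moduli are convolutions of moduli of test functions, whose series
  -- converges at x; this allows sum and integral to be exchanged.
  have hsum : Summable fun n : ℕ × ℕ => ∫ y, ‖u n.1 y * v n.2 (y⁻¹ * x)‖ ∂μ := by
    refine Complex.summable_ofReal.1 (hx'.summable.congr fun n => ?_)
    rw [ccConv_apply, ← integral_complex_ofReal]
    simp only [norm_mul, Complex.ofReal_mul]
    rfl
  have h := hasSum_integral_of_summable_integral_norm hi hsum
  have e := h.unique hx
  rw [← e]
  refine integral_congr_ae ?_
  filter_upwards [hprod x] with y hy
  exact hy.tsum_eq.symm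

end Convolution

/-! ### From bilinear forms to functionals on G × G -/

section BilinearIntegral

variable {α E : Type*} [MeasurableSpace α] {m : Measure α} [NormedAddCommGroup E] [NormedSpace ℂ E]

open Classical in
/-- The vector measure `A ↦ B (·, 1_A)` of a bounded bilinear form `B` on `E × L¹(m)`. -/
noncomputable def bilinearMeasure (B : E →L[ℂ] Lp ℂ 1 m →L[ℂ] ℂ) (A : Set α) : E →L[ℝ] ℂ :=
  if h : MeasurableSet A ∧ m A ≠ ⊤ then
    (B.flip (indicatorConstLp 1 h.1 h.2 1)).restrictScalars ℝ else 0

lemma bilinearMeasure_apply (B : E →L[ℂ] Lp ℂ 1 m →L[ℂ] ℂ) {A : Set α} (hA : MeasurableSet A)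
    (hA' : m A ≠ ⊤) (u : E) : bilinearMeasure B A u = B u (indicatorConstLp 1 hA hA' 1) := by
  rw [bilinearMeasure, dif_pos ⟨hA, hA'⟩]
  rfl

lemma dominatedFinMeasAdditive_bilinearMeasure (B : E →L[ℂ] Lp ℂ 1 m →L[ℂ] ℂ) :
    DominatedFinMeasAdditive m (bilinearMeasure B) ‖B‖ := by
  refine ⟨fun s t hs ht hms hmt hst => ?_, fun s hs hms => ?_⟩
  · ext u
    have hmst : m (s ∪ t) ≠ ⊤ := measure_union_ne_top hms hmt
    rw [add_apply, bilinearMeasure_apply B (hs.union ht) hmst,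
      bilinearMeasure_apply B hs hms, bilinearMeasure_apply B ht hmt, ← map_add,
      indicatorConstLp_disjoint_union hs ht hms hmt hst]
  · refine ContinuousLinearMap.opNorm_le_bound _ (by positivity) fun u => ?_
    rw [bilinearMeasure_apply B hs hms.ne]
    refine (B.le_opNorm₂ _ _).trans_eq ?_
    rw [norm_indicatorConstLp one_ne_zero ENNReal.one_ne_top]
    simp
    ring

/-- The completed projective tensor product of E and L¹(m) is the Bochner space L¹(m; E); S is the
functional on it that corresponds to B, obtained by integrating E-valued functions against the
additive set function A ↦ B(·, 1_A). -/
lemma exists_bilinearIntegral (B : E →L[ℂ] Lp ℂ 1 m →L[ℂ] ℂ) :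
    ∃ S : (α → E) → ℂ,
      (∀ f g, Integrable f m → Integrable g m → S (fun y => f y + g y) = S f + S g) ∧
      (∀ (c : ℂ) f, S (fun y => c • f y) = c * S f) ∧
      (∀ f, Integrable f m → ‖S f‖ ≤ ‖B‖ * ∫ y, ‖f y‖ ∂m) ∧
      (∀ f g, f =ᵐ[m] g → S f = S g) ∧
      ∀ u (c : Lp ℂ 1 m), S (fun y => c y • u) = B u c := by
  have hT := dominatedFinMeasAdditive_bilinearMeasure B
  refine ⟨setToFun m (bilinearMeasure B) hT, fun f g hf hg => setToFun_add hT hf hg,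
    fun c f => setToFun_smul hT (fun c s x => ?_) c f, fun f hf => ?_,
    fun f g h => setToFun_congr_ae hT h, fun u c => ?_⟩
  · by_cases h : MeasurableSet s ∧ m s ≠ ⊤
    · rw [bilinearMeasure_apply B h.1 h.2, bilinearMeasure_apply B h.1 h.2, map_smul]
      rfl
    · rw [bilinearMeasure, dif_neg h]
      simp
  · rw [← L1.norm_of_fun_eq_integral_norm hf]
    exact norm_setToFun_le hT hf (by positivity)
  -- Composition with z ↦ zu makes both sides continuous in c, so indicator functions suffice.
  · let L : ℂ →L[ℂ] E := (1 : ℂ →L[ℂ] ℂ).smulRight u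
    have hL : ∀ c : Lp ℂ 1 m, setToFun m (bilinearMeasure B) hT (L.compLpL 1 m c)
        = setToFun m (bilinearMeasure B) hT fun y => c y • u := fun c => by
      refine setToFun_congr_ae hT ?_
      filter_upwards [L.coeFn_compLpL c] with y hy
      rw [hy]
      simp [L]
    rw [← hL]
    refine Lp.induction (p := 1) ENNReal.one_ne_top
      (motive := fun c => setToFun m (bilinearMeasure B) hT (L.compLpL 1 m c) = B u c)
      (fun c s hs hms => ?_) (fun f g hf hg _ h1 h2 => ?_) ?_ c
    · rw [hL, Lp.simpleFunc.coe_indicatorConst]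
      have e : (fun y => indicatorConstLp 1 hs hms.ne c y • u)
          =ᵐ[m] s.indicator fun _ => c • u := by
        filter_upwards [indicatorConstLp_coeFn (p := 1) (hs := hs) (hμs := hms.ne) (c := c)] with y hy
        rw [hy]
        by_cases hys : y ∈ s <;> simp [hys]
      rw [setToFun_congr_ae hT e, setToFun_indicator_const hT hs hms.ne,
        bilinearMeasure_apply B hs hms.ne, map_smul, smul_apply, ← map_smul]
      congr 1
      refine Lp.ext ?_
      filter_upwards [Lp.coeFn_smul c (indicatorConstLp 1 hs hms.ne (1 : ℂ)),
        indicatorConstLp_coeFn (p := 1) (hs := hs) (hμs := hms.ne) (c := (1 : ℂ)),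
        indicatorConstLp_coeFn (p := 1) (hs := hs) (hμs := hms.ne) (c := c)] with y h1 h2 h3
      rw [h1, h3, Pi.smul_apply, h2]
      by_cases hys : y ∈ s <;> simp [hys]
    · have e : setToFun m (bilinearMeasure B) hT (L.compLpL 1 m (hf.toLp f + hg.toLp g))
          = setToFun m (bilinearMeasure B) hT (L.compLpL 1 m (hf.toLp f))
            + setToFun m (bilinearMeasure B) hT (L.compLpL 1 m (hg.toLp g)) := by
        rw [map_add, setToFun_congr_ae hT (Lp.coeFn_add _ _),
          setToFun_add hT (L1.integrable_coeFn _) (L1.integrable_coeFn _)]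
      rw [e, h1, h2, map_add]
    · exact isClosed_eq ((continuous_setToFun hT).comp (L.compLpL 1 m).continuous)
        (B u).continuous

end BilinearIntegral

section Sections

variable {G : Type*} [Group G] [TopologicalSpace G] [IsTopologicalGroup G]
  [LocallyCompactSpace G] [T2Space G] [MeasurableSpace G] [BorelSpace G]
  {μ : Measure G} [μ.IsHaarMeasure] [μ.Regular] {ω : G → ℝ}

lemma hasCompactSupport_section_left {X Y E : Type*} [TopologicalSpace X] [TopologicalSpace Y]
    [T2Space X] [Zero E] {F : X × Y → E} (hF' : HasCompactSupport F) (y : Y) :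
    HasCompactSupport fun x => F (x, y) := by
  refine HasCompactSupport.intro (hF'.isCompact.image continuous_fst) fun x hx => ?_
  by_contra h
  exact hx ⟨(x, y), subset_tsupport _ h, rfl⟩

lemma continuous_toL1_section (hω : IsWeight ω) {F : G × G → ℂ} (hF : Continuous F)
    (hF' : HasCompactSupport F) : Continuous fun y => toL1 μ ω fun x => F (x, y) := by
  have hi : ∀ y, Integrable (fun x => F (x, y)) (weightedMeasure μ ω) := fun y =>
    integrable_weightedMeasure_of_hasCompactSupport hω (by fun_prop)
      (hasCompactSupport_section_left hF' y)
  refine continuous_iff_continuousAt.2 fun y₀ => ?_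
  rw [ContinuousAt, tendsto_iff_norm_sub_tendsto_zero]
  have e : ∀ y, ‖toL1 μ ω (fun x => F (x, y)) - toL1 μ ω fun x => F (x, y₀)‖
      = ∫ x, ω x * ‖F (x, y) - F (x, y₀)‖ ∂μ := fun y => by
    rw [← toL1_sub (hi y) (hi y₀), norm_toL1 (f := fun x => F (x, y) - F (x, y₀)) hω ((hi y).sub (hi y₀))]
  simp only [e]
  have hωc := hω.continuous
  have hc : Continuous fun y => ∫ x, ω x * ‖F (x, y) - F (x, y₀)‖ ∂μ := by
    rw [← continuousOn_univ]
    refine continuousOn_integral_of_compact_support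
      (f := fun y x => ω x * ‖F (x, y) - F (x, y₀)‖) (hF'.isCompact.image continuous_fst)
      (by fun_prop) fun y x _ hx => ?_
    have h0 : ∀ y, F (x, y) = 0 := fun y => by
      by_contra h
      exact hx ⟨(x, y), subset_tsupport _ h, rfl⟩
    simp [h0]
  simpa using hc.tendsto y₀

lemma hasCompactSupport_toL1_section {F : G × G → ℂ} (hF' : HasCompactSupport F) :
    HasCompactSupport fun y => toL1 μ ω fun x => F (x, y) := by
  refine HasCompactSupport.intro (hF'.isCompact.image continuous_snd) fun y hy => ?_
  have h0 : ∀ x, F (x, y) = 0 := fun x => by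
    by_contra h
    exact hy ⟨(x, y), subset_tsupport _ h, rfl⟩
  simp only [h0]
  have := toL1_const_mul (μ := μ) (ω := ω) 0 (integrable_zero G ℂ (weightedMeasure μ ω))
  simpa using this

variable [MeasurableSpace (G × G)] [BorelSpace (G × G)] {ν : Measure (G × G)}

/-- A bounded bilinear form on `L¹(G, ω)` is a functional on the weighted `L¹` space of `G × G`. -/
lemma IsProdHaar.exists_functional (hν : IsProdHaar μ μ ν) (hω : IsWeight ω)
    (B : L1 μ ω →L[ℂ] L1 μ ω →L[ℂ] ℂ) :
    ∃ T : (G × G → ℂ) → ℂ, IsBddFunctional ν (fun v => ω v.1 * ω v.2) ‖B‖ T ∧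
      ∀ a c : C_c(G, ℂ), T (fun v => a v.1 * c v.2) = B (ccToL1 μ hω a) (ccToL1 μ hω c) := by
  obtain ⟨S, S1, S2, S3, S4, S5⟩ := exists_bilinearIntegral B
  have hi : ∀ {F : G × G → ℂ}, Continuous F → HasCompactSupport F → ∀ y,
      Integrable (fun x => F (x, y)) (weightedMeasure μ ω) := fun hF hF' y =>
    integrable_weightedMeasure_of_hasCompactSupport hω (by fun_prop)
      (hasCompactSupport_section_left hF' y)
  have hI : ∀ {F : G × G → ℂ}, Continuous F → HasCompactSupport F →
      Integrable (fun y => toL1 μ ω fun x => F (x, y)) (weightedMeasure μ ω) := fun hF hF' =>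
    integrable_weightedMeasure_of_hasCompactSupport hω (continuous_toL1_section hω hF hF')
      (hasCompactSupport_toL1_section hF')
  have hωc := hω.continuous
  -- F is read as the function y ↦ F(·, y) with values in L¹(G, ω), whose Bochner norm is the
  -- weighted L¹ norm of F.
  refine ⟨fun F => S fun y => toL1 μ ω fun x => F (x, y), ⟨fun f g hf hf' hg hg' => ?_,
    fun c f hf hf' => ?_, fun f hf hf' => ?_⟩, fun a c => ?_⟩
  · rw [← S1 _ _ (hI hf hf') (hI hg hg')]
    congr 1
    ext1 y
    exact toL1_add (hi hf hf' y) (hi hg hg' y)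
  · rw [← S2]
    congr 1
    ext1 y
    exact toL1_const_mul c (hi hf hf' y)
  · refine (S3 _ (hI hf hf')).trans_eq ?_
    rw [integral_weightedMeasure hω]
    have cH : Continuous fun w : G × G => ‖f w‖ * (ω w.1 * ω w.2) := by fun_prop
    have sH : HasCompactSupport fun w : G × G => ‖f w‖ * (ω w.1 * ω w.2) := hf'.norm.mul_right
    rw [hν.integral cH sH, integral_section_swap cH sH]
    congr 1
    refine integral_congr_ae (ae_of_all _ fun y => ?_)
    simp only
    rw [norm_toL1 hω (hi hf hf' y), smul_eq_mul, ← integral_const_mul]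
    congr 1
    ext x
    ring
  · rw [← S5]
    refine S4 _ _ ?_
    refine (ae_weightedMeasure_iff hω).2 ?_
    filter_upwards [coeFn_ccToL1 hω c] with y hy
    have h := toL1_const_mul (c y) (integrable_weightedMeasure_of_hasCompactSupport (μ := μ) (f := a) hω
      a.continuous a.hasCompactSupport)
    rw [hy, ccToL1_apply]
    simpa only [mul_comm] using h

end Sections

/-! ### Quasi-additive functions and their classes -/

section Characterizations

variable {G : Type*} [Group G] [TopologicalSpace G] [IsTopologicalGroup G]
  [LocallyCompactSpace G] [T2Space G]

lemma memLinf_iff [MeasurableSpace G] [BorelSpace G] {μ : Measure G} [μ.IsHaarMeasure] [μ.Regular]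
    {ω : G → ℝ} {h : G → ℂ} :
    MemLinf ω h ↔ Measurable h ∧ ∃ C : ℝ, ∀ᶠ x in lae μ, ‖h x‖ / ω x ≤ C := by
  rw [MemLinf, locallyAE_eq_lae μ, ← BorelSpace.measurable_eq]

lemma isQuasiAdditive_iff [MeasurableSpace (G × G)] [BorelSpace (G × G)]
    [MeasurableSpace (G × G × G)] [BorelSpace (G × G × G)] {ν₃ : Measure (G × G × G)}
    [ν₃.IsHaarMeasure] [ν₃.Regular] {p : G × G → ℂ} :
    IsQuasiAdditive p ↔ Measurable p ∧ ∀ᶠ t : G × G × G in lae ν₃,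
      p (t.1 * t.2.1, t.2.2) = p (t.1, t.2.1 * t.2.2) + p (t.2.1, t.2.2 * t.1) := by
  rw [IsQuasiAdditive, locallyAE_eq_lae ν₃, ← BorelSpace.measurable_eq]

lemma toClass_eq_iff [MeasurableSpace (G × G)] [BorelSpace (G × G)] {ν : Measure (G × G)}
    [ν.IsHaarMeasure] [ν.Regular] {p q : G × G → ℂ} :
    toClass p = toClass q ↔ ∀ᶠ t in lae ν, p t = q t := by
  rw [toClass, toClass, Germ.coe_eq, locallyAE_eq_lae ν]
  rfl

end Characterizations

section Classes

variable {G : Type*} [Group G] [TopologicalSpace G] [IsTopologicalGroup G]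
  [LocallyCompactSpace G] [T2Space G] [MeasurableSpace G] [BorelSpace G]
  {μ : Measure G} [μ.IsHaarMeasure] [μ.Regular] {ω : G → ℝ}

/-- Setting h to 0 where |h|/ω exceeds the essential bound changes it only on a locally null set and
turns the bound into one at every point, as needed to estimate h(xy) - h(yx) everywhere. -/
lemma MemLinf.exists_bounded (hω : IsWeight ω) {h : G → ℂ} (hh : MemLinf ω h) :
    ∃ h' : G → ℂ, Measurable h' ∧ (∃ C, 0 ≤ C ∧ ∀ x, ‖h' x‖ ≤ C * ω x) ∧
      ∀ᶠ x in lae μ, h x = h' x := by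
  obtain ⟨hm, C, hC⟩ := (memLinf_iff (μ := μ)).1 hh
  have hωm := hω.continuous.measurable
  have hs : MeasurableSet {x | ‖h x‖ / ω x ≤ C} :=
    measurableSet_le (hm.norm.div hωm) measurable_const
  set s := {x | ‖h x‖ / ω x ≤ C}
  refine ⟨s.indicator h, hm.indicator hs, ⟨max C 0, le_max_right _ _,
    fun x => ?_⟩, ?_⟩
  · by_cases hx : x ∈ s
    · rw [indicator_of_mem hx]
      refine ((div_le_iff₀ (hω.pos x)).1 hx).trans ?_
      exact mul_le_mul_of_nonneg_right (le_max_left _ _) (hω.pos x).le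
    · rw [indicator_of_notMem hx, norm_zero]
      exact mul_nonneg (le_max_right _ _) (hω.pos x).le
  · filter_upwards [hC] with x hx
    exact (indicator_of_mem (s := s) hx h).symm

lemma isQuasiAdditive_coboundary {h : G → ℂ} (hm : Measurable h) :
    IsQuasiAdditive fun v : G × G => h (v.1 * v.2) - h (v.2 * v.1) := by
  let _ : MeasurableSpace (G × G) := borel _
  have : BorelSpace (G × G) := ⟨rfl⟩
  refine ⟨?_, Eventually.of_forall fun t => ?_⟩
  · exact (hm.comp (by fun_prop : Continuous fun v : G × G => v.1 * v.2).measurable).sub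
      (hm.comp (by fun_prop : Continuous fun v : G × G => v.2 * v.1).measurable)
  · simp only [mul_assoc]
    ring

/-- The definition of D asks for a true supremum, so the representative is replaced by the
coboundary of a pointwise bounded h. Submultiplicativity bounds both ω(xy) and ω(yx) by ω(x) ω(y).
-/
lemma I_subset_D (μ : Measure G) [μ.IsHaarMeasure] [μ.Regular] (hω : IsWeight ω) : I ω ⊆ D ω := by
  let _ : MeasurableSpace (G × G) := borel _
  have : BorelSpace (G × G) := ⟨rfl⟩
  obtain ⟨ν, hν⟩ := exists_isProdHaar μ μ
  have := hν.haar
  have := hν.regular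
  rintro _ ⟨p, ⟨-, h, hh, hp⟩, rfl⟩
  obtain ⟨h', hm', ⟨C, hC0, hC⟩, hhh⟩ := hh.exists_bounded (μ := μ) hω
  rw [locallyAE_eq_lae ν] at hp
  refine ⟨fun v => h' (v.1 * v.2) - h' (v.2 * v.1), ⟨isQuasiAdditive_coboundary hm',
    C + C, fun x y => ?_⟩, ?_⟩
  · have := hω.pos x
    have := hω.pos y
    rw [div_le_iff₀ (by positivity), add_mul]
    refine (norm_sub_le _ _).trans (add_le_add ?_ ?_)
    · exact (hC _).trans (mul_le_mul_of_nonneg_left (hω.mul_le _ _) hC0)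
    · rw [mul_comm (ω x)]
      exact (hC _).trans (mul_le_mul_of_nonneg_left (hω.mul_le _ _) hC0)
  · rw [toClass_eq_iff (ν := ν)]
    filter_upwards [hp, hν.tendsto_mul.eventually hhh, hν.tendsto_mul_swap.eventually hhh]
      with v h1 h2 h3
    rw [h1, h2, h3]

lemma locBdd_of_le {h : G → ℂ} (hω : IsWeight ω) (hm : Measurable h) {C : ℝ}
    (hC : ∀ x, ‖h x‖ ≤ C * ω x) : LocBdd h :=
  ⟨hm, fun x => C * ω x, hω.continuous.const_mul C, hC⟩

variable [MeasurableSpace (G × G)] [BorelSpace (G × G)] {ν : Measure (G × G)}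

lemma locBdd_of_le_prod {p : G × G → ℂ} (hω : IsWeight ω) (hm : Measurable p) {C : ℝ}
    (hC : ∀ v, ‖p v‖ ≤ C * (ω v.1 * ω v.2)) : LocBdd p :=
  have := hω.continuous
  ⟨hm, fun v => C * (ω v.1 * ω v.2), by fun_prop, hC⟩

/-- Integration along the fibres of xy and of yx produces a * c and c * a: coboundaries are inner
derivations. -/
lemma IsProdHaar.integral_coboundary_mul (hν : IsProdHaar μ μ ν) {h : G → ℂ} (hh : LocBdd h)
    (a c : C_c(G, ℂ)) :
    ∫ v, (h (v.1 * v.2) - h (v.2 * v.1)) * (a v.1 * c v.2) ∂ν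
      = ∫ t, h t * ccConv μ a c t ∂μ - ∫ t, h t * ccConv μ c a t ∂μ := by
  have := hν.haar
  have cF : Continuous fun v : G × G => a v.1 * c v.2 := by fun_prop
  have sF := hasCompactSupport_tensor a.hasCompactSupport c.hasCompactSupport
  have e1 : _ = ∫ t, h t * ccConv μ a c t ∂μ := hν.integral_comp_mul cF sF hh
  have e2 : _ = ∫ t, h t * ∫ y, a (y⁻¹ * t) * c y ∂μ ∂μ := hν.integral_comp_mul_swap cF sF hh
  have i1 := (hh.comp (m := fun v : G × G => v.1 * v.2) (by fun_prop)).integrable cF sF ν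
  have i2 := (hh.comp (m := fun v : G × G => v.2 * v.1) (by fun_prop)).integrable cF sF ν
  have e3 : ∀ t, ∫ y, a (y⁻¹ * t) * c y ∂μ = ccConv μ c a t := fun t => by
    rw [ccConv_apply]
    congr 1
    ext y
    exact mul_comm _ _
  simp only [e3] at e2
  simp only [sub_mul]
  rw [integral_sub i1 i2, e1, e2]

variable [MeasurableSpace (G × G × G)] [BorelSpace (G × G × G)] {ν₃ : Measure (G × G × G)}

lemma hasCompactSupport_tensor_triple (a b c : C_c(G, ℂ)) :
    HasCompactSupport fun v : G × G × G => a v.1 * (b v.2.1 * c v.2.2) :=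
  hasCompactSupport_tensor (f := a) (g := fun w : G × G => b w.1 * c w.2) a.hasCompactSupport
    (hasCompactSupport_tensor b.hasCompactSupport c.hasCompactSupport)

/-- Each of the three terms, integrated along the fibres of its own multiplication map, turns two of
the factors into a convolution. The right side is the defect of the derivation identity. -/
lemma IsProdHaar.integral_quasiAdditive_defect (hν : IsProdHaar μ μ ν) (hν₃ : IsProdHaar μ ν ν₃)
    {p : G × G → ℂ} (hp : LocBdd p) (a b c : C_c(G, ℂ)) :
    ∫ v, (p (v.1 * v.2.1, v.2.2) - (p (v.1, v.2.1 * v.2.2) + p (v.2.1, v.2.2 * v.1)))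
        * (a v.1 * (b v.2.1 * c v.2.2)) ∂ν₃
      = ∫ w, p w * (ccConv μ a b w.1 * c w.2) ∂ν - (∫ w, p w * (a w.1 * ccConv μ b c w.2) ∂ν
        + ∫ w, p w * (b w.1 * ccConv μ c a w.2) ∂ν) := by
  have := hν.haar
  have := hν.regular
  have := hν₃.haar
  have cF : Continuous fun v : G × G × G => a v.1 * (b v.2.1 * c v.2.2) := by fun_prop
  have sF := hasCompactSupport_tensor_triple a b c
  have e1 := hν.integral_comp_mul_left hν₃ cF sF hp
  have e2 := hν.integral_comp_mul_right hν₃ cF sF hp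
  have e3 := hν.integral_comp_mul_rotate hν₃ cF sF hp
  have i1 := (hp.comp (m := fun v : G × G × G => (v.1 * v.2.1, v.2.2)) (by fun_prop)).integrable
    cF sF ν₃
  have i2 := (hp.comp (m := fun v : G × G × G => (v.1, v.2.1 * v.2.2)) (by fun_prop)).integrable
    cF sF ν₃
  have i3 := (hp.comp (m := fun v : G × G × G => (v.2.1, v.2.2 * v.1)) (by fun_prop)).integrable
    cF sF ν₃
  have i23 : Integrable (fun v : G × G × G => p (v.1, v.2.1 * v.2.2) * (a v.1 * (b v.2.1 * c v.2.2))
      + p (v.2.1, v.2.2 * v.1) * (a v.1 * (b v.2.1 * c v.2.2))) ν₃ := i2.add i3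
  simp only [sub_mul, add_mul]
  rw [integral_sub i1 i23, integral_add i2 i3, e1, e2, e3]
  have r1 : ∀ w : G × G, ∫ x, a x * (b (x⁻¹ * w.1) * c w.2) ∂μ = ccConv μ a b w.1 * c w.2 :=
    fun w => by
      rw [ccConv_apply, ← integral_mul_const]
      simp only [mul_assoc]
  have r2 : ∀ w : G × G, ∫ y, a w.1 * (b y * c (y⁻¹ * w.2)) ∂μ = a w.1 * ccConv μ b c w.2 :=
    fun w => by rw [ccConv_apply, ← integral_const_mul]
  have r3 : ∀ w : G × G, ∫ z, a (z⁻¹ * w.2) * (b w.1 * c z) ∂μ = b w.1 * ccConv μ c a w.2 :=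
    fun w => by
      rw [ccConv_apply, ← integral_const_mul]
      congr 1
      ext z
      ring
  simp only [r1, r2, r3]

end Classes

/-! ### Functions as functionals and as bilinear forms -/

section Correspondence

variable {G : Type*} [Group G] [TopologicalSpace G] [IsTopologicalGroup G]
  [LocallyCompactSpace G] [T2Space G] [MeasurableSpace G] [BorelSpace G]
  {μ : Measure G} [μ.IsHaarMeasure] [μ.Regular] {ω : G → ℝ}

/-- The integral against an element of `L^∞(G, 1/ω)` as a functional on `L¹(G, ω)`. -/
lemma exists_functional_of_le (hω : IsWeight ω) {h : G → ℂ} (hm : Measurable h) {C : ℝ}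
    (hC : ∀ x, ‖h x‖ ≤ C * ω x) :
    ∃ z : L1 μ ω →L[ℂ] ℂ, ∀ f : C_c(G, ℂ), z (ccToL1 μ hω f) = ∫ x, h x * f x ∂μ := by
  have hb := locBdd_of_le hω hm hC
  have hi : ∀ f : C_c(G, ℂ), Integrable (fun x => h x * f x) μ := fun f =>
    hb.integrable f.continuous f.hasCompactSupport μ
  let ℓ : C_c(G, ℂ) →ₗ[ℂ] ℂ :=
    { toFun := fun f => ∫ x, h x * f x ∂μ
      map_add' := fun f g => by
        rw [← integral_add (hi f) (hi g)]
        simp only [CompactlySupportedContinuousMap.add_apply, mul_add]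
      map_smul' := fun c f => by
        rw [← integral_smul]
        simp only [CompactlySupportedContinuousMap.smul_apply, mul_smul_comm, RingHom.id_apply] }
  have hωc := hω.continuous
  have hℓ : ∀ f, ‖ℓ f‖ ≤ C * ‖ccToL1 μ hω f‖ := fun f => by
    rw [norm_ccToL1, ← integral_const_mul]
    refine norm_integral_le_of_norm_le ?_ (ae_of_all _ fun x => ?_)
    · have c1 : Continuous fun x => ω x * ‖f x‖ := by fun_prop
      exact (c1.integrable_of_hasCompactSupport f.hasCompactSupport.norm.mul_left).const_mul C
    · rw [norm_mul, ← mul_assoc]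
      exact mul_le_mul_of_nonneg_right (hC x) (norm_nonneg _)
  exact ⟨ℓ.extendOfNorm (ccToL1 μ hω), fun f =>
    LinearMap.extendOfNorm_eq (denseRange_ccToL1 hω) ⟨C, hℓ⟩ f⟩

variable [MeasurableSpace (G × G)] [BorelSpace (G × G)] {ν : Measure (G × G)}

lemma IsProdHaar.exists_bilinear_of_le (hν : IsProdHaar μ μ ν) (hω : IsWeight ω) {p : G × G → ℂ}
    (hm : Measurable p) {C : ℝ} (hC0 : 0 ≤ C) (hC : ∀ v, ‖p v‖ ≤ C * (ω v.1 * ω v.2)) :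
    ∃ B : L1 μ ω →L[ℂ] L1 μ ω →L[ℂ] ℂ, ∀ a c : C_c(G, ℂ),
      B (ccToL1 μ hω a) (ccToL1 μ hω c) = ∫ v, p v * (a v.1 * c v.2) ∂ν := by
  have := hν.haar
  have hωc := hω.continuous
  have hb := locBdd_of_le_prod hω hm hC
  have cF : ∀ a c : C_c(G, ℂ), Continuous fun v : G × G => a v.1 * c v.2 := fun a c => by fun_prop
  have sF : ∀ a c : C_c(G, ℂ), HasCompactSupport fun v : G × G => a v.1 * c v.2 := fun a c =>
    hasCompactSupport_tensor a.hasCompactSupport c.hasCompactSupport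
  have hi : ∀ a c : C_c(G, ℂ), Integrable (fun v : G × G => p v * (a v.1 * c v.2)) ν :=
    fun a c => hb.integrable (cF a c) (sF a c) ν
  let b : C_c(G, ℂ) →ₗ[ℂ] C_c(G, ℂ) →ₗ[ℂ] ℂ :=
    LinearMap.mk₂ ℂ (fun a c => ∫ v, p v * (a v.1 * c v.2) ∂ν)
      (fun a a' c => by
        rw [← integral_add (hi a c) (hi a' c)]
        simp only [CompactlySupportedContinuousMap.add_apply, add_mul, mul_add])
      (fun z a c => by
        rw [← integral_smul]
        simp only [CompactlySupportedContinuousMap.smul_apply, smul_mul_assoc, mul_smul_comm])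
      (fun a c c' => by
        rw [← integral_add (hi a c) (hi a c')]
        simp only [CompactlySupportedContinuousMap.add_apply, mul_add])
      (fun z a c => by
        rw [← integral_smul]
        simp only [CompactlySupportedContinuousMap.smul_apply, mul_smul_comm])
  refine exists_bilinear_extension (denseRange_ccToL1 hω) b hC0 fun a c => ?_
  have cH : Continuous fun v : G × G => (ω v.1 * ‖a v.1‖) * (ω v.2 * ‖c v.2‖) := by fun_prop
  have sH : HasCompactSupport fun v : G × G => (ω v.1 * ‖a v.1‖) * (ω v.2 * ‖c v.2‖) :=
    hasCompactSupport_tensor (f := fun x => ω x * ‖a x‖) (g := fun x => ω x * ‖c x‖)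
      a.hasCompactSupport.norm.mul_left c.hasCompactSupport.norm.mul_left
  have e := hν.integral cH sH
  simp only [integral_const_mul, integral_mul_const] at e
  rw [norm_ccToL1, norm_ccToL1, mul_assoc, ← e, ← integral_const_mul]
  refine norm_integral_le_of_norm_le ((cH.integrable_of_hasCompactSupport sH).const_mul C)
    (ae_of_all _ fun v => ?_)
  rw [norm_mul, norm_mul]
  calc ‖p v‖ * (‖a v.1‖ * ‖c v.2‖) ≤ C * (ω v.1 * ω v.2) * (‖a v.1‖ * ‖c v.2‖) := by
        gcongr
        exact hC v
    _ = _ := by ring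

end Correspondence

/-! ### Weak amenability in terms of D and I -/

section WeakAmenability

variable {G : Type*} [Group G] [TopologicalSpace G] [IsTopologicalGroup G]
  [LocallyCompactSpace G] [T2Space G] [MeasurableSpace G] [BorelSpace G]
  {μ : Measure G} [μ.IsHaarMeasure] [μ.Regular] {ω : G → ℝ}

variable (μ) in
/-- If `L¹(G, ω)` is weakly amenable, then `D(G, ω) ⊆ I(G, ω)`. -/
lemma L1WeaklyAmenable.D_subset_I (hω : IsWeight ω) (hA : L1WeaklyAmenable μ ω) : D ω ⊆ I ω := by
  let _ : MeasurableSpace (G × G) := borel _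
  have : BorelSpace (G × G) := ⟨rfl⟩
  let _ : MeasurableSpace (G × G × G) := borel _
  have : BorelSpace (G × G × G) := ⟨rfl⟩
  obtain ⟨ν, hν⟩ := exists_isProdHaar μ μ
  have := hν.haar
  have := hν.regular
  obtain ⟨ν₃, hν₃⟩ := exists_isProdHaar μ ν
  have := hν₃.haar
  have := hν₃.regular
  rintro _ ⟨p, ⟨hp, C, hC⟩, rfl⟩
  refine ⟨p, ⟨hp, ?_⟩, rfl⟩
  obtain ⟨hm, hqa⟩ := (isQuasiAdditive_iff (ν₃ := ν₃)).1 hp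
  have hC' : ∀ v : G × G, ‖p v‖ ≤ max C 0 * (ω v.1 * ω v.2) := fun v => by
    have h1 := hω.pos v.1
    have h2 := hω.pos v.2
    refine ((div_le_iff₀ (by positivity)).1 (hC v.1 v.2)).trans ?_
    exact mul_le_mul_of_nonneg_right (le_max_left _ _) (by positivity)
  have hb := locBdd_of_le_prod hω hm hC'
  obtain ⟨B, hB⟩ := hν.exists_bilinear_of_le hω hm (le_max_right _ _) hC'
  obtain ⟨K, hK, hK'⟩ := exists_conv_eq (μ := μ) hω
  have hder : IsDerivation (conv μ ω) B := fun a b c => by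
    simp only [hK]
    -- Both sides are jointly continuous, so test functions suffice; there the identity is the
    -- vanishing of the quasi-additivity defect.
    refine (denseRange_ccToL1 (μ := μ) hω).induction_on₃
      (p := fun a b c => B (K a b) c = B a (K b c) + B b (K c a)) ?_ (fun a b c => ?_) a b c
    · exact isClosed_eq (by fun_prop) (by fun_prop)
    · rw [hK', hK', hK', hB, hB, hB, ← sub_eq_zero,
        ← hν.integral_quasiAdditive_defect hν₃ hb]
      have h0 : ∀ᶠ v : G × G × G in lae ν₃, p (v.1 * v.2.1, v.2.2)
          - (p (v.1, v.2.1 * v.2.2) + p (v.2.1, v.2.2 * v.1)) = (fun _ => (0 : ℂ)) v := by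
        filter_upwards [hqa] with v hv
        rw [hv, sub_self]
      rw [integral_mul_congr_lae h0 (hasCompactSupport_tensor_triple a b c)]
      simp
  obtain ⟨z, hz⟩ := hA B hder
  -- The functional z implementing the derivation has a density h bounded by a multiple of ω; this h
  -- is the primitive sought.
  have hℓ : IsBddFunctional μ ω ‖z‖ fun f => z (toL1 μ ω f) :=
    { add := fun f g hf hf' hg hg' => by
        rw [← map_add, ← toL1_add (integrable_weightedMeasure_of_hasCompactSupport hω hf hf')
          (integrable_weightedMeasure_of_hasCompactSupport hω hg hg')]
      smul := fun c f hf hf' => by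
        rw [toL1_const_mul c (integrable_weightedMeasure_of_hasCompactSupport hω hf hf'), map_smul,
          smul_eq_mul]
      bound := fun f hf hf' => by
        refine (z.le_opNorm _).trans_eq ?_
        rw [norm_toL1 hω (integrable_weightedMeasure_of_hasCompactSupport hω hf hf')]
        simp only [mul_comm] }
  obtain ⟨h, hhm, ⟨C', hC''⟩, hh⟩ := hℓ.exists_density hω.continuous hω.one_le
  have hh' : ∀ f : C_c(G, ℂ), z (ccToL1 μ hω f) = ∫ x, h x * f x ∂μ := fun f =>
    hh f f.continuous f.hasCompactSupport
  have hhb := locBdd_of_le hω hhm hC''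
  refine ⟨h, (memLinf_iff (μ := μ)).2 ⟨hhm, C', Eventually.of_forall fun x =>
    (div_le_iff₀ (hω.pos x)).2 (hC'' x)⟩, ?_⟩
  rw [locallyAE_eq_lae ν]
  have hcb : LocBdd fun v : G × G => h (v.1 * v.2) - h (v.2 * v.1) :=
    (hhb.comp (m := fun v : G × G => v.1 * v.2) (by fun_prop)).sub
      (hhb.comp (m := fun v : G × G => v.2 * v.1) (by fun_prop))
  have h0 := lae_eq_zero_of_tensor (νZ := ν) (hb.sub hcb) (Homeomorph.refl (G × G))
    fun a c ha ha' hc hc' => by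
      let a' : C_c(G, ℂ) := ⟨⟨a, ha⟩, ha'⟩
      let c' : C_c(G, ℂ) := ⟨⟨c, hc⟩, hc'⟩
      have cF : Continuous fun v : G × G => a' v.1 * c' v.2 := by fun_prop
      have sF : HasCompactSupport fun v : G × G => a' v.1 * c' v.2 := hasCompactSupport_tensor ha' hc'
      have e := hz (ccToL1 μ hω a') (ccToL1 μ hω c')
      rw [hB, hK, hK, hK', hK', hh', hh'] at e
      have e' := e.trans (hν.integral_coboundary_mul hhb a' c').symm
      simp only [sub_mul (p _)]
      change ∫ v, p v * (a' v.1 * c' v.2) - _ * (a' v.1 * c' v.2) ∂ν = 0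
      rw [integral_sub (hb.integrable cF sF ν) (hcb.integrable cF sF ν), sub_eq_zero]
      exact e'
  filter_upwards [h0] with v hv
  exact sub_eq_zero.1 hv

variable (μ) in
/-- If `D(G, ω) ⊆ I(G, ω)`, then `L¹(G, ω)` is weakly amenable. -/
lemma l1WeaklyAmenable_of_D_subset_I (hω : IsWeight ω) (hDI : D ω ⊆ I ω) :
    L1WeaklyAmenable μ ω := by
  let _ : MeasurableSpace (G × G) := borel _
  have : BorelSpace (G × G) := ⟨rfl⟩
  let _ : MeasurableSpace (G × G × G) := borel _
  have : BorelSpace (G × G × G) := ⟨rfl⟩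
  obtain ⟨ν, hν⟩ := exists_isProdHaar μ μ
  have := hν.haar
  have := hν.regular
  obtain ⟨ν₃, hν₃⟩ := exists_isProdHaar μ ν
  have := hν₃.haar
  have := hν₃.regular
  have hωc := hω.continuous
  intro B hder
  obtain ⟨K, hK, hK'⟩ := exists_conv_eq (μ := μ) hω
  -- The form B extends from tensors to all test functions on G × G, where it acquires a density p
  -- bounded by a multiple of ω(x) ω(y).
  obtain ⟨T, hT, hTB⟩ := hν.exists_functional hω B
  obtain ⟨p, hm, ⟨C, hC⟩, hp⟩ := hT.exists_density
    (w := fun v : G × G => ω v.1 * ω v.2) (by fun_prop) fun v =>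
      one_le_mul_of_one_le_of_one_le (hω.one_le v.1) (hω.one_le v.2)
  have hb := locBdd_of_le_prod hω hm hC
  have hB : ∀ a c : C_c(G, ℂ), B (ccToL1 μ hω a) (ccToL1 μ hω c)
      = ∫ v, p v * (a v.1 * c v.2) ∂ν := fun a c => by
    rw [← hTB, hp _ (by fun_prop) (hasCompactSupport_tensor a.hasCompactSupport
      c.hasCompactSupport)]
  have hqa : IsQuasiAdditive p := by
    refine (isQuasiAdditive_iff (ν₃ := ν₃)).2 ⟨hm, ?_⟩
    have hu : LocBdd fun v : G × G × G => p (v.1 * v.2.1, v.2.2)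
        - (p (v.1, v.2.1 * v.2.2) + p (v.2.1, v.2.2 * v.1)) := by
      have := ((hb.comp (m := fun v : G × G × G => (v.1 * v.2.1, v.2.2)) (by fun_prop)).sub
        (hb.comp (m := fun v : G × G × G => (v.1, v.2.1 * v.2.2)) (by fun_prop))).sub
        (hb.comp (m := fun v : G × G × G => (v.2.1, v.2.2 * v.1)) (by fun_prop))
      simpa only [sub_sub] using this
    have h0 := lae_eq_zero_of_tensor_triple (ν₃ := ν₃) hu fun a b c ha ha' hb₁ hb₂ hc hc' => by
      have := hν.integral_quasiAdditive_defect hν₃ hb ⟨⟨a, ha⟩, ha'⟩ ⟨⟨b, hb₁⟩, hb₂⟩ ⟨⟨c, hc⟩, hc'⟩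
      refine this.trans ?_
      rw [← hB, ← hB, ← hB, ← hK', ← hK', ← hK', sub_eq_zero]
      simp only [← hK]
      exact hder _ _ _
    filter_upwards [h0] with v hv
    exact sub_eq_zero.1 hv
  -- Membership in I concerns some representative p' and some essentially bounded h; these are
  -- carried back to p and to a pointwise bounded h', which defines a functional on L¹(G, ω).
  obtain ⟨p', ⟨-, h, hh, hp'⟩, hpp⟩ := hDI ⟨p, ⟨hqa, C, fun x y => by
    have h1 := hω.pos x
    have h2 := hω.pos y
    exact (div_le_iff₀ (by positivity)).2 (hC (x, y))⟩, rfl⟩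
  obtain ⟨h', hm', ⟨C', -, hC'⟩, hhh⟩ := hh.exists_bounded (μ := μ) hω
  rw [locallyAE_eq_lae ν] at hp'
  rw [toClass_eq_iff (ν := ν)] at hpp
  have hpe : ∀ᶠ v : G × G in lae ν, p v = h' (v.1 * v.2) - h' (v.2 * v.1) := by
    filter_upwards [hp', hpp, hν.tendsto_mul.eventually hhh, hν.tendsto_mul_swap.eventually hhh]
      with v h1 h2 h3 h4
    rw [← h2, h1, h3, h4]
  obtain ⟨z, hz⟩ := exists_functional_of_le (μ := μ) hω hm' hC'
  refine ⟨z, fun a c => ?_⟩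
  simp only [hK]
  refine (denseRange_ccToL1 (μ := μ) hω).induction_on₂
    (p := fun a c => B a c = z (K a c) - z (K c a)) ?_ (fun a c => ?_) a c
  · exact isClosed_eq (by fun_prop) (by fun_prop)
  · rw [hK', hK', hB, hz, hz, ← hν.integral_coboundary_mul (locBdd_of_le hω hm' hC')]
    exact integral_mul_congr_lae hpe (hasCompactSupport_tensor a.hasCompactSupport
      c.hasCompactSupport)

end WeakAmenability

/-! ### Averages of a quasi-additive function -/

/-- Although p is only Borel, increments of the integral are bounded by the integral of |Φ(x, y) -
Φ(x₀, y)| against a continuous majorant of p. -/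
lemma continuous_integral_mul_section {X Y 𝕜 : Type*} [RCLike 𝕜] [TopologicalSpace X]
    [TopologicalSpace Y] [T2Space Y] [MeasurableSpace Y] [BorelSpace Y] {ν : Measure Y}
    [IsFiniteMeasureOnCompacts ν] {p : Y → 𝕜} (hp : LocBdd p) {Φ : X × Y → 𝕜} (hΦ : Continuous Φ)
    (hΦ' : HasCompactSupport Φ) : Continuous fun x => ∫ y, p y * Φ (x, y) ∂ν := by
  obtain ⟨w, wc, hw⟩ := hp.bound
  have hi : ∀ x, Integrable (fun y => p y * Φ (x, y)) ν := fun x =>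
    hp.integrable (F := fun y => Φ (x, y)) (by fun_prop) (hasCompactSupport_section hΦ' x) ν
  refine continuous_iff_continuousAt.2 fun x₀ => ?_
  have hc : Continuous fun x => ∫ y, w y * ‖Φ (x, y) - Φ (x₀, y)‖ ∂ν := by
    rw [← continuousOn_univ]
    refine continuousOn_integral_of_compact_support
      (f := fun x y => w y * ‖Φ (x, y) - Φ (x₀, y)‖) (hΦ'.isCompact.image continuous_snd)
      (by fun_prop) fun x y _ hy => ?_
    have h0 : ∀ x, Φ (x, y) = 0 := fun x => by
      by_contra h
      exact hy ⟨(x, y), subset_tsupport _ h, rfl⟩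
    simp [h0]
  rw [ContinuousAt, tendsto_iff_norm_sub_tendsto_zero]
  refine squeeze_zero (fun _ => norm_nonneg _) (fun x => ?_) (by simpa using hc.tendsto x₀)
  rw [← integral_sub (hi x) (hi x₀)]
  refine norm_integral_le_of_norm_le ?_ (ae_of_all _ fun y => ?_)
  · have c1 : Continuous fun y => w y * ‖Φ (x, y) - Φ (x₀, y)‖ := by fun_prop
    have s1 : HasCompactSupport fun y => w y * ‖Φ (x, y) - Φ (x₀, y)‖ :=
      ((hasCompactSupport_section hΦ' x).sub (hasCompactSupport_section hΦ' x₀)).norm.mul_left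
    exact c1.integrable_of_hasCompactSupport s1
  · rw [← mul_sub, norm_mul]
    exact mul_le_mul_of_nonneg_right (hw y) (norm_nonneg _)

section Averaging

variable {G : Type*} [Group G] [TopologicalSpace G] [IsTopologicalGroup G]
  [LocallyCompactSpace G] [T2Space G] [MeasurableSpace G] [BorelSpace G]
  {μ : Measure G} [μ.IsHaarMeasure] [μ.Regular]

variable (μ) in
/-- The conjugate of a function, normalized so that its integral is preserved. -/
noncomputable def conjFun (s : G) (φ : G → ℝ) (t : G) : ℝ := rightScale μ s * φ (s * t * s⁻¹)

lemma continuous_conjFun (s : G) {φ : G → ℝ} (hφ : Continuous φ) : Continuous (conjFun μ s φ) := by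
  unfold conjFun
  fun_prop

lemma hasCompactSupport_conjFun (s : G) {φ : G → ℝ} (hφ : HasCompactSupport φ) :
    HasCompactSupport (conjFun μ s φ) :=
  (hasCompactSupport_comp_of_leftInverse hφ (θ := fun t => s * t * s⁻¹)
    (θ' := fun t => s⁻¹ * t * s) (by fun_prop) fun t => by group).mul_left

/-- This shows `conjFun` to be the transpose of the conjugation q ↦ q(s⁻¹ · s); the scaling factor
pays for the right translation. -/
lemma integral_mul_conjFun (s : G) (q φ : G → ℝ) :
    ∫ t, q t * conjFun μ s φ t ∂μ = ∫ t, q (s⁻¹ * t * s) * φ t ∂μ := by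
  have h1 := integral_mul_right_eq_rightScale μ s fun t => q (s⁻¹ * t) * φ (t * s⁻¹)
  have h2 := integral_mul_left_eq_self (μ := μ) (fun t => q (s⁻¹ * t) * φ (t * s⁻¹)) s
  simp only [mul_inv_cancel_right, ← mul_assoc, inv_mul_cancel, one_mul, RCLike.ofReal_real_eq_id,
    id] at h1 h2
  rw [h1, ← h2, ← integral_const_mul]
  congr 1
  ext t
  simp only [conjFun]
  ring

variable [MeasurableSpace (G × G)] [BorelSpace (G × G)] {ν : Measure (G × G)}

/-- The pairing of `p` with `g(x) φ(x y)`. -/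
noncomputable def pairing (ν : Measure (G × G)) (p : G × G → ℝ) (g φ : G → ℝ) : ℝ :=
  ∫ v, p v * (g v.1 * φ (v.1 * v.2)) ∂ν

lemma const_mul_pairing (c : ℝ) (p : G × G → ℝ) (g φ : G → ℝ) :
    c * pairing ν p g φ = ∫ v, p v * (c * (g v.1 * φ (v.1 * v.2))) ∂ν := by
  rw [pairing, ← integral_const_mul]
  congr 1
  ext v
  ring

lemma hasCompactSupport_mul_comp {g φ : G → ℝ} (hg : HasCompactSupport g)
    (hφ : HasCompactSupport φ) : HasCompactSupport fun v : G × G => g v.1 * φ (v.1 * v.2) :=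
  hasCompactSupport_comp_of_leftInverse (hasCompactSupport_tensor hg hφ)
    (θ := fun v : G × G => (v.1, v.1 * v.2)) (θ' := fun v => (v.1, v.1⁻¹ * v.2)) (by fun_prop)
    fun v => by simp

/-- As a functional of φ the pairing should be integration against the average ∫ p(x, x⁻¹t) g(x) dx;
boundedness is what yields that average as a density. -/
lemma IsProdHaar.isBddFunctional_pairing (hν : IsProdHaar μ μ ν) {p : G × G → ℝ}
    (hm : Measurable p) {C : ℝ} (hC : ∀ v, ‖p v‖ ≤ C) {g : G → ℝ} (hg : Continuous g)
    (hg' : HasCompactSupport g) :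
    IsBddFunctional μ (fun _ => 1) (C * ∫ x, ‖g x‖ ∂μ) (pairing ν p g) := by
  have := hν.haar
  have hp : LocBdd p := .of_bounded hm hC
  have cF : ∀ {φ : G → ℝ}, Continuous φ → Continuous fun v : G × G => g v.1 * φ (v.1 * v.2) :=
    fun hφ => by fun_prop
  have hi : ∀ {φ : G → ℝ}, Continuous φ → HasCompactSupport φ →
      Integrable (fun v : G × G => p v * (g v.1 * φ (v.1 * v.2))) ν := fun hφ hφ' =>
    hp.integrable (cF hφ) (hasCompactSupport_mul_comp hg' hφ') ν
  refine ⟨fun f f' hf hf' hh hh' => ?_, fun c f hf hf' => ?_, fun f hf hf' => ?_⟩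
  · simp only [pairing]
    rw [← integral_add (hi hf hf') (hi hh hh')]
    simp only [mul_add]
  · simp only [pairing]
    rw [← integral_const_mul]
    congr 1
    ext v
    ring
  · have cH : Continuous fun v : G × G => ‖g v.1‖ * ‖f (v.1 * v.2)‖ := by fun_prop
    have sH : HasCompactSupport fun v : G × G => ‖g v.1‖ * ‖f (v.1 * v.2)‖ :=
      hasCompactSupport_mul_comp (g := fun x => ‖g x‖) (φ := fun x => ‖f x‖) hg'.norm hf'.norm
    have e := hν.integral cH sH
    have e2 : ∀ x, ∫ y, ‖f (x * y)‖ ∂μ = ∫ y, ‖f y‖ ∂μ := fun x =>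
      integral_mul_left_eq_self (fun y => ‖f y‖) x
    simp only [integral_const_mul, e2, integral_mul_const] at e
    simp only [mul_one]
    rw [mul_assoc, ← e, ← integral_const_mul]
    refine norm_integral_le_of_norm_le ((cH.integrable_of_hasCompactSupport sH).const_mul C)
      (ae_of_all _ fun v => ?_)
    rw [norm_mul, norm_mul]
    exact mul_le_mul_of_nonneg_right (hC v) (by positivity)

lemma hasCompactSupport_mul_translate {f g φ : G → ℝ} (hf : HasCompactSupport f)
    (hg : HasCompactSupport g) (hφ : HasCompactSupport φ) :
    HasCompactSupport fun v : G × G × G => f v.1 * (g (v.1⁻¹ * v.2.1) * φ (v.2.1 * v.2.2)) :=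
  hasCompactSupport_comp_of_leftInverse (hasCompactSupport_tensor (f := f)
      (g := fun w : G × G => g w.1 * φ w.2) hf (hasCompactSupport_tensor hg hφ))
    (θ := fun v : G × G × G => (v.1, v.1⁻¹ * v.2.1, v.2.1 * v.2.2))
    (θ' := fun v => (v.1, v.1 * v.2.1, (v.1 * v.2.1)⁻¹ * v.2.2)) (by fun_prop)
    fun v => by simp

lemma hasCompactSupport_mul_conj {f g φ : G → ℝ} (hf : HasCompactSupport f)
    (hg : HasCompactSupport g) (hφ : HasCompactSupport φ) :
    HasCompactSupport fun v : G × G × G => f v.1 * (g v.2.1 * conjFun μ v.1 φ (v.2.1 * v.2.2)) := by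
  have := hasCompactSupport_comp_of_leftInverse (hasCompactSupport_tensor (f := f)
      (g := fun w : G × G => g w.1 * φ w.2) hf (hasCompactSupport_tensor hg hφ))
    (θ := fun v : G × G × G => (v.1, v.2.1, v.1 * (v.2.1 * v.2.2) * v.1⁻¹))
    (θ' := fun v => (v.1, v.2.1, v.2.1⁻¹ * (v.1⁻¹ * v.2.2 * v.1))) (by fun_prop)
    fun v => by simp [mul_assoc]
  have h2 : HasCompactSupport fun v : G × G × G => rightScale μ v.1 *
      (f v.1 * (g v.2.1 * φ (v.1 * (v.2.1 * v.2.2) * v.1⁻¹))) := this.mul_left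
  refine (congrArg HasCompactSupport ?_).mp h2
  ext v
  simp only [conjFun]
  ring

lemma continuous_mul_conj {f g φ : G → ℝ} (hf : Continuous f)
    (hg : Continuous g) (hφ : Continuous φ) :
    Continuous fun v : G × G × G => f v.1 * (g v.2.1 * conjFun μ v.1 φ (v.2.1 * v.2.2)) := by
  unfold conjFun
  fun_prop

variable [MeasurableSpace (G × G × G)] [BorelSpace (G × G × G)] {ν₃ : Measure (G × G × G)}

/-- The variation of the pairing under the action of `s` on both functions. -/
noncomputable def pairingVariation (μ : Measure G) [μ.IsHaarMeasure] [μ.Regular]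
    (ν : Measure (G × G)) (p : G × G → ℝ) (g φ : G → ℝ) (s : G) : ℝ :=
  pairing ν p (fun x => g (s⁻¹ * x)) φ - pairing ν p g (conjFun μ s φ)

lemma continuous_mul_pairing_translate [IsFiniteMeasureOnCompacts ν] {p : G × G → ℝ}
    (hp : LocBdd p) {f g φ : G → ℝ}
    (hf : Continuous f) (hf' : HasCompactSupport f) (hg : Continuous g) (hg' : HasCompactSupport g)
    (hφ : Continuous φ) (hφ' : HasCompactSupport φ) :
    Continuous fun s => f s * pairing ν p (fun x => g (s⁻¹ * x)) φ := by
  simp only [const_mul_pairing]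
  exact continuous_integral_mul_section (ν := ν) hp (by fun_prop)
    (hasCompactSupport_mul_translate hf' hg' hφ')

lemma continuous_mul_pairing_conj [IsFiniteMeasureOnCompacts ν] {p : G × G → ℝ}
    (hp : LocBdd p) {f g φ : G → ℝ}
    (hf : Continuous f) (hf' : HasCompactSupport f) (hg : Continuous g) (hg' : HasCompactSupport g)
    (hφ : Continuous φ) (hφ' : HasCompactSupport φ) :
    Continuous fun s => f s * pairing ν p g (conjFun μ s φ) := by
  simp only [const_mul_pairing]
  exact continuous_integral_mul_section (ν := ν) hp (continuous_mul_conj hf hg hφ)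
    (hasCompactSupport_mul_conj (μ := μ) hf' hg' hφ')

lemma continuous_mul_pairingVariation [IsFiniteMeasureOnCompacts ν] {p : G × G → ℝ}
    (hp : LocBdd p) {f g φ : G → ℝ}
    (hf : Continuous f) (hf' : HasCompactSupport f) (hg : Continuous g) (hg' : HasCompactSupport g)
    (hφ : Continuous φ) (hφ' : HasCompactSupport φ) :
    Continuous fun s => f s * pairingVariation μ ν p g φ s := by
  simp only [pairingVariation, mul_sub]
  exact (continuous_mul_pairing_translate hp hf hf' hg hg' hφ hφ').sub
    (continuous_mul_pairing_conj hp hf hf' hg hg' hφ hφ')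

/-- Quasi-additivity is tested against f(x) g(y) φ(xyz). Fibre integration gives pairings with
translates of g from p(xy, z), with conjugates of φ from p(y, zx), and the right side from p(x, yz).
This is c_{sy}(t) - c_y(s⁻¹ts) = c_s(t), averaged over s and y. -/
lemma IsProdHaar.integral_mul_pairingVariation (hν : IsProdHaar μ μ ν) (hν₃ : IsProdHaar μ ν ν₃)
    {p : G × G → ℝ} (hp : LocBdd p)
    (hqa : ∀ᶠ t : G × G × G in lae ν₃,
      p (t.1 * t.2.1, t.2.2) = p (t.1, t.2.1 * t.2.2) + p (t.2.1, t.2.2 * t.1))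
    {f g φ : G → ℝ}
    (hf : Continuous f) (hf' : HasCompactSupport f) (hg : Continuous g) (hg' : HasCompactSupport g)
    (hφ : Continuous φ) (hφ' : HasCompactSupport φ) :
    ∫ s, f s * pairingVariation μ ν p g φ s ∂μ = (∫ x, g x ∂μ) * pairing ν p f φ := by
  have := hν.haar
  have := hν.regular
  have := hν₃.haar
  have := hν₃.regular
  set Φ : G × G × G → ℝ := fun v => f v.1 * (g v.2.1 * φ (v.1 * v.2.1 * v.2.2)) with hΦ
  have Φc : Continuous Φ := by fun_prop
  have Φs : HasCompactSupport Φ := by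
    refine hasCompactSupport_comp_of_leftInverse (hasCompactSupport_tensor (f := f)
      (g := fun w : G × G => g w.1 * φ w.2) hf' (hasCompactSupport_tensor hg' hφ'))
      (θ := fun v : G × G × G => (v.1, v.2.1, v.1 * v.2.1 * v.2.2))
      (θ' := fun v => (v.1, v.2.1, (v.1 * v.2.1)⁻¹ * v.2.2)) (by fun_prop)
      fun v => by simp [mul_assoc]
  have e := integral_mul_congr_lae hqa Φs
  simp only [add_mul] at e
  have i2 := (hp.comp (m := fun v : G × G × G => (v.1, v.2.1 * v.2.2)) (by fun_prop)).integrable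
    Φc Φs ν₃
  have i3 := (hp.comp (m := fun v : G × G × G => (v.2.1, v.2.2 * v.1)) (by fun_prop)).integrable
    Φc Φs ν₃
  rw [integral_add i2 i3, hν.integral_comp_mul_left hν₃ Φc Φs hp,
    hν.integral_comp_mul_right hν₃ Φc Φs hp, hν.integral_comp_mul_rotate' hν₃ Φc Φs hp] at e
  simp only [hΦ, RCLike.ofReal_real_eq_id, id, mul_inv_cancel_left] at e
  have s1 := integral_integral_mul_swap (νX := μ) (νY := ν) hp (by fun_prop)
    (hasCompactSupport_mul_translate hf' hg' hφ')
  have s2 := integral_integral_mul_swap (νX := μ) (νY := ν) hp (continuous_mul_conj hf hg hφ)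
    (hasCompactSupport_mul_conj (μ := μ) hf' hg' hφ')
  have r1 : ∫ w : G × G, p w * ∫ x, f x * (g (x⁻¹ * w.1) * φ (w.1 * w.2)) ∂μ ∂ν
      = ∫ s, f s * pairing ν p (fun x => g (s⁻¹ * x)) φ ∂μ := by
    simp only [const_mul_pairing]
    exact s1.symm
  have r2 : ∫ w : G × G, p w * ∫ y, f w.1 * (g y * φ (w.1 * y * (y⁻¹ * w.2))) ∂μ ∂ν
      = (∫ x, g x ∂μ) * pairing ν p f φ := by
    rw [pairing, ← integral_const_mul]
    congr 1
    ext w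
    have : ∀ y, f w.1 * (g y * φ (w.1 * y * (y⁻¹ * w.2))) = g y * (f w.1 * φ (w.1 * w.2)) :=
      fun y => by
        rw [mul_assoc w.1, mul_inv_cancel_left]
        ring
    simp only [this]
    rw [integral_mul_const]
    ring
  have r3 : ∫ w : G × G, p w * ∫ x, rightScale μ x * (f x * (g w.1 * φ (x * w.1 * (w.2 * x⁻¹)))) ∂μ ∂ν
      = ∫ s, f s * pairing ν p g (conjFun μ s φ) ∂μ := by
    have : ∀ w : G × G, ∀ x, rightScale μ x * (f x * (g w.1 * φ (x * w.1 * (w.2 * x⁻¹))))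
        = f x * (g w.1 * conjFun μ x φ (w.1 * w.2)) := fun w x => by
      simp only [conjFun, mul_assoc]
      ring
    simp only [this]
    simp only [const_mul_pairing]
    exact s2.symm
  rw [r1, r2, r3] at e
  have j1 := (continuous_mul_pairing_translate (ν := ν) hp hf hf' hg hg' hφ
    hφ').integrable_of_hasCompactSupport hf'.mul_right (μ := μ)
  have j2 := (continuous_mul_pairing_conj (μ := μ) (ν := ν) hp hf hf' hg hg' hφ
    hφ').integrable_of_hasCompactSupport hf'.mul_right (μ := μ)
  simp only [pairingVariation, mul_sub]
  rw [integral_sub j1 j2, e]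
  ring

end Averaging

/-! ### Suprema of uniformly bounded families -/

section Suprema

open scoped NNReal

variable {X ι : Type*} [TopologicalSpace X] [MeasurableSpace X] [BorelSpace X] {μ : Measure X}
  [IsFiniteMeasureOnCompacts μ]

lemma measurable_finset_sup_apply {r : ι → X → ℝ≥0} (hr : ∀ i, Measurable (r i)) (S : Finset ι) :
    Measurable fun t => S.sup fun i => r i t := by
  classical
  induction S using Finset.induction_on with
  | empty => simp
  | insert i S _ ih =>
    simp only [Finset.sup_insert]
    exact (hr i).sup ih

lemma locBdd_finset_sup {r : ι → X → ℝ≥0} (hr : ∀ i, Measurable (r i)) {B : ℝ≥0}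
    (hB : ∀ i t, r i t ≤ B) (S : Finset ι) : LocBdd fun t => ((S.sup fun i => r i t : ℝ≥0) : ℝ) :=
  .of_bounded (measurable_finset_sup_apply hr S).coe_nnreal_real (C := B) fun t => by
    rw [Real.norm_eq_abs, NNReal.abs_eq]
    exact NNReal.coe_le_coe.2 (Finset.sup_le fun i _ => hB i t)

/-- The integrals against the finite suprema of a uniformly bounded family of functions converge. -/
lemma exists_tendsto_integral_finset_sup {r : ι → X → ℝ≥0} (hr : ∀ i, Measurable (r i)) {B : ℝ≥0}
    (hB : ∀ i t, r i t ≤ B) :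
    ∃ z : (X → ℝ) → ℝ, IsBddFunctional μ (fun _ => 1) B z ∧
      ∀ φ, Continuous φ → HasCompactSupport φ →
        Tendsto (fun S : Finset ι => ∫ t, ((S.sup fun i => r i t : ℝ≥0) : ℝ) * φ t ∂μ) atTop
          (𝓝 (z φ)) := by
  set M : Finset ι → (X → ℝ) → ℝ := fun S φ => ∫ t, ((S.sup fun i => r i t : ℝ≥0) : ℝ) * φ t ∂μ
    with hM
  have hi : ∀ (S : Finset ι) {φ : X → ℝ}, Continuous φ → HasCompactSupport φ →
      Integrable (fun t => ((S.sup fun i => r i t : ℝ≥0) : ℝ) * φ t) μ := fun S φ hφ hφ' =>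
    (locBdd_finset_sup hr hB S).integrable hφ hφ' μ
  have hbound : ∀ (S : Finset ι) {φ : X → ℝ}, Continuous φ → HasCompactSupport φ →
      ‖M S φ‖ ≤ B * ∫ t, ‖φ t‖ * 1 ∂μ := fun S φ hφ hφ' => by
    simp only [mul_one]
    rw [← integral_const_mul]
    refine norm_integral_le_of_norm_le
      ((hφ.norm.integrable_of_hasCompactSupport hφ'.norm).const_mul _) (ae_of_all _ fun t => ?_)
    rw [norm_mul, Real.norm_eq_abs, NNReal.abs_eq]
    exact mul_le_mul_of_nonneg_right (NNReal.coe_le_coe.2 (Finset.sup_le fun i _ => hB i t))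
      (norm_nonneg _)
  -- For φ ≥ 0 the integrals increase with the finite set and stay bounded; a general φ is split
  -- into its positive and negative parts.
  have hpos : ∀ {φ : X → ℝ}, Continuous φ → HasCompactSupport φ → (∀ t, 0 ≤ φ t) →
      ∃ L, Tendsto (fun S => M S φ) atTop (𝓝 L) := fun {φ} hφ hφ' h0 =>
    ⟨_, tendsto_atTop_ciSup (fun S T hST => integral_mono (hi S hφ hφ') (hi T hφ hφ') fun t =>
      mul_le_mul_of_nonneg_right (NNReal.coe_le_coe.2 (Finset.sup_mono hST)) (h0 t))
      ⟨B * ∫ t, ‖φ t‖ * 1 ∂μ, by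
        rintro _ ⟨S, rfl⟩
        exact (le_abs_self _).trans (hbound S hφ hφ')⟩⟩
  have hlim : ∀ {φ : X → ℝ}, Continuous φ → HasCompactSupport φ →
      ∃ L, Tendsto (fun S => M S φ) atTop (𝓝 L) := fun {φ} hφ hφ' => by
    have c1 : Continuous fun t => max (φ t) 0 := by fun_prop
    have c2 : Continuous fun t => max (-φ t) 0 := by fun_prop
    have s1 : HasCompactSupport fun t => max (φ t) 0 :=
      hφ'.comp_left (g := fun x => max x 0) (by simp)
    have s2 : HasCompactSupport fun t => max (-φ t) 0 :=
      hφ'.comp_left (g := fun x => max (-x) 0) (by simp)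
    obtain ⟨L₁, h₁⟩ := hpos c1 s1 fun t => le_max_right _ _
    obtain ⟨L₂, h₂⟩ := hpos c2 s2 fun t => le_max_right _ _
    refine ⟨L₁ - L₂, (h₁.sub h₂).congr fun S => ?_⟩
    simp only [hM]
    rw [← integral_sub (hi S c1 s1) (hi S c2 s2)]
    congr 1
    ext t
    rw [← mul_sub]
    congr 1
    rcases le_total 0 (φ t) with h | h
    · rw [max_eq_left h, max_eq_right (by linarith), sub_zero]
    · rw [max_eq_right h, max_eq_left (by linarith), zero_sub, neg_neg]
  have hz : ∀ {φ : X → ℝ}, Continuous φ → HasCompactSupport φ →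
      Tendsto (fun S => M S φ) atTop (𝓝 (limUnder atTop fun S => M S φ)) := fun hφ hφ' =>
    tendsto_nhds_limUnder (hlim hφ hφ')
  refine ⟨fun φ => limUnder atTop fun S => M S φ, ⟨fun f g hf hf' hg hg' => ?_,
    fun c f hf hf' => ?_, fun f hf hf' => ?_⟩, fun φ hφ hφ' => hz hφ hφ'⟩
  · refine (((hz hf hf').add (hz hg hg')).congr fun S => ?_).limUnder_eq
    simp only [hM, mul_add]
    exact (integral_add (hi S hf hf') (hi S hg hg')).symm
  · refine (((hz hf hf').const_mul c).congr fun S => ?_).limUnder_eq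
    simp only [hM]
    rw [← integral_const_mul]
    congr 1
    ext t
    ring
  · exact le_of_tendsto (hz hf hf').norm (Eventually.of_forall fun S => hbound S hf hf')

end Suprema

/-! ### Bounded quasi-additive functions are coboundaries -/

section Johnson

open scoped NNReal

variable {G : Type*} [Group G] [TopologicalSpace G] [IsTopologicalGroup G]
  [LocallyCompactSpace G] [T2Space G] [MeasurableSpace G] [BorelSpace G]
  {μ : Measure G} [μ.IsHaarMeasure] [μ.Regular]

variable (μ) in
/-- The continuous probability densities of compact support. -/
@[ext]
structure Density where
  /-- The underlying function. -/
  toFun : G → ℝ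
  continuous : Continuous toFun
  hasCompactSupport : HasCompactSupport toFun
  nonneg : ∀ x, 0 ≤ toFun x
  integral_eq : ∫ x, toFun x ∂μ = 1

instance : Nonempty (Density μ) := by
  obtain ⟨f, fs, f0, fx⟩ := exists_continuous_nonneg_pos (1 : G)
  have hf := f.continuous.integral_pos_of_hasCompactSupport_nonneg_nonzero (μ := μ) fs f0 fx
  refine ⟨⟨fun x => (∫ x, f x ∂μ)⁻¹ * f x, by fun_prop, fs.mul_left,
    fun x => mul_nonneg (inv_nonneg.2 hf.le) (f0 x), ?_⟩⟩
  rw [integral_const_mul, inv_mul_cancel₀ hf.ne']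

/-- The left translate of a probability density. -/
def Density.translate (s : G) (g : Density μ) : Density μ :=
  ⟨fun x => g.toFun (s⁻¹ * x), g.continuous.comp (by fun_prop),
    hasCompactSupport_comp_of_leftInverse g.hasCompactSupport (θ' := fun x => s * x) (by fun_prop)
      fun x => by simp,
    fun x => g.nonneg _, (integral_mul_left_eq_self g.toFun s⁻¹).trans g.integral_eq⟩

lemma Density.translate_inv_translate (s : G) (g : Density μ) :
    (g.translate s⁻¹).translate s = g :=
  Density.ext (funext fun x => by simp [translate])

variable [MeasurableSpace (G × G)] [BorelSpace (G × G)] {ν : Measure (G × G)}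
  [MeasurableSpace (G × G × G)] [BorelSpace (G × G × G)] {ν₃ : Measure (G × G × G)}
  {p : G × G → ℝ}

/-- Integrated against any f, both variations give the pairing of p with f and φ. With W their
difference and f = χ²W this reads ∫ (χW)² = 0, and continuity gives W(s) = 0 at every s, not just at
almost every one. -/
lemma IsProdHaar.pairingVariation_eq (hν : IsProdHaar μ μ ν) (hν₃ : IsProdHaar μ ν ν₃)
    (hp : LocBdd p) (hqa : ∀ᶠ t : G × G × G in lae ν₃,
      p (t.1 * t.2.1, t.2.2) = p (t.1, t.2.1 * t.2.2) + p (t.2.1, t.2.2 * t.1))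
    (g g' : Density μ) {φ : G → ℝ} (hφ : Continuous φ) (hφ' : HasCompactSupport φ) (s : G) :
    pairingVariation μ ν p g.toFun φ s = pairingVariation μ ν p g'.toFun φ s := by
  have := hν.haar
  obtain ⟨χ, χc, χs, χ1, -⟩ := exists_cutoff (isCompact_singleton (x := s))
  set W : G → ℝ := fun s => pairingVariation μ ν p g.toFun φ s - pairingVariation μ ν p g'.toFun φ s
  have hψ : Continuous fun s => χ s * W s := by
    simp only [W, mul_sub]
    exact (continuous_mul_pairingVariation hp χc χs g.continuous g.hasCompactSupport hφ hφ').sub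
      (continuous_mul_pairingVariation hp χc χs g'.continuous g'.hasCompactSupport hφ hφ')
  have hf : Continuous fun s => χ s * (χ s * W s) := χc.mul hψ
  have hf' : HasCompactSupport fun s => χ s * (χ s * W s) := χs.mul_right
  have e1 := hν.integral_mul_pairingVariation hν₃ hp hqa hf hf' g.continuous g.hasCompactSupport hφ hφ'
  have e2 := hν.integral_mul_pairingVariation hν₃ hp hqa hf hf' g'.continuous g'.hasCompactSupport hφ hφ'
  rw [g.integral_eq] at e1
  rw [g'.integral_eq] at e2
  rw [← e2, ← sub_eq_zero, ← integral_sub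
    ((continuous_mul_pairingVariation hp hf hf' g.continuous g.hasCompactSupport hφ hφ').integrable_of_hasCompactSupport
      hf'.mul_right)
    ((continuous_mul_pairingVariation hp hf hf' g'.continuous g'.hasCompactSupport hφ
      hφ').integrable_of_hasCompactSupport hf'.mul_right)] at e1
  by_contra hne
  have hW : W s ≠ 0 := sub_ne_zero.2 hne
  have hsq : Continuous fun s => (χ s * W s) * (χ s * W s) := hψ.mul hψ
  have hpos := hsq.integral_pos_of_hasCompactSupport_nonneg_nonzero (μ := μ) (x := s)
    (χs.mul_right.mul_right) (fun s => mul_self_nonneg _)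
    (by simpa [χ1 s rfl] using hW)
  refine hpos.ne' ((integral_congr_ae (ae_of_all _ fun s => ?_)).trans e1)
  simp only [W]
  ring

/-- Since |p| ≤ K - 1, the density of the pairing lies in [-K, K]. Adding K makes it nonnegative, so
that finite suprema, including the empty one, make sense in `ℝ≥0`. -/
lemma IsProdHaar.exists_density_pairing (hν : IsProdHaar μ μ ν) (hm : Measurable p) {K : ℝ≥0}
    (hK : ∀ v, ‖p v‖ + 1 ≤ K) (g : Density μ) :
    ∃ r : G → ℝ≥0, Measurable r ∧ (∀ t, r t ≤ 2 * K) ∧ ∀ φ : G → ℝ, Continuous φ →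
      HasCompactSupport φ → pairing ν p g.toFun φ = ∫ t, ((r t : ℝ) - K) * φ t ∂μ := by
  have hK1 : (1 : ℝ) ≤ K := le_trans (by linarith [norm_nonneg (p 1)]) (hK 1)
  have hg : ∫ x, ‖g.toFun x‖ ∂μ = 1 := by
    rw [← g.integral_eq]
    congr 1
    ext x
    rw [Real.norm_eq_abs, abs_of_nonneg (g.nonneg x)]
  have hb := hν.isBddFunctional_pairing hm (C := K - 1) (fun v => by linarith [hK v]) g.continuous g.hasCompactSupport
  rw [hg, mul_one] at hb
  obtain ⟨h, hm, hbd, hh⟩ := hb.exists_density_real (by linarith)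
  have h0 : ∀ t, -K ≤ h t ∧ h t ≤ K := fun t => by
    have := hbd t
    rw [sub_add_cancel, Real.norm_eq_abs] at this
    exact abs_le.1 this
  have hr : ∀ t, ((h t + K).toNNReal : ℝ) = h t + K := fun t =>
    Real.coe_toNNReal _ (by linarith [(h0 t).1])
  refine ⟨fun t => (h t + K).toNNReal, (hm.add_const _).real_toNNReal, fun t => ?_,
    fun φ hφ hφ' => ?_⟩
  · rw [← NNReal.coe_le_coe, hr]
    push_cast
    linarith [(h0 t).2]
  · simp only [hr, add_sub_cancel_right]
    exact hh φ hφ hφ'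

end Johnson

section Johnson

open scoped NNReal

variable {G : Type*} [Group G] [TopologicalSpace G] [IsTopologicalGroup G]
  [LocallyCompactSpace G] [T2Space G] [MeasurableSpace G] [BorelSpace G]
  {μ : Measure G} [μ.IsHaarMeasure] [μ.Regular]
  [MeasurableSpace (G × G)] [BorelSpace (G × G)] {ν : Measure (G × G)}
  [MeasurableSpace (G × G × G)] [BorelSpace (G × G × G)] {ν₃ : Measure (G × G × G)}
  {p : G × G → ℝ}

lemma integral_conjFun (s : G) (φ : G → ℝ) : ∫ t, conjFun μ s φ t ∂μ = ∫ t, φ t ∂μ := by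
  simpa using integral_mul_conjFun (μ := μ) s (fun _ => 1) φ

lemma locBdd_coe_of_le {r : G → ℝ≥0} (hr : Measurable r) {B : ℝ≥0} (hB : ∀ t, r t ≤ B) :
    LocBdd fun t => (r t : ℝ) :=
  .of_bounded hr.coe_nnreal_real (C := B) fun t => by
    rw [Real.norm_eq_abs, NNReal.abs_eq]
    exact NNReal.coe_le_coe.2 (hB t)

/-- A common real shift w, possibly negative, passes through the supremum; nonemptiness is needed
because the empty supremum is 0. -/
lemma finset_sup_eq_add {ι : Type*} {S : Finset ι} (hS : S.Nonempty) {u v : ι → ℝ≥0} {w : ℝ}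
    (h : ∀ i ∈ S, (u i : ℝ) = v i + w) : ((S.sup u : ℝ≥0) : ℝ) = (S.sup v : ℝ≥0) + w := by
  obtain ⟨i, hi, hu⟩ := S.exists_mem_eq_sup hS u
  obtain ⟨j, hj, hv⟩ := S.exists_mem_eq_sup hS v
  have h1 : (v i : ℝ) ≤ (S.sup v : ℝ≥0) := NNReal.coe_le_coe.2 (Finset.le_sup hi)
  have h2 : (u j : ℝ) ≤ (S.sup u : ℝ≥0) := NNReal.coe_le_coe.2 (Finset.le_sup hj)
  refine le_antisymm ?_ ?_
  · rw [hu, h i hi]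
    linarith
  · rw [hv, ← h j hj]
    exact h2

/-- The heart of the argument: h is the supremum of the averages r_g over all densities g, formed
weakly as a limit over finite sets. Translating every g by s permutes the family, while it replaces
each r_g by its conjugate plus a function that does not depend on g. Comparing the two suprema gives
the equation for h. -/
lemma IsProdHaar.exists_primitive (hν : IsProdHaar μ μ ν) (hν₃ : IsProdHaar μ ν ν₃)
    (hm : Measurable p) {K : ℝ≥0} (hK : ∀ v, ‖p v‖ + 1 ≤ K) (hqa : ∀ᶠ t : G × G × G in lae ν₃,
      p (t.1 * t.2.1, t.2.2) = p (t.1, t.2.1 * t.2.2) + p (t.2.1, t.2.2 * t.1)) :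
    ∃ h : G → ℝ, Measurable h ∧ (∃ C, ∀ x, ‖h x‖ ≤ C) ∧ ∀ (g : Density μ) (φ : G → ℝ),
      Continuous φ → HasCompactSupport φ → ∀ s,
      pairingVariation μ ν p g.toFun φ s = ∫ t, h t * φ t ∂μ - ∫ t, h t * conjFun μ s φ t ∂μ := by
  classical
  have hp : LocBdd p := .of_bounded hm (C := K) fun v => by linarith [hK v]
  choose r hr hrK hrp using hν.exists_density_pairing hm hK
  obtain ⟨z, hz, hzt⟩ := exists_tendsto_integral_finset_sup (μ := μ) hr hrK
  obtain ⟨h, hhm, hhb, hh⟩ := hz.exists_density_real (NNReal.coe_nonneg _)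
  refine ⟨h, hhm, ⟨_, hhb⟩, fun g φ hφ hφ' s => ?_⟩
  have hφc := continuous_conjFun (μ := μ) s hφ
  have hφs := hasCompactSupport_conjFun (μ := μ) s hφ'
  rw [← hh φ hφ hφ', ← hh _ hφc hφs, eq_sub_iff_add_eq]
  have hrb : ∀ g, LocBdd fun t => (r g t : ℝ) := fun g => locBdd_coe_of_le (hr g) (hrK g)
  have hrb' : ∀ g, LocBdd fun t => (r g (s⁻¹ * t * s) : ℝ) := fun g =>
    (hrb g).comp (m := fun t => s⁻¹ * t * s) (by fun_prop)
  have hwb : ∀ g : Density μ, LocBdd fun t => (r (g.translate s) t : ℝ) - r g (s⁻¹ * t * s) :=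
    fun g => (hrb _).sub (hrb' g)
  have hw : ∀ (g : Density μ) (ψ : G → ℝ), Continuous ψ → HasCompactSupport ψ →
      ∫ t, ((r (g.translate s) t : ℝ) - r g (s⁻¹ * t * s)) * ψ t ∂μ
        = pairingVariation μ ν p g.toFun ψ s := fun g ψ hψ hψ' => by
    have c1 := continuous_conjFun (μ := μ) s hψ
    have s1 := hasCompactSupport_conjFun (μ := μ) s hψ'
    have e1 : pairing ν p (fun x => g.toFun (s⁻¹ * x)) ψ = _ := hrp (g.translate s) ψ hψ hψ'
    have e2 := hrp g _ c1 s1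
    simp only [sub_mul] at e1 e2
    rw [integral_sub ((hrb _).integrable hψ hψ' μ)
      ((hψ.integrable_of_hasCompactSupport hψ').const_mul _), integral_const_mul] at e1
    rw [integral_sub ((hrb _).integrable c1 s1 μ)
      ((c1.integrable_of_hasCompactSupport s1).const_mul _), integral_const_mul,
      integral_conjFun, integral_mul_conjFun s (fun t => (r g t : ℝ))] at e2
    simp only [sub_mul]
    rw [pairingVariation, e1, e2, integral_sub ((hrb _).integrable hψ hψ' μ)
      ((hrb' g).integrable hψ hψ' μ)]
    ring
  -- The shift between r of the translated density and the conjugate of r is the same for all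
  -- densities, up to a locally null set depending on g'.
  have hae : ∀ g' : Density μ, ∀ᶠ t in lae μ, (r (g'.translate s) t : ℝ)
      = r g' (s⁻¹ * t * s) + ((r (g.translate s) t : ℝ) - r g (s⁻¹ * t * s)) := fun g' => by
    have h0 := lae_eq_zero_of_integral (ν := μ) ((hwb g').sub (hwb g)) fun ψ hψ hψ' => by
      simp only [sub_mul ((r (g'.translate s) _ : ℝ) - r g' (s⁻¹ * _ * s))]
      rw [integral_sub ((hwb g').integrable hψ hψ' μ) ((hwb g).integrable hψ hψ' μ), hw g' ψ hψ hψ',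
        hw g ψ hψ hψ', hν.pairingVariation_eq hν₃ hp hqa g' g hψ hψ' s, sub_self]
    filter_upwards [h0] with t ht
    linarith
  -- Translation by s is onto, so translated finite sets still exhaust the family.
  have hshift : Tendsto (Finset.image (Density.translate (μ := μ) s)) atTop atTop :=
    tendsto_finset_image_atTop_atTop fun g => Density.translate_inv_translate s g
  have hlim := (hzt φ hφ hφ').comp hshift
  refine tendsto_nhds_unique ((((hzt _ hφc hφs).const_add _).congr' ?_)) hlim
  -- Only sets containing g are considered, which makes them nonempty; finiteness then leaves
  -- finitely many exceptional sets.
  filter_upwards [eventually_ge_atTop {g}] with S hS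
  have hSne : S.Nonempty := ⟨g, hS (Finset.mem_singleton_self g)⟩
  have hSb := locBdd_finset_sup hr hrK S
  have hSb' : LocBdd fun t => ((S.sup fun i => r i (s⁻¹ * t * s) : ℝ≥0) : ℝ) :=
    hSb.comp (m := fun t => s⁻¹ * t * s) (by fun_prop)
  have hSe : ∀ᶠ t in lae μ, (((S.image (Density.translate s)).sup fun i => r i t : ℝ≥0) : ℝ)
      = ((S.sup fun i => r i (s⁻¹ * t * s) : ℝ≥0) : ℝ)
        + ((r (g.translate s) t : ℝ) - r g (s⁻¹ * t * s)) := by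
    have hall : ∀ᶠ t in lae μ, ∀ g' ∈ S, (r (g'.translate s) t : ℝ)
      = r g' (s⁻¹ * t * s) + ((r (g.translate s) t : ℝ) - r g (s⁻¹ * t * s)) :=
      (Filter.eventually_all_finset S).2 fun g' _ => hae g'
    filter_upwards [hall] with t ht
    rw [Finset.sup_image]
    exact finset_sup_eq_add hSne ht
  rw [Function.comp_apply, integral_mul_congr_lae hSe hφ']
  simp only [add_mul]
  rw [integral_add (hSb'.integrable hφ hφ' μ) ((hwb g).integrable hφ hφ' μ), hw g φ hφ hφ',
    integral_mul_conjFun s (fun t => ((S.sup fun i => r i t : ℝ≥0) : ℝ))]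
  ring

/-- The equation for h, integrated in s against f with a density g of integral 1, equates the
pairing of p with that of the coboundary of h. -/
lemma IsProdHaar.exists_coboundary_real (hν : IsProdHaar μ μ ν) (hν₃ : IsProdHaar μ ν ν₃)
    (hm : Measurable p) {C : ℝ} (hC : ∀ v, ‖p v‖ ≤ C) (hqa : ∀ᶠ t : G × G × G in lae ν₃,
      p (t.1 * t.2.1, t.2.2) = p (t.1, t.2.1 * t.2.2) + p (t.2.1, t.2.2 * t.1)) :
    ∃ h : G → ℝ, Measurable h ∧ (∃ C, ∀ x, ‖h x‖ ≤ C) ∧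
      ∀ᶠ v : G × G in lae ν, p v = h (v.1 * v.2) - h (v.2 * v.1) := by
  have := hν.haar
  have := hν.regular
  have hp : LocBdd p := .of_bounded hm hC
  have hC0 : 0 ≤ C := (norm_nonneg _).trans (hC 1)
  obtain ⟨h, hhm, ⟨C', hhb⟩, hh⟩ := hν.exists_primitive hν₃ hm (K := (C + 1).toNNReal)
    (fun v => by rw [Real.coe_toNNReal _ (by positivity)]; linarith [hC v]) hqa
  have hhl : LocBdd h := .of_bounded hhm hhb
  refine ⟨h, hhm, ⟨C', hhb⟩, ?_⟩
  have hcb₁ : LocBdd fun v : G × G => h (v.1 * v.2) :=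
    hhl.comp (m := fun v : G × G => v.1 * v.2) (by fun_prop)
  have hcb₂ : LocBdd fun v : G × G => h (v.2 * v.1) :=
    hhl.comp (m := fun v : G × G => v.2 * v.1) (by fun_prop)
  obtain ⟨g⟩ := (inferInstance : Nonempty (Density μ))
  -- The pairings use f(x) φ(xy), so the tensor test is pulled back along the shear (x, y) ↦ (x,
  -- xy).
  let θ : G × G ≃ₜ G × G := Homeomorph.shearMulRight G
  have h0 := lae_eq_zero_of_tensor (νZ := ν) (hp.sub (hcb₁.sub hcb₂)) θ fun f φ hf hf' hφ hφ' => by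
    change ∫ v, (p v - (h (v.1 * v.2) - h (v.2 * v.1))) * (f v.1 * φ (v.1 * v.2)) ∂ν = 0
    have cF : Continuous fun v : G × G => f v.1 * φ (v.1 * v.2) := by fun_prop
    have sF := hasCompactSupport_mul_comp hf' hφ'
    have e := hν.integral_mul_pairingVariation hν₃ hp hqa hf hf' g.continuous g.hasCompactSupport
      hφ hφ'
    rw [g.integral_eq, one_mul] at e
    simp only [hh g φ hφ hφ', mul_sub] at e
    have e1 := hν.integral_comp_mul cF sF hhl
    have e2 := hν.integral_comp_mul_swap' cF sF hhl
    simp only [mul_inv_cancel_left, RCLike.ofReal_real_eq_id, id] at e1 e2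
    have cΦ : Continuous fun v : G × G => f v.1 * conjFun μ v.1 φ v.2 := by
      unfold conjFun
      fun_prop
    have sΦ : HasCompactSupport fun v : G × G => f v.1 * conjFun μ v.1 φ v.2 := by
      have h1 : HasCompactSupport fun v : G × G =>
          rightScale μ v.1 * (f v.1 * φ (v.1 * v.2 * v.1⁻¹)) :=
        (hasCompactSupport_comp_of_leftInverse (hasCompactSupport_tensor hf' hφ')
          (θ := fun v : G × G => (v.1, v.1 * v.2 * v.1⁻¹))
          (θ' := fun v => (v.1, v.1⁻¹ * v.2 * v.1)) (by fun_prop)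
          fun v => by simp [mul_assoc]).mul_left
      refine (congrArg HasCompactSupport ?_).mp h1
      ext v
      simp only [conjFun]
      ring
    have e3 := integral_integral_mul_swap (νX := μ) (νY := μ) hhl cΦ sΦ
    have e4 : ∀ t, ∫ x, rightScale μ x * (f x * φ (x * (t * x⁻¹))) ∂μ
        = ∫ x, f x * conjFun μ x φ t ∂μ := fun t => by
      congr 1
      ext x
      simp only [conjFun, mul_assoc]
      ring
    simp only [e4] at e2
    rw [← e3] at e2
    have e5 : ∀ x, ∫ t, h t * (f x * conjFun μ x φ t) ∂μ = f x * ∫ t, h t * conjFun μ x φ t ∂μ :=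
      fun x => by
        rw [← integral_const_mul]
        congr 1
        ext t
        ring
    simp only [e5] at e2
    have cf5 : Continuous fun x => f x * ∫ t, h t * conjFun μ x φ t ∂μ := by
      simp only [← e5]
      exact continuous_integral_mul_section hhl cΦ sΦ
    simp only [integral_mul_const] at e1
    rw [integral_sub ((hf.integrable_of_hasCompactSupport hf').mul_const _)
      (cf5.integrable_of_hasCompactSupport hf'.mul_right), integral_mul_const, ← e2] at e
    have e6 : ∫ t, h t * ((∫ x, f x ∂μ) * φ t) ∂μ = (∫ x, f x ∂μ) * ∫ t, h t * φ t ∂μ := by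
      rw [← integral_const_mul]
      congr 1
      ext t
      ring
    rw [e6] at e1
    have i12 : Integrable (fun v : G × G => h (v.1 * v.2) * (f v.1 * φ (v.1 * v.2))
        - h (v.2 * v.1) * (f v.1 * φ (v.1 * v.2))) ν :=
      (hcb₁.integrable cF sF ν).sub (hcb₂.integrable cF sF ν)
    simp only [sub_mul]
    rw [integral_sub (hp.integrable cF sF ν) i12, integral_sub (hcb₁.integrable cF sF ν)
      (hcb₂.integrable cF sF ν), e1, e, pairing, sub_self]
  filter_upwards [h0] with v hv
  exact sub_eq_zero.1 hv

end Johnson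

/-! ### Comparison of D and I for the two weights -/

section Main

variable {G : Type*} [Group G] [TopologicalSpace G] [IsTopologicalGroup G]
  [LocallyCompactSpace G] [T2Space G] {ω σ : G → ℝ}

/-- Bounded quasi-additive functions are inner. -/
lemma IsQuasiAdditive.isInnerQuasiAdditive [MeasurableSpace G] [BorelSpace G] (μ : Measure G)
    [μ.IsHaarMeasure] [μ.Regular] (hω : IsWeight ω) {p : G × G → ℂ} (hp : IsQuasiAdditive p) {C : ℝ}
    (hC : ∀ v, ‖p v‖ ≤ C) : IsInnerQuasiAdditive ω p := by
  let _ : MeasurableSpace (G × G) := borel _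
  have : BorelSpace (G × G) := ⟨rfl⟩
  let _ : MeasurableSpace (G × G × G) := borel _
  have : BorelSpace (G × G × G) := ⟨rfl⟩
  obtain ⟨ν, hν⟩ := exists_isProdHaar μ μ
  have := hν.haar
  have := hν.regular
  obtain ⟨ν₃, hν₃⟩ := exists_isProdHaar μ ν
  have := hν₃.haar
  have := hν₃.regular
  refine ⟨hp, ?_⟩
  obtain ⟨hm, hqa⟩ := (isQuasiAdditive_iff (ν₃ := ν₃)).1 hp
  -- The supremum argument needs real values, so real and imaginary parts are treated separately.
  obtain ⟨h₁, m₁, ⟨C₁, b₁⟩, e₁⟩ := hν.exists_coboundary_real hν₃ (p := fun v => (p v).re)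
    (by fun_prop) (fun v => (Complex.abs_re_le_norm _).trans (hC v)) (by
      filter_upwards [hqa] with t ht
      rw [ht, Complex.add_re])
  obtain ⟨h₂, m₂, ⟨C₂, b₂⟩, e₂⟩ := hν.exists_coboundary_real hν₃ (p := fun v => (p v).im)
    (by fun_prop) (fun v => (Complex.abs_im_le_norm _).trans (hC v)) (by
      filter_upwards [hqa] with t ht
      rw [ht, Complex.add_im])
  refine ⟨fun x => (h₁ x : ℂ) + h₂ x * Complex.I, (memLinf_iff (μ := μ)).2 ⟨by fun_prop, C₁ + C₂,
    Eventually.of_forall fun x => ?_⟩, ?_⟩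
  · refine (div_le_self (norm_nonneg _) (hω.one_le x)).trans ((norm_add_le _ _).trans ?_)
    rw [norm_mul, Complex.norm_I, mul_one, Complex.norm_real, Complex.norm_real]
    exact add_le_add (b₁ x) (b₂ x)
  · rw [locallyAE_eq_lae ν]
    filter_upwards [e₁, e₂] with v h1 h2
    apply Complex.ext
    · simpa using h1
    · simpa using h2

/-- A bounded σ makes the members of D bounded functions, hence coboundaries of a bounded h; as ω ≥
1, such an h is admissible for every weight ω. -/
lemma D_subset_I_of_bounded (hω : IsWeight ω) (hσ : IsWeight σ) (hb : ∃ C, ∀ x, σ x ≤ C) :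
    D σ ⊆ I ω := by
  let _ : MeasurableSpace G := borel G
  have : BorelSpace G := ⟨rfl⟩
  obtain ⟨C, hC⟩ := hb
  rintro _ ⟨p, ⟨hp, C', hC'⟩, rfl⟩
  refine ⟨p, hp.isInnerQuasiAdditive Measure.haar hω (C := max C' 0 * (C * C)) fun v => ?_, rfl⟩
  have h1 := hσ.pos v.1
  have h2 := hσ.pos v.2
  refine ((div_le_iff₀ (by positivity)).1 (hC' v.1 v.2)).trans ?_
  exact mul_le_mul (le_max_left _ _) (mul_le_mul (hC _) (hC _) h2.le (h1.le.trans (hC _)))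
    (by positivity) (le_max_right _ _)

lemma D_mono (hω : IsWeight ω) (h : ∀ x, ω x ≤ σ x) : D ω ⊆ D σ := by
  rintro _ ⟨p, ⟨hp, C, hC⟩, rfl⟩
  refine ⟨p, ⟨hp, C, fun x y => le_trans ?_ (hC x y)⟩, rfl⟩
  have h1 := hω.pos x
  have h2 := hω.pos y
  have h3 := h1.trans_le (h x)
  exact div_le_div_of_nonneg_left (norm_nonneg _) (mul_pos h1 h2)
    (mul_le_mul (h x) (h y) h2.le h3.le)

lemma IsWeight.star (hω : IsWeight ω) : IsWeight (star ω) where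
  continuous := hω.continuous.mul (hω.continuous.comp continuous_inv)
  one_le x := one_le_mul_of_one_le_of_one_le (hω.one_le x) (hω.one_le x⁻¹)
  mul_le x y := by
    have h1 := hω.pos
    calc Beurling.star ω (x * y) = ω (x * y) * ω (y⁻¹ * x⁻¹) := by
          rw [Beurling.star, mul_inv_rev]
      _ ≤ (ω x * ω y) * (ω y⁻¹ * ω x⁻¹) :=
          mul_le_mul (hω.mul_le _ _) (hω.mul_le _ _) (h1 _).le (mul_pos (h1 _) (h1 _)).le
      _ = _ := by
          simp only [Beurling.star]
          ring
  map_one := by simp [Beurling.star, hω.map_one]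

lemma IsWeight.le_star (hω : IsWeight ω) (x : G) : ω x ≤ Beurling.star ω x :=
  le_mul_of_one_le_right (hω.pos x).le (hω.one_le x⁻¹)

lemma I_eq_singleton_zero (hcomm : ∀ x y : G, x * y = y * x) : I ω = {0} := by
  ext q
  constructor
  · rintro ⟨p, ⟨-, h, -, hp⟩, rfl⟩
    refine Germ.coe_eq.2 ?_
    filter_upwards [hp] with t ht
    rw [ht, hcomm t.1 t.2, sub_self]
  · rintro rfl
    refine ⟨fun _ => 0, ⟨⟨@measurable_const _ _ _ (borel _) 0,
      Eventually.of_forall fun t => (add_zero 0).symm⟩, fun _ => 0,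
      ⟨@measurable_const _ _ _ (borel _) 0, 0, Eventually.of_forall fun x => by simp⟩,
      Eventually.of_forall fun t => (sub_zero 0).symm⟩, rfl⟩

end Main

end Beurling

theorem corollary3p6 {G : Type*} [Group G] [TopologicalSpace G] [IsTopologicalGroup G]
    [LocallyCompactSpace G] [T2Space G] [MeasurableSpace G] [BorelSpace G]
    (μ : MeasureTheory.Measure G) [μ.IsHaarMeasure] [μ.Regular]
    (ω : G → ℝ) (hω : Beurling.IsWeight ω) :
    ((∃ C : ℝ, ∀ x, Beurling.star ω x ≤ C) →
      Beurling.L1WeaklyAmenable μ ω ∧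
        Beurling.D (Beurling.star ω) = Beurling.I (Beurling.star ω)) ∧
    (Beurling.L1WeaklyAmenable μ (Beurling.star ω) →
      Beurling.I ω = Beurling.I (Beurling.star ω) →
        Beurling.L1WeaklyAmenable μ ω ∧
        Beurling.D ω = Beurling.D (Beurling.star ω) ∧
        ((∀ x y : G, x * y = y * x) → Beurling.D ω = {0})) ∧
    (Beurling.D (Beurling.star ω) = Beurling.I (Beurling.star ω) →
      Beurling.I (Beurling.star ω) = Beurling.I ω →
        Beurling.D ω = Beurling.I ω) := by
  have hs := hω.star
  have hDs : Beurling.D ω ⊆ Beurling.D (Beurling.star ω) := Beurling.D_mono hω hω.le_star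
  have hI := Beurling.I_subset_D μ hω
  have hIs := Beurling.I_subset_D μ hs
  refine ⟨fun hb => ⟨?_, ?_⟩, fun hA hII => ?_, fun hDI hII => ?_⟩
  · exact Beurling.l1WeaklyAmenable_of_D_subset_I μ hω
      (hDs.trans (Beurling.D_subset_I_of_bounded hω hs hb))
  · exact (Beurling.D_subset_I_of_bounded hs hs hb).antisymm hIs
  -- This closes the chain from `I ω` through `D ω` to `D (star ω)`, so all three sets coincide.
  · have h1 : Beurling.D (Beurling.star ω) ⊆ Beurling.I ω := by
      rw [hII]
      exact hA.D_subset_I μ hs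
    have h2 : Beurling.D ω = Beurling.I ω := (hDs.trans h1).antisymm hI
    refine ⟨Beurling.l1WeaklyAmenable_of_D_subset_I μ hω h2.subset,
      hDs.antisymm (h1.trans hI), fun hcomm => ?_⟩
    rw [h2, Beurling.I_eq_singleton_zero hcomm]
  · exact (hDs.trans (hDI.trans hII).subset).antisymm hI
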